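/- **Notation.** Let $\mathfrak g$ be a finite dimensional simple complex Lie algebra with Killing form $k$, let $\mathfrak h\subset\mathfrak g$ be a Cartan subalgebra and $\mathfrak b\supset\mathfrak h$ a Borel subalgebra. Let $\widehat{\mathfrak g}=\mathfrak g\otimes_{\mathbb C}\mathbb C[t,t^{-1}]\oplus\mathbb CK\oplus\mathbb CD$ be the affine Kac–Moody algebra, with bracket $[x\otimes t^n,y\otimes t^m]=[x,y]\otimes t^{n+m}+n\delta_{m,-n}k(x,y)K$, $[K,\widehat{\mathfrak g}]=0$, $[D,x\otimes t^n]=n\,x\otimes t^n$. Put $\widehat{\mathfrak h}=\mathfrak h\oplus\mathbb CK\oplus\mathbb CD$ and $\widehat{\mathfrak b}=\mathfrak g\otimes t\mathbb C[t]\oplus\mathfrak b\oplus\mathbb CK\oplus\mathbb CD$. For $\lambda,\mu\in\widehat{\mathfrak h}^\star$ write $\mu\le\lambda$ if $\lambda-\mu$ is a sum of roots of $\widehat{\mathfrak b}$ with respect to $\widehat{\mathfrak h}$. A set $\mathcal J\subset\widehat{\mathfrak h}^\star$ is *open* if $\mu\le\lambda\in\mathcal J$ implies $\mu\in\mathcal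 J$, and *locally bounded* if $\{\gamma\in\mathcal J\mid\gamma\ge\mu\}$ is finite for each $\mu\in\widehat{\mathfrak h}^\star$. Let $A$ be a commutative Noetherian local algebra over the symmetric algebra $S(\mathfrak h)$, with residue field $\mathbb K$. Let $\tau\colon\widehat{\mathfrak h}\to A$ be the map induced by $\mathfrak h\to S(\mathfrak h)\to A$ with $\tau(K)=\tau(D)=0$. A $\widehat{\mathfrak g}_A$-module is an $A$-module with an $A$-linear action of $\widehat{\mathfrak g}$; its weight spaces are $M_\lambda=\{m\mid Hm=(\lambda(H)+\tau(H))m\ \forall H\in\widehat{\mathfrak h}\}$. Let $\widehat{\mathcal O}_A$ be the full subcategory of the $\widehat{\mathfrak g}_A$-modules $M$ such that $M=\bigoplus_{\lambda\in\widehat{\mathfrak h}^\star}M_\lambda$ and each element of $M$ lies in an $A$-submodule that is stable under $\widehat{\mathfrak b}$ and finitely generated over $A$. For $n\in\mathbb Z$ let $T^n$ be the functor $M\mapsto M\otimes_{\mathbb C}L(n\delta)$ on $\widehat{\mathcal O}_A$, where $L(n\delta)$ is the one-dimensional $\widehat{\mathfrak g}$-module on which $D$ acts as $n$ and $\mathfrak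 g\otimes\mathbb C[t,t^{-1}]\oplus\mathbb CK$ acts as zero. Let $\mathcal A_n$ be the set of natural transformations $\sigma\colon\mathrm{id}_{\widehat{\mathcal O}_A}\to T^n$ with $T^m(\sigma^M)=\sigma^{T^mM}$ for all $m\in\mathbb Z$ and all $M$ in $\widehat{\mathcal O}_A$. Let $\overline{\mathcal O}_A\subset\widehat{\mathcal O}_A$ be the full subcategory of *restricted* objects, i.e. the $M$ with $\sigma^M=0$ for all $\sigma\in\mathcal A_n$, $n\ne0$. For $\lambda\in\widehat{\mathfrak h}^\star$ let $L_A(\lambda)$ be the simple quotient of the Verma module $U(\widehat{\mathfrak g})\otimes_{U(\widehat{\mathfrak b})}\mathbb K_\lambda$, regarded as a $\widehat{\mathfrak g}_A$-module. Here $\mathbb K_\lambda=\mathbb K$, with $\widehat{\mathfrak h}$ acting by $\lambda+\tau$ and $[\widehat{\mathfrak b},\widehat{\mathfrak b}]$ acting as zero. For $\mathcal J$ open and locally bounded and $\lambda\in\mathcal J$ let $\overline P_A^{\mathcal J}(\lambda)\to L_A(\lambda)$ be a projective cover in the full subcategory $\overline{\mathcal O}_A^{\mathcal J}$ of the $M$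 in $\overline{\mathcal O}_A$ such that $M_\mu\ne0$ implies $\mu\in\mathcal J$: a surjection $c$ from a projective object such that each morphism $g$ in $\overline{\mathcal O}_A^{\mathcal J}$ with $c\circ g$ surjective is itself surjective. Write $[M:L_A(\mu)]\neq0$ if $L_A(\mu)$ is isomorphic to a subquotient of $M$. Let $\overline\sim_A$ be the equivalence relation on $\widehat{\mathfrak h}^\star$ generated by: $\lambda\,\overline\sim_A\,\mu$ if $[\overline P_A^{\mathcal J}(\lambda):L_A(\mu)]\ne0$ for some open, locally bounded $\mathcal J$ containing $\lambda$. For an equivalence class $\Lambda$ let $\overline{\mathcal O}_{A,\Lambda}\subset\overline{\mathcal O}_A$ be the full subcategory of all $M$ such that $[M:L_A(\lambda)]\ne0$ implies $\lambda\in\Lambda$. **Theorem (Restricted block decomposition).** The functor $$\prod_{\Lambda\in\widehat{\mathfrak h}^\star/\overline\sim_A}\overline{\mathcal O}_{A,\Lambda}\to\overline{\mathcal O}_A,\qquad \{M_\Lambda\}\mapsto\bigoplus_\Lambda M_\Lambda$$ is an equivalence of categories. -/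

import Mathlib

open CategoryTheory
open scoped TensorProduct DirectSum

universe u

set_option linter.unusedSectionVars false

noncomputable section

namespace AffineO

/-! ### The affine Kac-Moody algebra -/

section Affine

variable {𝔤 : Type u} [LieRing 𝔤] [LieAlgebra ℂ 𝔤]

/-- The bilinear map on `𝔤 ⊗ ℂ[t, t⁻¹]` with `(x t ^ n, y t ^ m) ↦ B n m x y`. Here and below
`𝔤 ⊗ ℂ[t, t⁻¹]` is the space `ℤ →₀ 𝔤` of Laurent polynomials with coefficients in `𝔤`, and
`Finsupp.single n x` is `x ⊗ t ^ n`. -/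
def loopBilin {W : Type*} [AddCommGroup W] [Module ℂ W] (B : ℤ → ℤ → 𝔤 →ₗ[ℂ] 𝔤 →ₗ[ℂ] W) :
    (ℤ →₀ 𝔤) →ₗ[ℂ] (ℤ →₀ 𝔤) →ₗ[ℂ] W :=
  Finsupp.lsum ℂ fun n => (Finsupp.lsum ℂ fun m => (B n m).flip).flip

lemma loopBilin_single {W : Type*} [AddCommGroup W] [Module ℂ W]
    (B : ℤ → ℤ → 𝔤 →ₗ[ℂ] 𝔤 →ₗ[ℂ] W) (n m : ℤ) (x y : 𝔤) :
    loopBilin B (Finsupp.single n x) (Finsupp.single m y) = B n m x y := by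
  simp [loopBilin]

variable (𝔤)

/-- The bracket of the loop algebra: `[x t ^ n, y t ^ m] = [x, y] t ^ (n + m)`. -/
def loopBracket : (ℤ →₀ 𝔤) →ₗ[ℂ] (ℤ →₀ 𝔤) →ₗ[ℂ] (ℤ →₀ 𝔤) :=
  loopBilin fun n m =>
    (LieModule.toEnd ℂ 𝔤 𝔤 : 𝔤 →ₗ[ℂ] 𝔤 →ₗ[ℂ] 𝔤).compr₂ (Finsupp.lsingle (n + m))

/-- The cocycle `(x t ^ n, y t ^ m) ↦ n δ_{m,-n} k(x, y)`, where `k` is the Killing form. -/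
def loopCocycle : (ℤ →₀ 𝔤) →ₗ[ℂ] (ℤ →₀ 𝔤) →ₗ[ℂ] ℂ :=
  loopBilin fun n m => if m = -n then (n : ℂ) • killingForm ℂ 𝔤 else 0

/-- The operator `t ∂/∂t`, that is, `x t ^ n ↦ n x t ^ n`. -/
def euler : (ℤ →₀ 𝔤) →ₗ[ℂ] (ℤ →₀ 𝔤) :=
  Finsupp.lsum ℂ fun n => (n : ℂ) • Finsupp.lsingle n

/-- The affine Kac-Moody algebra `𝔤 ⊗ ℂ[t, t⁻¹] ⊕ ℂ K ⊕ ℂ D`. -/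
@[ext]
structure Affine : Type u where
  /-- the component in `𝔤 ⊗ ℂ[t, t⁻¹]` -/
  loop : ℤ →₀ 𝔤
  /-- the coefficient of `K` -/
  central : ℂ
  /-- the coefficient of `D` -/
  deriv : ℂ

/-- The underlying vector space is the direct sum. -/
def affineEquiv : Affine 𝔤 ≃ (ℤ →₀ 𝔤) × ℂ × ℂ where
  toFun x := (x.loop, x.central, x.deriv)
  invFun p := ⟨p.1, p.2.1, p.2.2⟩
  left_inv _ := rfl
  right_inv _ := rfl

instance : AddCommGroup (Affine 𝔤) := (affineEquiv 𝔤).addCommGroup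
instance : Module ℂ (Affine 𝔤) := (affineEquiv 𝔤).module ℂ

/-- The bracket
`[x t ^ n, y t ^ m] = [x, y] t ^ (n + m) + n δ_{m,-n} k(x, y) K`, `[K, -] = 0`,
`[D, x t ^ n] = n x t ^ n`. -/
instance : Bracket (Affine 𝔤) (Affine 𝔤) where
  bracket x y :=
    { loop := loopBracket 𝔤 x.loop y.loop + x.deriv • euler 𝔤 y.loop - y.deriv • euler 𝔤 x.loop
      central := loopCocycle 𝔤 x.loop y.loop
      deriv := 0 }

variable {𝔤}

@[simp] lemma loop_zero : (0 : Affine 𝔤).loop = 0 := rfl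
@[simp] lemma central_zero : (0 : Affine 𝔤).central = 0 := rfl
@[simp] lemma deriv_zero : (0 : Affine 𝔤).deriv = 0 := rfl
@[simp] lemma loop_add (x y : Affine 𝔤) : (x + y).loop = x.loop + y.loop := rfl
@[simp] lemma central_add (x y : Affine 𝔤) : (x + y).central = x.central + y.central := rfl
@[simp] lemma deriv_add (x y : Affine 𝔤) : (x + y).deriv = x.deriv + y.deriv := rfl
@[simp] lemma loop_smul (a : ℂ) (x : Affine 𝔤) : (a • x).loop = a • x.loop := rfl
@[simp] lemma central_smul (a : ℂ) (x : Affine 𝔤) : (a • x).central = a * x.central := rfl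
@[simp] lemma deriv_smul (a : ℂ) (x : Affine 𝔤) : (a • x).deriv = a * x.deriv := rfl

@[simp] lemma loop_lie (x y : Affine 𝔤) : ⁅x, y⁆.loop =
    loopBracket 𝔤 x.loop y.loop + x.deriv • euler 𝔤 y.loop - y.deriv • euler 𝔤 x.loop := rfl
@[simp] lemma central_lie (x y : Affine 𝔤) :
    ⁅x, y⁆.central = loopCocycle 𝔤 x.loop y.loop := rfl
@[simp] lemma deriv_lie (x y : Affine 𝔤) : ⁅x, y⁆.deriv = 0 := rfl

lemma loopBracket_single (n m : ℤ) (x y : 𝔤) :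
    loopBracket 𝔤 (Finsupp.single n x) (Finsupp.single m y) = Finsupp.single (n + m) ⁅x, y⁆ := by
  rw [loopBracket, loopBilin_single]; simp

lemma loopCocycle_single (n m : ℤ) (x y : 𝔤) :
    loopCocycle 𝔤 (Finsupp.single n x) (Finsupp.single m y) =
      if m = -n then (n : ℂ) * killingForm ℂ 𝔤 x y else 0 := by
  rw [loopCocycle, loopBilin_single]; split_ifs <;> simp

lemma euler_single (n : ℤ) (x : 𝔤) :
    euler 𝔤 (Finsupp.single n x) = (n : ℂ) • Finsupp.single n x := by
  simp [euler]

lemma euler_apply (x : ℤ →₀ 𝔤) (n : ℤ) : euler 𝔤 x n = (n : ℂ) • x n := by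
  induction x using Finsupp.induction_linear with
  | zero => simp
  | add x x' hx hx' => simp only [map_add, Finsupp.add_apply, hx, hx', smul_add]
  | single m x =>
    rw [euler_single, Finsupp.smul_apply, Finsupp.single_apply]
    split_ifs with h
    · rw [h]
    · simp

lemma loopBracket_apply (x y : ℤ →₀ 𝔤) (n : ℤ) :
    loopBracket 𝔤 x y n = x.sum fun i a => ⁅a, y (n - i)⁆ := by
  induction x using Finsupp.induction_linear with
  | zero => simp
  | add x x' hx hx' =>
    rw [map_add, LinearMap.add_apply, Finsupp.add_apply, hx, hx',
      Finsupp.sum_add_index' (by simp) (fun _ _ _ => add_lie _ _ _)]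
  | single i x =>
    rw [Finsupp.sum_single_index (zero_lie _)]
    induction y using Finsupp.induction_linear with
    | zero => simp
    | add y y' hy hy' => rw [map_add, Finsupp.add_apply, hy, hy', Finsupp.add_apply, lie_add]
    | single m y =>
      rw [loopBracket_single, Finsupp.single_apply, Finsupp.single_apply]
      by_cases h : i + m = n
      · rw [if_pos h, if_pos (by lia)]
      · rw [if_neg h, if_neg (by lia), lie_zero]

lemma loopBracket_skew (x y : ℤ →₀ 𝔤) : loopBracket 𝔤 x y = -loopBracket 𝔤 y x := by
  induction x using Finsupp.induction_linear with
  | zero => simp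
  | add x x' hx hx' => simp only [map_add, LinearMap.add_apply, hx, hx']; abel
  | single n x =>
    induction y using Finsupp.induction_linear with
    | zero => simp
    | add y y' hy hy' => simp only [map_add, LinearMap.add_apply, hy, hy']; abel
    | single m y =>
      rw [loopBracket_single, loopBracket_single, ← lie_skew x y, Finsupp.single_neg, add_comm]

lemma loopBracket_self (x : ℤ →₀ 𝔤) : loopBracket 𝔤 x x = 0 := by
  have h : (2 : ℂ) • loopBracket 𝔤 x x = 0 := by
    rw [two_smul]; nth_rw 1 [loopBracket_skew]; exact neg_add_cancel _
  exact (smul_eq_zero.mp h).resolve_left two_ne_zero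

lemma loopCocycle_skew (x y : ℤ →₀ 𝔤) : loopCocycle 𝔤 x y = -loopCocycle 𝔤 y x := by
  induction x using Finsupp.induction_linear with
  | zero => simp
  | add x x' hx hx' => simp only [map_add, LinearMap.add_apply, hx, hx']; ring
  | single n x =>
    induction y using Finsupp.induction_linear with
    | zero => simp
    | add y y' hy hy' => simp only [map_add, LinearMap.add_apply, hy, hy']; ring
    | single m y =>
      rw [loopCocycle_single, loopCocycle_single, LieModule.traceForm_comm ℂ 𝔤 𝔤 x y]
      by_cases h : m = -n
      · subst h; simp
      · rw [if_neg h, if_neg (by lia), neg_zero]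

lemma loopCocycle_self (x : ℤ →₀ 𝔤) : loopCocycle 𝔤 x x = 0 :=
  self_eq_neg.mp (loopCocycle_skew x x)

lemma loopBracket_jacobi (x y z : ℤ →₀ 𝔤) : loopBracket 𝔤 x (loopBracket 𝔤 y z) =
    loopBracket 𝔤 (loopBracket 𝔤 x y) z + loopBracket 𝔤 y (loopBracket 𝔤 x z) := by
  induction x using Finsupp.induction_linear with
  | zero => simp
  | add x x' hx hx' => simp only [map_add, LinearMap.add_apply, hx, hx']; abel
  | single n x =>
    induction y using Finsupp.induction_linear with
    | zero => simp
    | add y y' hy hy' => simp only [map_add, LinearMap.add_apply, hy, hy']; abel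
    | single m y =>
      induction z using Finsupp.induction_linear with
      | zero => simp
      | add z z' hz hz' => simp only [map_add, hz, hz']; abel
      | single l z =>
        simp only [loopBracket_single]
        rw [leibniz_lie x y z, Finsupp.single_add, add_assoc, add_left_comm]

lemma loopCocycle_jacobi (x y z : ℤ →₀ 𝔤) : loopCocycle 𝔤 x (loopBracket 𝔤 y z) =
    loopCocycle 𝔤 (loopBracket 𝔤 x y) z + loopCocycle 𝔤 y (loopBracket 𝔤 x z) := by
  induction x using Finsupp.induction_linear with
  | zero => simp
  | add x x' hx hx' => simp only [map_add, LinearMap.add_apply, hx, hx']; ring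
  | single n x =>
    induction y using Finsupp.induction_linear with
    | zero => simp
    | add y y' hy hy' => simp only [map_add, LinearMap.add_apply, hy, hy']; ring
    | single m y =>
      induction z using Finsupp.induction_linear with
      | zero => simp
      | add z z' hz hz' => simp only [map_add, hz, hz']; ring
      | single l z =>
        simp only [loopBracket_single, loopCocycle_single]
        by_cases h : n + m + l = 0
        · rw [if_pos (by lia), if_pos (by lia), if_pos (by lia)]
          have h1 : killingForm ℂ 𝔤 ⁅x, y⁆ z = killingForm ℂ 𝔤 x ⁅y, z⁆ :=
            LieModule.traceForm_apply_lie_apply ℂ 𝔤 𝔤 x y z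
          have h2 : killingForm ℂ 𝔤 ⁅y, x⁆ z = killingForm ℂ 𝔤 y ⁅x, z⁆ :=
            LieModule.traceForm_apply_lie_apply ℂ 𝔤 𝔤 y x z
          rw [← lie_skew y x, map_neg, LinearMap.neg_apply] at h2
          rw [← h1, ← h2]; push_cast; ring
        · rw [if_neg (by lia), if_neg (by lia), if_neg (by lia), add_zero]

lemma euler_loopBracket (x y : ℤ →₀ 𝔤) : euler 𝔤 (loopBracket 𝔤 x y) =
    loopBracket 𝔤 (euler 𝔤 x) y + loopBracket 𝔤 x (euler 𝔤 y) := by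
  induction x using Finsupp.induction_linear with
  | zero => simp
  | add x x' hx hx' => simp only [map_add, LinearMap.add_apply, hx, hx']; abel
  | single n x =>
    induction y using Finsupp.induction_linear with
    | zero => simp
    | add y y' hy hy' => simp only [map_add, hy, hy']; abel
    | single m y =>
      simp only [euler_single, map_smul, LinearMap.smul_apply, loopBracket_single, Int.cast_add,
        add_smul]

lemma loopCocycle_euler (x y : ℤ →₀ 𝔤) :
    loopCocycle 𝔤 (euler 𝔤 x) y + loopCocycle 𝔤 x (euler 𝔤 y) = 0 := by
  induction x using Finsupp.induction_linear with
  | zero => simp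
  | add x x' hx hx' =>
    simp only [map_add, LinearMap.add_apply]; linear_combination hx + hx'
  | single n x =>
    induction y using Finsupp.induction_linear with
    | zero => simp
    | add y y' hy hy' => simp only [map_add]; linear_combination hy + hy'
    | single m y =>
      simp only [euler_single, map_smul, LinearMap.smul_apply, loopCocycle_single, smul_eq_mul]
      split_ifs with h
      · subst h; push_cast; ring
      · ring

instance : LieRing (Affine 𝔤) where
  add_lie x y z := by
    ext1
    · simp only [loop_lie, loop_add, deriv_add, map_add, LinearMap.add_apply]; module
    · simp
    · simp
  lie_add x y z := by
    ext1
    · simp only [loop_lie, loop_add, deriv_add, map_add]; module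
    · simp
    · simp
  lie_self x := by
    ext1
    · simp [loopBracket_self]
    · simp [loopCocycle_self]
    · simp
  leibniz_lie x y z := by
    ext1
    · simp only [loop_lie, loop_add, deriv_lie, map_add, map_sub, map_smul, LinearMap.add_apply,
        LinearMap.sub_apply, LinearMap.smul_apply, euler_loopBracket,
        loopBracket_jacobi x.loop y.loop z.loop, loopBracket_skew (euler 𝔤 x.loop) y.loop]
      module
    · simp only [loop_lie, central_lie, central_add, map_add, map_sub, map_smul,
        LinearMap.add_apply, LinearMap.sub_apply, LinearMap.smul_apply, smul_eq_mul,
        loopCocycle_jacobi x.loop y.loop z.loop]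
      have h1 := loopCocycle_euler x.loop y.loop
      have h2 := loopCocycle_euler x.loop z.loop
      have h3 := loopCocycle_euler y.loop z.loop
      have h4 := loopCocycle_skew (euler 𝔤 x.loop) y.loop
      linear_combination (-z.deriv) * h1 - x.deriv * h3 + y.deriv * h2 + z.deriv * h4
    · simp

instance : LieAlgebra ℂ (Affine 𝔤) where
  lie_smul a x y := by
    ext1
    · simp only [loop_lie, loop_smul, deriv_smul, map_smul]; module
    · simp
    · simp

end Affine

/-! ### Cartan and Borel subalgebras, roots, weights -/

section Weights

variable {𝔤 : Type u} [LieRing 𝔤] [LieAlgebra ℂ 𝔤]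

/-- A Borel subalgebra is a maximal solvable subalgebra. -/
def IsBorel (𝔟 : LieSubalgebra ℂ 𝔤) : Prop :=
  Maximal (fun 𝔠 : LieSubalgebra ℂ 𝔤 => LieAlgebra.IsSolvable 𝔠) 𝔟

/-- The affine Cartan subalgebra `𝔥 ⊕ ℂ K ⊕ ℂ D` as a vector space. -/
abbrev CartanHat (𝔥 : LieSubalgebra ℂ 𝔤) : Type u := 𝔥 × ℂ × ℂ

/-- The inclusion of the affine Cartan subalgebra into the affine Kac-Moody algebra. -/
def cartanIncl (𝔥 : LieSubalgebra ℂ 𝔤) : CartanHat 𝔥 →ₗ[ℂ] Affine 𝔤 where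
  toFun H := { loop := Finsupp.single 0 (H.1 : 𝔤), central := H.2.1, deriv := H.2.2 }
  map_add' H H' := by ext1 <;> simp
  map_smul' a H := by ext1 <;> simp

/-- The affine Borel subalgebra `𝔤 ⊗ t ℂ[t] ⊕ 𝔟 ⊕ ℂ K ⊕ ℂ D`. -/
def borelHat (𝔟 : LieSubalgebra ℂ 𝔤) : LieSubalgebra ℂ (Affine 𝔤) where
  carrier := {x | (∀ n < 0, x.loop n = 0) ∧ x.loop 0 ∈ 𝔟}
  zero_mem' := ⟨fun _ _ => rfl, 𝔟.zero_mem⟩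
  add_mem' {x y} hx hy :=
    ⟨fun n hn => by simp [hx.1 n hn, hy.1 n hn], by simpa using 𝔟.add_mem hx.2 hy.2⟩
  smul_mem' a x hx := ⟨fun n hn => by simp [hx.1 n hn], by simpa using 𝔟.smul_mem a hx.2⟩
  lie_mem' {x y} hx hy := by
    refine ⟨fun n hn => ?_, ?_⟩
    · rw [loop_lie, Finsupp.sub_apply, Finsupp.add_apply, Finsupp.smul_apply, Finsupp.smul_apply,
        euler_apply, euler_apply, hx.1 n hn, hy.1 n hn, loopBracket_apply, Finsupp.sum,
        Finset.sum_eq_zero]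
      · simp
      · intro i _
        rcases lt_or_ge i 0 with hi | hi
        · rw [hx.1 i hi, zero_lie]
        · rw [hy.1 (n - i) (by lia), lie_zero]
    · change (loopBracket 𝔤 x.loop y.loop + x.deriv • euler 𝔤 y.loop -
        y.deriv • euler 𝔤 x.loop) 0 ∈ 𝔟
      rw [Finsupp.sub_apply, Finsupp.add_apply, Finsupp.smul_apply, Finsupp.smul_apply,
        euler_apply, euler_apply, Int.cast_zero, zero_smul, zero_smul, smul_zero, smul_zero,
        add_zero, sub_zero, loopBracket_apply]
      refine sum_mem fun i _ => ?_
      change ⁅x.loop i, y.loop (0 - i)⁆ ∈ 𝔟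
      rcases lt_trichotomy i 0 with hi | hi | hi
      · rw [hx.1 i hi, zero_lie]; exact 𝔟.zero_mem
      · subst hi; rw [sub_zero]; exact 𝔟.lie_mem hx.2 hy.2
      · rw [hy.1 (0 - i) (by lia), lie_zero]; exact 𝔟.zero_mem

/-- The dual of the affine Cartan subalgebra. -/
abbrev Wt (𝔥 : LieSubalgebra ℂ 𝔤) : Type u := Module.Dual ℂ (CartanHat 𝔥)

/-- The inclusion of the dual of `𝔥` into the dual of the affine Cartan subalgebra. -/
def wtIncl {𝔥 : LieSubalgebra ℂ 𝔤} (α : Module.Dual ℂ 𝔥) : Wt 𝔥 :=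
  α ∘ₗ LinearMap.fst ℂ 𝔥 (ℂ × ℂ)

/-- The weight `δ`: zero on `𝔥 ⊕ ℂ K`, one on `D`. -/
def delta (𝔥 : LieSubalgebra ℂ 𝔤) : Wt 𝔥 :=
  LinearMap.snd ℂ ℂ ℂ ∘ₗ LinearMap.snd ℂ 𝔥 (ℂ × ℂ)

variable (𝔥 : LieSubalgebra ℂ 𝔤) [LieRing.IsNilpotent 𝔥] (𝔟 : LieSubalgebra ℂ 𝔤)

/-- The roots of `𝔤` with respect to `𝔥`. -/
def roots : Set (Module.Dual ℂ 𝔥) :=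
  {α | α ≠ 0 ∧ LieAlgebra.rootSpace 𝔥 (α : 𝔥 → ℂ) ≠ ⊥}

/-- The positive roots, i.e. the roots of `𝔟`. -/
def posRoots : Set (Module.Dual ℂ 𝔥) :=
  {α | α ∈ roots 𝔥 ∧ ∀ x ∈ LieAlgebra.rootSpace 𝔥 (α : 𝔥 → ℂ), x ∈ 𝔟}

/-- The positive affine roots. -/
def posAffineRoots : Set (Wt 𝔥) :=
  {γ | (∃ α ∈ posRoots 𝔥 𝔟, γ = wtIncl α) ∨
    (∃ α ∈ roots 𝔥, ∃ n : ℕ, 0 < n ∧ γ = wtIncl α + n • delta 𝔥) ∨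
    (∃ n : ℕ, 0 < n ∧ γ = n • delta 𝔥)}

/-- The order on weights: `μ ≤ lam` if `lam - μ` is a sum of positive affine roots. -/
def WtLE (μ lam : Wt 𝔥) : Prop := lam - μ ∈ AddSubmonoid.closure (posAffineRoots 𝔥 𝔟)

/-- A set of weights is open if it is closed downwards. -/
def IsOpenWt (J : Set (Wt 𝔥)) : Prop := ∀ lam ∈ J, ∀ μ, WtLE 𝔥 𝔟 μ lam → μ ∈ J

/-- A set `J` of weights is locally bounded if each `{γ ∈ J | μ ≤ γ}` is finite. -/
def IsLocallyBoundedWt (J : Set (Wt 𝔥)) : Prop := ∀ μ, {γ ∈ J | WtLE 𝔥 𝔟 μ γ}.Finite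

end Weights

/-! ### The deformed category `O` -/

section Modules

variable (𝔤 : Type u) [LieRing 𝔤] [LieAlgebra ℂ 𝔤] (A : Type u) [CommRing A] [Algebra ℂ A]

/-- The algebra `A ⊗ U(𝔤̂)`. A module over it is an `A`-module with an `A`-linear action
of the affine Kac-Moody algebra `𝔤̂`, the two `ℂ`-actions being the same. -/
abbrev Env : Type u := A ⊗[ℂ] UniversalEnvelopingAlgebra ℂ (Affine 𝔤)

/-- The category of `𝔤̂_A`-modules. -/
abbrev GMod := ModuleCat.{u} (Env 𝔤 A)

variable {𝔤}

/-- The element of `A ⊗ U(𝔤̂)` through which `x ∈ 𝔤̂` acts on modules. -/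
def act (x : Affine 𝔤) : Env 𝔤 A := 1 ⊗ₜ UniversalEnvelopingAlgebra.ι ℂ x

variable {A}

/-- The `A`-module underlying a `𝔤̂_A`-module. -/
instance (M : GMod 𝔤 A) : Module A M := Module.compHom M (algebraMap A (Env 𝔤 A))

lemma smul_eq (M : GMod 𝔤 A) (a : A) (m : M) : a • m = algebraMap A (Env 𝔤 A) a • m := rfl

instance (M : GMod 𝔤 A) : IsScalarTower A (Env 𝔤 A) M where
  smul_assoc a e m := by rw [smul_eq, smul_smul, Algebra.smul_def]

variable (𝔥 𝔟 : LieSubalgebra ℂ 𝔤) [Algebra (SymmetricAlgebra ℂ 𝔥) A]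

/-- The canonical map from the affine Cartan subalgebra to a deformation algebra; it vanishes
on `K` and `D`. -/
def tau (A : Type u) [CommRing A] [Algebra (SymmetricAlgebra ℂ 𝔥) A] (H : CartanHat 𝔥) : A :=
  algebraMap (SymmetricAlgebra ℂ 𝔥) A (SymmetricAlgebra.ι ℂ 𝔥 H.1)

/-- The weight space `M_lam`, on which `H` acts as `lam(H) + τ(H)`. -/
def weightSpace (M : GMod 𝔤 A) (lam : Wt 𝔥) : Submodule A M where
  carrier := {m | ∀ H : CartanHat 𝔥,
    act A (cartanIncl 𝔥 H) • m = (algebraMap ℂ A (lam H) + tau 𝔥 A H) • m}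
  zero_mem' H := by rw [smul_zero, smul_zero]
  add_mem' hx hy H := by rw [smul_add, smul_add, hx H, hy H]
  smul_mem' a x hx H := by
    rw [← smul_comm a, hx H, smul_comm]

open Classical in
/-- `M` is a weight module: it is the direct sum of its weight spaces. -/
def IsWeightModule (M : GMod 𝔤 A) : Prop :=
  DirectSum.IsInternal fun lam : Wt 𝔥 => weightSpace 𝔥 M lam

/-- `M` is locally `𝔟̂_A`-finite: each element lies in a `𝔟̂_A`-submodule that is finitely
generated over `A`. -/
def IsLocallyFinite (M : GMod 𝔤 A) : Prop :=
  ∀ m : M, ∃ N : Submodule A M, m ∈ N ∧ N.FG ∧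
    ∀ x ∈ borelHat 𝔟, ∀ v ∈ N, act A x • v ∈ N

variable (A) in
/-- The deformed category `O` of all locally `𝔟̂_A`-finite weight modules, as a full subcategory
of the category of `𝔤̂_A`-modules. -/
def catO : ObjectProperty (GMod 𝔤 A) := fun M => IsWeightModule 𝔥 M ∧ IsLocallyFinite 𝔟 M


/-! ### The shift functors and the graded centre -/

lemma weightSpace_indep (M : GMod 𝔤 A) :
    iSupIndep fun lam : Wt 𝔥 => weightSpace 𝔥 M lam := by
  classical
  rw [iSupIndep_iff_finsetSum_eq_zero_imp_eq_zero]
  intro s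
  induction s using Finset.induction_on with
  | empty => simp
  | insert μ s hμ ih =>
    intro v hv hsum
    rw [Finset.sum_insert hμ] at hsum
    have hw (lam : Wt 𝔥) (hl : lam ∈ insert μ s) (H : CartanHat 𝔥) :
        act A (cartanIncl 𝔥 H) • v lam = (algebraMap ℂ A (lam H) + tau 𝔥 A H) • v lam :=
      hv lam hl H
    have key : ∀ lam ∈ s, ∀ H : CartanHat 𝔥, algebraMap ℂ A (lam H - μ H) • v lam = 0 := by
      intro lam hl H
      refine ih (fun lam => algebraMap ℂ A (lam H - μ H) • v lam)
        (fun i hi => Submodule.smul_mem _ _ (hv i (Finset.mem_insert_of_mem hi))) ?_ lam hl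
      have h1 : act A (cartanIncl 𝔥 H) • (v μ + ∑ i ∈ s, v i) -
          (algebraMap ℂ A (μ H) + tau 𝔥 A H) • (v μ + ∑ i ∈ s, v i) = 0 := by
        rw [hsum, smul_zero, smul_zero, sub_zero]
      rw [smul_add, smul_add, hw μ (Finset.mem_insert_self _ _) H, add_sub_add_left_eq_sub,
        Finset.smul_sum, Finset.smul_sum, ← Finset.sum_sub_distrib] at h1
      rw [← h1]
      refine Finset.sum_congr rfl fun i hi => ?_
      rw [hw i (Finset.mem_insert_of_mem hi) H, ← sub_smul, map_sub]
      congr 1; ring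
    have hz : ∀ lam ∈ s, v lam = 0 := by
      intro lam hl
      obtain ⟨H, hH⟩ : ∃ H, lam H ≠ μ H := by
        by_contra! hc
        exact hμ (LinearMap.ext hc ▸ hl)
      have hu : IsUnit (algebraMap ℂ A (lam H - μ H)) :=
        (IsUnit.mk0 _ (sub_ne_zero.mpr hH)).map _
      exact hu.smul_eq_zero.mp (key lam hl H)
    intro i hi
    rcases Finset.mem_insert.mp hi with rfl | hi
    · rwa [Finset.sum_eq_zero hz, add_zero] at hsum
    · exact hz i hi

lemma isWeightModule_iff (M : GMod 𝔤 A) :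
    IsWeightModule 𝔥 M ↔ ⨆ lam : Wt 𝔥, weightSpace 𝔥 M lam = ⊤ := by
  classical
  rw [IsWeightModule, DirectSum.isInternal_submodule_iff_iSupIndep_and_iSup_eq_top]
  exact ⟨fun h => h.2, fun h => ⟨weightSpace_indep 𝔥 M, h⟩⟩

/-- The map `x ↦ x + n δ(x)` from `𝔤̂` to `U(𝔤̂)`, where `δ(x)` is the coefficient of `D`
in `x`. -/
def shiftLie (𝔤 : Type u) [LieRing 𝔤] [LieAlgebra ℂ 𝔤] (n : ℤ) :
    letI : LieRing (UniversalEnvelopingAlgebra ℂ (Affine 𝔤)) := LieRing.ofAssociativeRing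
    Affine 𝔤 →ₗ⁅ℂ⁆ UniversalEnvelopingAlgebra ℂ (Affine 𝔤) :=
  letI : LieRing (UniversalEnvelopingAlgebra ℂ (Affine 𝔤)) := LieRing.ofAssociativeRing
  { toFun x := UniversalEnvelopingAlgebra.ι ℂ x + algebraMap ℂ _ (n * x.deriv)
    map_add' x y := by
      simp only [map_add, deriv_add, mul_add]; abel
    map_smul' a x := by
      simp only [map_smul, deriv_smul, RingHom.id_apply, smul_add, Algebra.algebraMap_eq_smul_one,
        smul_smul]
      rw [mul_left_comm]
    map_lie' {x y} := by
      rw [LieRing.of_associative_ring_bracket, LieHom.map_lie, LieRing.of_associative_ring_bracket,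
        deriv_lie, mul_zero, map_zero, add_zero]
      have h1 := Algebra.commutes (n * x.deriv : ℂ) (UniversalEnvelopingAlgebra.ι ℂ y)
      have h2 := Algebra.commutes (n * y.deriv : ℂ) (UniversalEnvelopingAlgebra.ι ℂ x)
      have h3 := Algebra.commutes (n * y.deriv : ℂ)
        (algebraMap ℂ (UniversalEnvelopingAlgebra ℂ (Affine 𝔤)) (n * x.deriv))
      simp only [mul_add, add_mul, h1, h2, h3]
      abel }

/-- The endomorphism of `A ⊗ U(𝔤̂)` with `x ↦ x + n δ(x)` for `x ∈ 𝔤̂`. -/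
def shiftHom (𝔤 : Type u) [LieRing 𝔤] [LieAlgebra ℂ 𝔤] (A : Type u) [CommRing A] [Algebra ℂ A]
    (n : ℤ) : Env 𝔤 A →ₐ[A] Env 𝔤 A :=
  Algebra.TensorProduct.map (AlgHom.id A A) (UniversalEnvelopingAlgebra.lift ℂ (shiftLie 𝔤 n))

/-- The functor `T ^ n = - ⊗ L(nδ)` on `𝔤̂_A`-modules, where `L(nδ)` is the one-dimensional
`𝔤̂`-module on which `x` acts as the scalar `n δ(x)`: the `A`-module is unchanged, and
`x ∈ 𝔤̂` acts as `x + n δ(x)`. -/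
def shiftMod (𝔤 : Type u) [LieRing 𝔤] [LieAlgebra ℂ 𝔤] (A : Type u) [CommRing A] [Algebra ℂ A]
    (n : ℤ) : GMod 𝔤 A ⥤ GMod 𝔤 A :=
  ModuleCat.restrictScalars (shiftHom 𝔤 A n : Env 𝔤 A →+* Env 𝔤 A)

/-- The identity map from `M` to `T ^ n M`. -/
def toShift (n : ℤ) (M : GMod 𝔤 A) : M ≃ₗ[A] (shiftMod 𝔤 A n).obj M where
  toFun m := m
  invFun m := m
  map_add' _ _ := rfl
  map_smul' a m := by
    change algebraMap A (Env 𝔤 A) a • m = shiftHom 𝔤 A n (algebraMap A (Env 𝔤 A) a) • m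
    rw [AlgHom.commutes]
  left_inv _ := rfl
  right_inv _ := rfl

/-- The action of `𝔤̂` on `T ^ n M = M ⊗ L(nδ)`. -/
lemma act_toShift (n : ℤ) (M : GMod 𝔤 A) (x : Affine 𝔤) (m : M) :
    act A x • toShift n M m =
      toShift n M (act A x • m + algebraMap ℂ A (n * x.deriv) • m) := by
  change shiftHom 𝔤 A n (act A x) • m = act A x • m + algebraMap A (Env 𝔤 A) _ • m
  rw [← add_smul]
  congr 1
  rw [shiftHom, act, Algebra.TensorProduct.map_tmul, UniversalEnvelopingAlgebra.lift_ι_apply]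
  change (1 : A) ⊗ₜ (UniversalEnvelopingAlgebra.ι ℂ x + algebraMap ℂ _ (n * x.deriv)) = _
  rw [TensorProduct.tmul_add, Algebra.algebraMap_eq_smul_one, ← TensorProduct.smul_tmul,
    ← Algebra.algebraMap_eq_smul_one]
  rfl

lemma catO_shift (n : ℤ) (M : GMod 𝔤 A) (hM : catO A 𝔥 𝔟 M) :
    catO A 𝔥 𝔟 ((shiftMod 𝔤 A n).obj M) := by
  refine ⟨?_, fun m => ?_⟩
  · rw [isWeightModule_iff, eq_top_iff]
    have h := (isWeightModule_iff 𝔥 M).mp hM.1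
    rw [← (LinearEquiv.range (toShift n M)), ← Submodule.map_top, ← h, Submodule.map_iSup]
    refine iSup_le fun lam => le_iSup_of_le (lam + n • delta 𝔥) ?_
    rintro _ ⟨m, hm, rfl⟩ H
    change act A _ • toShift n M m = _ • toShift n M m
    rw [act_toShift, ← map_smul, hm H, ← add_smul]
    congr 2
    have : algebraMap ℂ A ((lam + n • delta 𝔥) H) =
        algebraMap ℂ A (lam H) + algebraMap ℂ A (n * (cartanIncl 𝔥 H).deriv) := by
      rw [← map_add]
      simp [delta, cartanIncl]
    rw [this]; abel
  · obtain ⟨N, hmN, hN, hs⟩ := hM.2 ((toShift n M).symm m)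
    refine ⟨N.map (toShift n M : M →ₗ[A] (shiftMod 𝔤 A n).obj M), ⟨_, hmN, rfl⟩, hN.map _, ?_⟩
    rintro x hx _ ⟨v, hv, rfl⟩
    exact ⟨_, N.add_mem (hs x hx v hv) (N.smul_mem _ hv), (act_toShift n M x v).symm⟩

variable (A) in
/-- The autoequivalence `T ^ n` of the category `O`. -/
def shiftO (n : ℤ) : (catO A 𝔥 𝔟).FullSubcategory ⥤ (catO A 𝔥 𝔟).FullSubcategory :=
  (catO A 𝔥 𝔟).lift ((catO A 𝔥 𝔟).ι ⋙ shiftMod 𝔤 A n) fun M => catO_shift 𝔥 𝔟 n M.obj M.property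

variable {𝔥 𝔟} in
/-- The component at `M` of a natural transformation `id ⟶ T ^ n`, as a map on the elements
of `M`. -/
def component {n : ℤ} (τ : 𝟭 (catO A 𝔥 𝔟).FullSubcategory ⟶ shiftO A 𝔥 𝔟 n)
    (M : (catO A 𝔥 𝔟).FullSubcategory) (v : M.obj) : M.obj :=
  let f : M.obj ⟶ (shiftMod 𝔤 A n).obj M.obj := (τ.app M).hom
  (toShift n M.obj).symm (f.hom v)

variable (A) in
/-- The degree `n` part of the graded centre of the category `O`: the natural transformations
`τ : id ⟶ T ^ n` such that `T ^ m (τ^M) = τ^(T ^ m M)` for all `m` and `M`. This is stated on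
elements: `T ^ m T ^ n M` and `T ^ n T ^ m M` both have the elements of `M`, and `T ^ m` does not
change the map underlying a morphism. -/
def gradedCenter (n : ℤ) : Set (𝟭 (catO A 𝔥 𝔟).FullSubcategory ⟶ shiftO A 𝔥 𝔟 n) :=
  {τ | ∀ (m : ℤ) (M : (catO A 𝔥 𝔟).FullSubcategory) (v : M.obj),
    component τ ((shiftO A 𝔥 𝔟 m).obj M) (toShift m M.obj v) = toShift m M.obj (component τ M v)}

variable (A) in
/-- The restricted category `O` of all `M` in the category `O` such that `τ^M = 0` for all `τ` of
degree `n ≠ 0` in the graded centre. -/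
def resO : ObjectProperty (GMod 𝔤 A) := fun M =>
  ∃ h : catO A 𝔥 𝔟 M, ∀ n : ℤ, n ≠ 0 → ∀ τ ∈ gradedCenter A 𝔥 𝔟 n, τ.app ⟨M, h⟩ = 0


/-! ### Verma modules and simple objects -/

/-- The deformed Verma module `U(𝔤̂) ⊗_{U(𝔟̂)} A_lam`, where `A_lam` is free of rank one over `A`,
`H` acts on it as `lam(H) + τ(H)`, and `[𝔟̂, 𝔟̂]` acts as zero: the quotient of `A ⊗ U(𝔤̂)` by the
left ideal generated by all `H - (lam(H) + τ(H))` and by `[𝔟̂, 𝔟̂]`. -/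
def verma (A : Type u) [CommRing A] [Algebra ℂ A] [Algebra (SymmetricAlgebra ℂ 𝔥) A]
    (lam : Wt 𝔥) : GMod 𝔤 A :=
  ModuleCat.of (Env 𝔤 A) (Env 𝔤 A ⧸ Submodule.span (Env 𝔤 A)
    ({e | ∃ H : CartanHat 𝔥, e = act A (cartanIncl 𝔥 H) -
        algebraMap A (Env 𝔤 A) (algebraMap ℂ A (lam H) + tau 𝔥 A H)} ∪
      {e | ∃ x ∈ borelHat 𝔟, ∃ y ∈ borelHat 𝔟, e = act A ⁅x, y⁆}))

/-- The quotient of the Verma module by its largest proper submodule (the sum of all proper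
submodules). Over a field this is the simple quotient. -/
def simpleQuotient (A : Type u) [CommRing A] [Algebra ℂ A] [Algebra (SymmetricAlgebra ℂ 𝔥) A]
    (lam : Wt 𝔥) : GMod 𝔤 A :=
  ModuleCat.of (Env 𝔤 A) (verma 𝔥 𝔟 A lam ⧸
    sSup {N : Submodule (Env 𝔤 A) (verma 𝔥 𝔟 A lam) | N ≠ ⊤})

variable (𝔤 A) in
/-- The base change `A ⊗ U(𝔤̂) → K ⊗ U(𝔤̂)` to the residue field `K` of `A`. -/
def residueHom [IsLocalRing A] : Env 𝔤 A →ₐ[ℂ] Env 𝔤 (IsLocalRing.ResidueField A) :=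
  Algebra.TensorProduct.map (IsScalarTower.toAlgHom ℂ A (IsLocalRing.ResidueField A))
    (AlgHom.id ℂ _)

variable (A) in
/-- The simple object `L_A(lam)`: the simple quotient `L_K(lam)` of the Verma module over the
residue field `K`, regarded as a `𝔤̂_A`-module. -/
def simpleL [IsLocalRing A] (lam : Wt 𝔥) : GMod 𝔤 A :=
  (ModuleCat.restrictScalars (residueHom 𝔤 A : Env 𝔤 A →+* Env 𝔤 (IsLocalRing.ResidueField A))).obj
    (simpleQuotient 𝔥 𝔟 (IsLocalRing.ResidueField A) lam)

/-- `L` is isomorphic to a subquotient of `M`, i.e. `[M : L] ≠ 0`. -/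
def IsSubquotient (L M : GMod 𝔤 A) : Prop :=
  ∃ (N : Submodule (Env 𝔤 A) M) (N' : Submodule (Env 𝔤 A) N),
    Nonempty ((N ⧸ N') ≃ₗ[Env 𝔤 A] L)

/-! ### Truncation, projective covers and blocks -/

variable [LieRing.IsNilpotent 𝔥]

variable (A) in
/-- The truncated restricted category: restricted objects whose weights lie in `J`. -/
def resOTrunc (J : Set (Wt 𝔥)) : ObjectProperty (GMod 𝔤 A) := fun M =>
  resO A 𝔥 𝔟 M ∧ ∀ lam : Wt 𝔥, weightSpace 𝔥 M lam ≠ ⊥ → lam ∈ J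

variable {𝔥 𝔟} in
/-- A morphism `c : P ⟶ L` in the truncated restricted category is a projective cover if `P` is
projective, `c` is surjective, and each `g : M ⟶ P` with `c ∘ g` surjective is surjective. -/
def IsProjectiveCover {J : Set (Wt 𝔥)} {P L : (resOTrunc A 𝔥 𝔟 J).FullSubcategory}
    (c : P ⟶ L) : Prop :=
  Projective P ∧ Function.Surjective c.hom.hom ∧
    ∀ (M : (resOTrunc A 𝔥 𝔟 J).FullSubcategory) (g : M ⟶ P),
      Function.Surjective (g ≫ c).hom.hom → Function.Surjective g.hom.hom

variable (A) in
/-- `[P : L_A(μ)] ≠ 0` for a projective cover `P` of `L_A(lam)` in the restricted category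
truncated by some open, locally bounded set `J` of weights. -/
def resLinked [IsLocalRing A] (lam μ : Wt 𝔥) : Prop :=
  ∃ J : Set (Wt 𝔥), IsOpenWt 𝔥 𝔟 J ∧ IsLocallyBoundedWt 𝔥 𝔟 J ∧ lam ∈ J ∧
    ∃ (hL : resOTrunc A 𝔥 𝔟 J (simpleL A 𝔥 𝔟 lam)) (P : (resOTrunc A 𝔥 𝔟 J).FullSubcategory)
      (c : P ⟶ ⟨simpleL A 𝔥 𝔟 lam, hL⟩),
      IsProjectiveCover c ∧ IsSubquotient (simpleL A 𝔥 𝔟 μ) P.obj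

variable (A) in
/-- The equivalence relation on weights generated by `resLinked`. -/
def resSetoid [IsLocalRing A] : Setoid (Wt 𝔥) := Relation.EqvGen.setoid (resLinked A 𝔥 𝔟)

variable (A) in
/-- The subcategory of the restricted category `O` attached to an equivalence class `Λ`: all `M`
such that `L_A(lam)` is a subquotient of `M` only if `lam ∈ Λ`. -/
def resBlock [IsLocalRing A] (Λ : Quotient (resSetoid A 𝔥 𝔟)) : ObjectProperty (GMod 𝔤 A) :=
  fun M => resO A 𝔥 𝔟 M ∧
    ∀ lam : Wt 𝔥, IsSubquotient (simpleL A 𝔥 𝔟 lam) M → Quotient.mk (resSetoid A 𝔥 𝔟) lam = Λ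

/-- The direct sum of a family of `𝔤̂_A`-modules. -/
def directSum {I : Type u} (M : I → GMod 𝔤 A) : GMod 𝔤 A :=
  ModuleCat.of (Env 𝔤 A) (⨁ i, M i)

open Classical in
/-- The inclusion of a summand. -/
def inclSum {I : Type u} (M : I → GMod 𝔤 A) (i : I) : M i ⟶ directSum M :=
  ModuleCat.ofHom (DirectSum.lof (Env 𝔤 A) I (fun i => M i) i)

open Classical in
lemma directSum_induction {I : Type u} (M : I → GMod 𝔤 A) {p : directSum M → Prop}
    (h0 : p 0) (h1 : ∀ i (m : M i), p ((inclSum M i).hom m))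
    (ha : ∀ x y, p x → p y → p (x + y)) (x : directSum M) : p x :=
  DirectSum.induction_on (β := fun i => (M i : Type u)) x h0 (fun i m => h1 i m) ha

/-- A morphism of `𝔤̂_A`-modules is `A`-linear. -/
def homA {M N : GMod 𝔤 A} (f : M ⟶ N) : M →ₗ[A] N where
  toFun := f.hom
  map_add' := f.hom.map_add
  map_smul' a m := f.hom.map_smul (algebraMap A (Env 𝔤 A) a) m

lemma directSum_catO {I : Type u} (M : I → GMod 𝔤 A) (hM : ∀ i, catO A 𝔥 𝔟 (M i)) :
    catO A 𝔥 𝔟 (directSum M) := by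
  refine ⟨?_, fun m => ?_⟩
  · rw [isWeightModule_iff, eq_top_iff]
    intro m _
    induction m using directSum_induction with
    | h0 => exact Submodule.zero_mem _
    | ha x y hx hy => exact Submodule.add_mem _ (hx trivial) (hy trivial)
    | h1 i m =>
      have h : m ∈ ⨆ lam : Wt 𝔥, weightSpace 𝔥 (M i) lam := by
        rw [(isWeightModule_iff 𝔥 (M i)).mp (hM i).1]; trivial
      have h2 := Submodule.mem_map_of_mem (f := homA (inclSum M i)) h
      rw [Submodule.map_iSup] at h2
      have hle : ⨆ lam : Wt 𝔥, (weightSpace 𝔥 (M i) lam).map (homA (inclSum M i)) ≤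
          ⨆ lam : Wt 𝔥, weightSpace 𝔥 (directSum M) lam := iSup_mono fun lam => ?_
      · exact hle h2
      rintro _ ⟨v, hv, rfl⟩ H
      change act A _ • (inclSum M i).hom v = (_ : A) • homA (inclSum M i) v
      rw [← map_smul, ← map_smul, hv H]
      rfl
  · induction m using directSum_induction with
    | h0 => exact ⟨⊥, Submodule.zero_mem _, Submodule.fg_bot, fun x _ v hv => by
        rw [(Submodule.mem_bot A).mp hv, smul_zero]; exact Submodule.zero_mem _⟩
    | ha x y hx hy =>
      obtain ⟨N, h1, h2, h3⟩ := hx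
      obtain ⟨N', h1', h2', h3'⟩ := hy
      refine ⟨N ⊔ N', Submodule.add_mem_sup h1 h1', h2.sup h2', fun x hx v hv => ?_⟩
      obtain ⟨a, ha, b, hb, rfl⟩ := Submodule.mem_sup.mp hv
      rw [smul_add]
      exact Submodule.add_mem_sup (h3 x hx a ha) (h3' x hx b hb)
    | h1 i m =>
      obtain ⟨N, h1, h2, h3⟩ := (hM i).2 m
      refine ⟨N.map (homA (inclSum M i)), ⟨m, h1, rfl⟩, h2.map _, ?_⟩
      rintro x hx _ ⟨v, hv, rfl⟩
      exact ⟨_, h3 x hx v hv, (inclSum M i).hom.map_smul _ _⟩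

lemma directSum_resO {I : Type u} (M : I → GMod 𝔤 A) (hM : ∀ i, resO A 𝔥 𝔟 (M i)) :
    resO A 𝔥 𝔟 (directSum M) := by
  have hO : ∀ i, catO A 𝔥 𝔟 (M i) := fun i => (hM i).1
  refine ⟨directSum_catO 𝔥 𝔟 M hO, fun n hn τ hτ => ?_⟩
  apply ObjectProperty.hom_ext
  apply ModuleCat.hom_ext
  apply LinearMap.ext
  intro m
  induction m using directSum_induction with
  | h0 => exact map_zero _
  | ha x y hx hy => exact (map_add _ x y).trans (by rw [hx, hy]; exact (map_add _ x y).symm)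
  | h1 i m =>
    let f : (⟨M i, hO i⟩ : (catO A 𝔥 𝔟).FullSubcategory) ⟶
        ⟨directSum M, directSum_catO 𝔥 𝔟 M hO⟩ := ObjectProperty.homMk (inclSum M i)
    have h := τ.naturality f
    have h0 : τ.app ⟨M i, hO i⟩ = 0 := (hM i).2 n hn τ hτ
    rw [h0, Limits.zero_comp] at h
    have h' := congrArg (fun g => g.hom.hom m) h
    exact h'

/-- The functor `{M_Λ} ↦ ⨁ M_Λ` from the product of the subcategories attached to the equivalence
classes to the restricted category `O`. -/
def blockSum (𝔥 𝔟 : LieSubalgebra ℂ 𝔤) [LieRing.IsNilpotent 𝔥] (A : Type u) [CommRing A]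
    [IsLocalRing A] [Algebra ℂ A] [Algebra (SymmetricAlgebra ℂ 𝔥) A] :
    (∀ Λ : Quotient (resSetoid A 𝔥 𝔟), (resBlock A 𝔥 𝔟 Λ).FullSubcategory) ⥤
      (resO A 𝔥 𝔟).FullSubcategory where
  obj M := ⟨directSum fun Λ => (M Λ).obj, directSum_resO 𝔥 𝔟 _ fun Λ => (M Λ).property.1⟩
  map f := ObjectProperty.homMk (ModuleCat.ofHom (DirectSum.lmap fun Λ => (f Λ).hom.hom))
  map_id M := by
    apply ObjectProperty.hom_ext
    apply ModuleCat.hom_ext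
    exact DirectSum.lmap_id
  map_comp f g := by
    apply ObjectProperty.hom_ext
    apply ModuleCat.hom_ext
    exact DirectSum.lmap_comp (fun Λ => (f Λ).hom.hom) (fun Λ => (g Λ).hom.hom)

end Modules

end AffineO

end

/-! The decomposition of a restricted module M is written down directly: `blockPart M Λ` is the sum
of the images in M of all covers P^J(γ) with γ ∈ Λ. By the definition of linkage all simple factors
of such a cover lie in Λ, and a simple factor of a sum of submodules is a factor of one of them, so
`blockPart M Λ` has factors in Λ only. A nonzero submodule always has a simple factor
(`exists_hasFactor`). Hence the parts for different classes are independent, and a map between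
different blocks vanishes because its image would have factors in both classes.

The parts exhaust M (`iSup_blockPart`). The submodule U generated by m ∈ M has its weights in some
open, locally bounded J. If m were outside the sum of the parts, the intersection of U with that sum
would lie in the kernel of a surjection U → L(γ) with γ ∈ J. The cover P^J(γ) → L(γ) lifts to U; its
image lies in the sum of the parts and yet maps onto L(γ), a contradiction. Independence and
exhaustion give essential surjectivity, the vanishing of maps between blocks gives fullness.

The main work is the existence of covers (`exists_isCover`). Vectors of weight λ in truncated
restricted modules are represented by a cyclic module `univMod`, which is projective because taking
weight spaces is exact. The cover of L(λ) is a direct summand of it, found by induction on the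
number of weights of J above λ: an unwanted simple quotient L(γ) has γ > λ, and its cover splits
off. Splitting off terminates because the weight spaces of `univMod` are Noetherian A-modules.
Idempotents need not be lifted from the residue field, so A need not be complete.

Two inputs come from Lie theory. Verma modules are nonzero, by a construction in the style of the
Poincaré-Birkhoff-Witt theorem (`InducedModule.exists_rep`). And 𝔟̂, with 𝔟 known only to be maximal
solvable, is the nonnegative part of an integral grading of 𝔤̂ with finite-dimensional pieces
(`BorelRoots.exists_grading`, `nonempty_grading`), which makes highest weight arguments available.
-/

noncomputable section

/-! ### Inducing a character of a subalgebra: a PBW construction -/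

namespace InducedModule

variable {k L R I : Type*} [Field k] [LieRing L] [LieAlgebra k L] [CommRing R] [Algebra k R]
  [LinearOrder I] (coord : L →ₗ[k] I →₀ k) (c : I → L) (χ : L →ₗ[k] R)

/-- The space of polynomials in the variables `I`. -/
abbrev Poly (I R : Type*) [CommRing R] := Multiset I →₀ R

variable (R) in
/-- Multiplication by the leading term of `x`, applied to a monomial. -/
def lead (M : Multiset I) : L →ₗ[k] Poly I R :=
  Finsupp.linearCombination k (fun i => Finsupp.single (i ::ₘ M) (1 : R)) ∘ₗ coord

open Classical in
/-- A smallest element of a nonempty multiset. -/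
def least (M : Multiset I) (h : M ≠ 0) : I :=
  Finset.min' (Multiset.toFinset M) (by simpa [Finset.nonempty_iff_ne_empty] using h)

lemma least_mem (M : Multiset I) (h : M ≠ 0) : least M h ∈ M := by
  classical
  exact Multiset.mem_toFinset.mp (M.toFinset.min'_mem _)

lemma least_cons (j : I) (N : Multiset I) (hj : ∀ i ∈ N, j ≤ i) (h : j ::ₘ N ≠ 0) :
    least (j ::ₘ N) h = j := by
  classical
  refine le_antisymm (Finset.min'_le _ _ (by simp)) ?_
  have := least_mem _ h
  rcases Multiset.mem_cons.mp this with h | h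
  · exact h.ge
  · exact hj _ h

variable {coord c χ}

open Classical in
variable (coord c χ) in
/-- The action of `x` on the monomial `M`. -/
def mono (M : Multiset I) : L →ₗ[k] Poly I R :=
  if h : M = 0 then lead R coord 0 + (Finsupp.lsingle (R := k) (0 : Multiset I)) ∘ₗ χ
  else
    let j := least M h
    let N := M.erase j
    have hj : j ∈ M := least_mem M h
    have _hN : N.card < M.card := Multiset.card_erase_lt_of_mem hj
    -- Action of `c j` on lower degree. The default 0 is never reached where `E` is used, since the
    -- remainder `mono N - lead N` has degree at most that of `N`.
    let E : Poly I R →ₗ[R] Poly I R := Finsupp.linearCombination R fun M' =>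
      if _h' : M'.card < M.card then mono M' (c j) else 0
    -- Modelled on x · (c_j N) = c_j · (x · N) + [x, c_j] · N, with the top degree part of the first
    -- summand written out as `lead M x`.
    let U : L →ₗ[k] Poly I R := lead R coord M +
      E.restrictScalars k ∘ₗ (mono N - lead R coord N) +
      mono N ∘ₗ ((LieModule.toEnd k L L : L →ₗ[k] L →ₗ[k] L).flip (c j))
    -- For i ≤ j the value at `c i` is overwritten by the ordered monomial `i ::ₘ M`.
    U + Finsupp.linearCombination k (fun i => if i ≤ j then
      Finsupp.single (i ::ₘ M) (1 : R) - U (c i) else 0) ∘ₗ coord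
termination_by M.card

variable (coord c χ) in
/-- The action of `x` on polynomials. -/
def actPoly (x : L) : Poly I R →ₗ[R] Poly I R :=
  Finsupp.linearCombination R fun M => mono coord c χ M x

variable (hc : ∀ i, coord (c i) = Finsupp.single i 1)

lemma actPoly_single (x : L) (M : Multiset I) :
    actPoly coord c χ x (Finsupp.single M 1) = mono coord c χ M x := by
  simp [actPoly]

lemma actPoly_add (x y : L) :
    actPoly coord c χ (x + y) = actPoly coord c χ x + actPoly coord c χ y := by
  ext M : 2; simp [actPoly]

lemma actPoly_smul (a : k) (x : L) :
    actPoly coord c χ (a • x) = a • actPoly coord c χ x := by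
  ext M : 2; simp [actPoly]

lemma mono_zero (x : L) : mono coord c χ 0 x = lead R coord 0 x + Finsupp.single 0 (χ x) := by
  rw [mono]; simp

include hc in
lemma lead_c (i : I) (M : Multiset I) :
    lead R coord M (c i) = Finsupp.single (i ::ₘ M) 1 := by
  simp [lead, hc]

/-- Polynomials of degree at most `n`. -/
abbrev degLE (I R : Type*) [CommRing R] (n : ℕ) : Submodule R (Poly I R) :=
  Finsupp.supported R R {M | M.card ≤ n}

include hc in
-- An element acts as multiplication by its leading term up to terms of no higher degree than the
-- monomial. This keeps the recursion inside the range where it is defined and drives the inductions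
-- on degree.
lemma mono_sub_lead_mem (n : ℕ) : ∀ M : Multiset I, M.card = n → ∀ x,
    mono coord c χ M x - lead R coord M x ∈ degLE I R n := by
  classical
  induction n using Nat.strong_induction_on with
  | _ n ih =>
  intro M hM x
  have hlead : ∀ (M : Multiset I) (x : L), lead R coord M x ∈ degLE I R (M.card + 1) := by
    intro M x
    rw [lead, LinearMap.comp_apply, Finsupp.linearCombination_apply]
    refine Submodule.sum_mem _ fun i _ => ?_
    refine Submodule.smul_of_tower_mem _ _ (Finsupp.single_mem_supported _ _ (by simp))
  have hmon : ∀ {a b : ℕ}, a ≤ b → degLE I R a ≤ degLE I R b := fun h =>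
    Finsupp.supported_mono fun M (hM : M.card ≤ _) => hM.trans h
  rw [mono]
  split_ifs with h
  · subst h
    simp only [LinearMap.add_apply, LinearMap.comp_apply, add_sub_cancel_left]
    exact Finsupp.single_mem_supported _ _ (by simp)
  · set j := least M h
    have hj : j ∈ M := least_mem M h
    have hN : (M.erase j).card + 1 = M.card := Multiset.card_erase_add_one hj
    extract_lets N _ _ E U
    have hmono : ∀ x, mono coord c χ (M.erase j) x ∈ degLE I R n := by
      intro x
      have h1 := ih _ (by omega) (M.erase j) rfl x
      have h2 := hlead (M.erase j) x
      have := Submodule.add_mem (degLE I R n) (hmon (by omega) h1) (hmon (by omega) h2)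
      simpa using this
    have hE : ∀ w ∈ degLE I R (M.erase j).card, E w ∈ degLE I R n := by
      intro w hw
      rw [Finsupp.linearCombination_apply]
      refine Submodule.sum_mem _ fun M' hM' => Submodule.smul_mem _ _ ?_
      have hw' : M'.card ≤ (M.erase j).card := hw hM'
      rw [dif_pos (by omega)]
      have h1 := ih _ (by omega) M' rfl (c j)
      have h2 := hlead M' (c j)
      have := Submodule.add_mem (degLE I R n) (hmon (by omega) h1) (hmon (by omega) h2)
      simpa using this
    have hU : ∀ x, U x - lead R coord M x ∈ degLE I R n := by
      intro x
      simp only [U, LinearMap.add_apply, LinearMap.comp_apply]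
      rw [add_assoc, add_sub_cancel_left]
      refine Submodule.add_mem _ (hE _ ?_) (hmono _)
      exact ih _ (by omega) (M.erase j) rfl x
    rw [LinearMap.add_apply, add_sub_right_comm]
    refine Submodule.add_mem _ (hU x) ?_
    rw [LinearMap.comp_apply, Finsupp.linearCombination_apply]
    refine Submodule.sum_mem _ fun i _ => Submodule.smul_of_tower_mem _ _ ?_
    split_ifs
    · rw [← neg_sub, ← lead_c hc]
      exact Submodule.neg_mem _ (hU _)
    · exact Submodule.zero_mem _

include hc in
-- The overwriting step in the recursion does not touch such an `x`, so only the commutation rule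
-- with `c j` remains.
lemma mono_cons (j : I) (N : Multiset I) (hj : ∀ i ∈ N, j ≤ i) (x : L)
    (hx : ∀ i ≤ j, coord x i = 0) :
    mono coord c χ (j ::ₘ N) x = lead R coord (j ::ₘ N) x +
      actPoly coord c χ (c j) (mono coord c χ N x - lead R coord N x) +
      mono coord c χ N ⁅x, c j⁆ := by
  classical
  rw [mono, dif_neg (Multiset.cons_ne_zero)]
  simp only [least_cons j N hj, Multiset.erase_cons_head, LinearMap.add_apply,
    LinearMap.comp_apply]
  rw [Finsupp.linearCombination_apply, Finsupp.sum, Finset.sum_eq_zero, add_zero]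
  · congr 2
    have := mono_sub_lead_mem (χ := χ) hc _ N rfl x
    simp only [LinearMap.coe_restrictScalars, actPoly, Finsupp.linearCombination_apply]
    refine Finset.sum_congr rfl fun M' hM' => ?_
    have hw' : M'.card ≤ N.card := this hM'
    change _ • (dite _ _ _) = _
    rw [dif_pos (by simpa using Nat.lt_succ_of_le hw')]
    rfl
  · intro i hi
    rw [if_neg, smul_zero]
    intro h
    exact (Finsupp.mem_support_iff.mp hi) (hx i h)

include hc in
lemma mono_low (hχ : ∀ i, χ (c i) = 0) (i : I) (M : Multiset I) (hi : ∀ j ∈ M, i ≤ j) :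
    mono coord c χ M (c i) = Finsupp.single (i ::ₘ M) 1 := by
  classical
  rw [mono]
  split_ifs with h
  · subst h
    simp [lead_c hc, hχ]
  · simp only [LinearMap.add_apply, LinearMap.comp_apply, hc,
      Finsupp.linearCombination_single, one_smul]
    rw [if_pos (hi _ (least_mem M h))]
    abel

variable (coord c χ) in
/-- The failure of `actPoly` to be a representation. -/
def defect (x y : L) (w : Poly I R) : Poly I R :=
  actPoly coord c χ x (actPoly coord c χ y w) - actPoly coord c χ y (actPoly coord c χ x w) -
    actPoly coord c χ ⁅x, y⁆ w

lemma defect_skew (x y : L) (w : Poly I R) :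
    defect coord c χ x y w = - defect coord c χ y x w := by
  have : actPoly coord c χ ⁅x, y⁆ = - actPoly coord c χ ⁅y, x⁆ := by
    ext M : 2
    have h := map_neg (mono coord c χ M) ⁅y, x⁆
    rw [lie_skew] at h
    simp [actPoly, h]
  simp only [defect, this, LinearMap.neg_apply]
  abel

include hc in
-- For `x` with coordinates only above `j` this is the recursion itself. For `x = c i` with i < j
-- the roles are exchanged by skew symmetry. A general `x` is a combination of the `c i` plus an
-- element of the kernel of `coord`.
lemma defect_low (hχ : ∀ i, χ (c i) = 0) (j : I) (N : Multiset I) (hj : ∀ i ∈ N, j ≤ i) (x : L) :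
    defect coord c χ x (c j) (Finsupp.single N (1 : R)) = 0 := by
  have key : ∀ (j : I) (hj : ∀ i ∈ N, j ≤ i) (x : L), (∀ i ≤ j, coord x i = 0) →
      defect coord c χ x (c j) (Finsupp.single N (1 : R)) = 0 := by
    intro j hj x hx
    have h1 : actPoly coord c χ (c j) (lead R coord N x) = lead R coord (j ::ₘ N) x := by
      simp only [lead, LinearMap.comp_apply, Finsupp.linearCombination_apply, Finsupp.sum, map_sum]
      refine Finset.sum_congr rfl fun i hi => ?_
      have hij : j ≤ i := by
        by_contra h
        exact (Finsupp.mem_support_iff.mp hi) (hx i (not_le.mp h).le)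
      rw [LinearMap.map_smul_of_tower, actPoly_single, mono_low hc hχ, Multiset.cons_swap]
      simpa [hij] using hj
    simp only [defect, actPoly_single]
    rw [mono_low hc hχ j N hj, actPoly_single, mono_cons hc j N hj x hx, map_sub, h1]
    abel
  have h2 : ∀ i, defect coord c χ (c i) (c j) (Finsupp.single N (1 : R)) = 0 := by
    intro i
    rcases lt_trichotomy i j with h | h | h
    · rw [defect_skew, key i (fun l hl => h.le.trans (hj l hl)), neg_zero]
      intro l hl
      rw [hc, Finsupp.single_apply, if_neg]
      exact (hl.trans_lt h).ne'
    · subst h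
      simp only [defect, lie_self, actPoly_single, map_zero, sub_self]
    · refine key j hj _ fun l hl => ?_
      rw [hc, Finsupp.single_apply, if_neg]
      exact (hl.trans_lt h).ne'
  set y := Finsupp.linearCombination k c (coord x) with hy
  have h3 : coord (x - y) = 0 := by
    rw [map_sub, hy, Finsupp.linearCombination_apply, Finsupp.sum, map_sum]
    simp_rw [map_smul, hc, Finsupp.smul_single_one]
    exact sub_eq_zero.mpr (Finsupp.sum_single (coord x)).symm
  have hadd : ∀ x y w, defect coord c χ (x + y) (c j) w =
      defect coord c χ x (c j) w + defect coord c χ y (c j) (w : Poly I R) := by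
    intro x y w
    simp only [defect, add_lie, actPoly_add, LinearMap.add_apply, map_add]; abel
  have hsmul : ∀ (a : k) x w, defect coord c χ (a • x) (c j) w =
      a • defect coord c χ x (c j) (w : Poly I R) := by
    intro a x w
    simp only [defect, smul_lie, actPoly_smul, LinearMap.smul_apply, LinearMap.map_smul_of_tower,
      smul_sub]
  let D : L →ₗ[k] Poly I R :=
    { toFun x := defect coord c χ x (c j) (Finsupp.single N (1 : R))
      map_add' x y := hadd x y _
      map_smul' a x := hsmul a x _ }
  have h4 : D y = 0 := by
    rw [hy, Finsupp.linearCombination_apply, Finsupp.sum, map_sum]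
    refine Finset.sum_eq_zero fun i _ => ?_
    rw [map_smul]
    exact (congrArg _ (h2 i)).trans (smul_zero _)
  have h5 : D (x - y) = 0 := key j hj _ fun i _ => by rw [h3]; rfl
  have h6 := D.map_add (x - y) y
  rw [h4, h5, sub_add_cancel, add_zero] at h6
  exact h6

include hc in
/-- The commutation relations, on polynomials of degree `n`. -/
lemma defect_eq_zero (hχ : ∀ i, χ (c i) = 0)
    (hker : ∀ x y, coord x = 0 → coord y = 0 → coord ⁅x, y⁆ = 0 ∧ χ ⁅x, y⁆ = 0) (n : ℕ) :
    ∀ M : Multiset I, M.card = n → ∀ x y, defect coord c χ x y (Finsupp.single M (1 : R)) = 0 := by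
  classical
  induction n using Nat.strong_induction_on with
  | _ n ih =>
  intro M hM
  let D : L →ₗ[k] L →ₗ[k] Poly I R := LinearMap.mk₂ k
    (fun x y => defect coord c χ x y (Finsupp.single M (1 : R)))
    (fun x y z => by simp only [defect, add_lie, actPoly_add, LinearMap.add_apply, map_add]; abel)
    (fun a x y => by
      simp only [defect, smul_lie, actPoly_smul, LinearMap.smul_apply,
        LinearMap.map_smul_of_tower, smul_sub])
    (fun x y z => by simp only [defect, lie_add, actPoly_add, LinearMap.add_apply, map_add]; abel)
    (fun a x y => by
      simp only [defect, lie_smul, actPoly_smul, LinearMap.smul_apply,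
        LinearMap.map_smul_of_tower, smul_sub])
  have hD : ∀ x y, D x y = defect coord c χ x y (Finsupp.single M (1 : R)) := fun _ _ => rfl
  -- reduction to elements without a component `c i` for `i` below `M`
  suffices h : ∀ x y, (∀ i, (∀ j ∈ M, i ≤ j) → coord x i = 0) →
      (∀ i, (∀ j ∈ M, i ≤ j) → coord y i = 0) → D x y = 0 by
    have hlow : ∀ x y, (∀ i, coord y i ≠ 0 → ∀ j ∈ M, i ≤ j) →
        D x (Finsupp.linearCombination k c (coord y)) = 0 := by
      intro x y hy
      rw [Finsupp.linearCombination_apply, Finsupp.sum, map_sum]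
      refine Finset.sum_eq_zero fun i hi => ?_
      rw [map_smul, hD, defect_low hc hχ i M (hy i (Finsupp.mem_support_iff.mp hi)), smul_zero]
    have hdec : ∀ x, ∃ l, (∀ y, D y l = 0) ∧
        ∀ i, (∀ j ∈ M, i ≤ j) → coord (x - l) i = 0 := by
      intro x
      refine ⟨Finsupp.linearCombination k c ((coord x).filter fun i => ∀ j ∈ M, i ≤ j), ?_, ?_⟩
      · intro y
        rw [Finsupp.linearCombination_apply, Finsupp.sum, map_sum]
        refine Finset.sum_eq_zero fun i hi => ?_
        rw [Finsupp.support_filter, Finset.mem_filter] at hi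
        rw [map_smul, hD, defect_low hc hχ i M hi.2, smul_zero]
      · intro i hi
        have : ∀ v : I →₀ k, coord (Finsupp.linearCombination k c v) = v := by
          intro v
          rw [Finsupp.linearCombination_apply, Finsupp.sum, map_sum]
          simp_rw [map_smul, hc, Finsupp.smul_single_one]
          exact Finsupp.sum_single v
        rw [map_sub, this, Finsupp.sub_apply, Finsupp.filter_apply, if_pos hi, sub_self]
    intro x y
    obtain ⟨lx, hlx, hx⟩ := hdec x
    obtain ⟨ly, hly, hy⟩ := hdec y
    have h1 := h _ _ hx hy
    have h2 : D lx y = 0 := by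
      rw [hD, defect_skew, ← hD, hlx, neg_zero]
    simp only [map_sub, LinearMap.sub_apply, hly, h2, sub_zero] at h1
    exact h1
  intro x y hx hy
  rcases Multiset.empty_or_exists_mem M with h0 | ⟨_, h0⟩
  · subst h0
    have hx' : coord x = 0 := Finsupp.ext fun i => hx i (by simp)
    have hy' : coord y = 0 := Finsupp.ext fun i => hy i (by simp)
    obtain ⟨h1, h2⟩ := hker x y hx' hy'
    -- On the empty monomial the subalgebra acts by the scalars χ, which commute, and χ vanishes on
    -- brackets.
    have hz : ∀ x : L, ∀ r : R, coord x = 0 →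
        actPoly coord c χ x (Finsupp.single 0 r) = Finsupp.single 0 (r * χ x) := by
      intro x r hx
      have : (Finsupp.single 0 r : Poly I R) = r • Finsupp.single 0 1 := by simp
      rw [this, map_smul, actPoly_single, mono_zero, lead, LinearMap.comp_apply, hx]
      simp
    rw [hD, defect, hz y 1 hy', hz x 1 hx', hz x _ hx', hz y _ hy', hz _ _ h1, h2]
    simp [mul_comm]
  · have hM0 : M ≠ 0 := by rintro rfl; simp at h0
    obtain ⟨j, P, hj, rfl⟩ : ∃ j P, (∀ i ∈ P, j ≤ i) ∧ M = j ::ₘ P := by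
      refine ⟨least M hM0, M.erase (least M hM0), fun i hi => ?_,
        (Multiset.cons_erase (least_mem M hM0)).symm⟩
      exact Finset.min'_le _ _ (by simpa using Multiset.mem_of_mem_erase hi)
    rw [Multiset.card_cons] at hM
    -- the relation between `x` and `c j` on the vectors `y P`
    have hcj : ∀ x y : L, (∀ i, (∀ l ∈ j ::ₘ P, i ≤ l) → coord y i = 0) →
        defect coord c χ x (c j) (mono coord c χ P y : Poly I R) = 0 := by
      intro x y hy
      let T : Poly I R →ₗ[R] Poly I R := actPoly coord c χ x ∘ₗ actPoly coord c χ (c j) -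
        actPoly coord c χ (c j) ∘ₗ actPoly coord c χ x - actPoly coord c χ ⁅x, c j⁆
      have hT : ∀ w, defect coord c χ x (c j) w = T w := fun _ => rfl
      -- The leading terms of y · P involve only variables from `j` upwards, so `defect_low` applies
      -- to them; the remainder has degree at most that of `P` and falls under the induction
      -- hypothesis.
      have h1 : T (lead R coord P y) = 0 := by
        simp only [lead, LinearMap.comp_apply, Finsupp.linearCombination_apply, Finsupp.sum,
          map_sum]
        refine Finset.sum_eq_zero fun i hi => ?_
        rw [LinearMap.map_smul_of_tower, ← hT, defect_low hc hχ, smul_zero]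
        have : j ≤ i := by
          by_contra h
          refine (Finsupp.mem_support_iff.mp hi) (hy i ?_)
          intro l hl
          rcases Multiset.mem_cons.mp hl with rfl | hl
          · exact (not_le.mp h).le
          · exact (not_le.mp h).le.trans (hj l hl)
        simpa [this] using hj
      have h2 : T (mono coord c χ P y - lead R coord P y) = 0 := by
        have hw := mono_sub_lead_mem (χ := χ) hc _ P rfl y
        rw [← Finsupp.sum_single (mono coord c χ P y - lead R coord P y), Finsupp.sum, map_sum]
        refine Finset.sum_eq_zero fun M' hM' => ?_
        have : M'.card ≤ P.card := hw hM'
        rw [← Finsupp.smul_single_one, map_smul, ← hT, ih _ (by omega) M' rfl, smul_zero]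
      rw [map_sub, h1, sub_zero] at h2
      rw [hT, h2]
    have hstep : ∀ y, mono coord c χ (j ::ₘ P) y =
        actPoly coord c χ (c j) (mono coord c χ P y) + (mono coord c χ P ⁅y, c j⁆ : Poly I R) := by
      intro y
      have := defect_low (R := R) hc hχ j P hj y
      rw [defect, actPoly_single, actPoly_single, actPoly_single, mono_low hc hχ j P hj,
        actPoly_single, sub_sub, sub_eq_zero] at this
      exact this
    have hP : ∀ x y, actPoly coord c χ x (mono coord c χ P y) =
        actPoly coord c χ y (mono coord c χ P x) + (mono coord c χ P ⁅x, y⁆ : Poly I R) := by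
      intro x y
      have := ih _ (by omega) P rfl x y
      rw [defect, actPoly_single, actPoly_single, actPoly_single, sub_sub, sub_eq_zero] at this
      exact this
    have h1 := hcj x y hy
    have h2 := hcj y x hx
    rw [defect, sub_sub, sub_eq_zero] at h1 h2
    have h3 := hP x ⁅y, c j⁆
    have h4 := hP y ⁅x, c j⁆
    have h5 := hP x y
    rw [hD, defect, actPoly_single, actPoly_single, actPoly_single, hstep, hstep, hstep, map_add,
      map_add, h1, h2, h3, h4, h5, map_add]
    -- All products have been commuted past `c j`; the Jacobi identity cancels what is left.
    have h6 : ⁅⁅x, y⁆, c j⁆ = ⁅x, ⁅y, c j⁆⁆ - ⁅y, ⁅x, c j⁆⁆ := lie_lie x y (c j)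
    rw [h6, map_sub]
    abel

include hc in
/-- A character of a subalgebra is induced to a representation on a nonzero space. -/
theorem exists_rep (hχ : ∀ i, χ (c i) = 0)
    (hker : ∀ x y, coord x = 0 → coord y = 0 → coord ⁅x, y⁆ = 0 ∧ χ ⁅x, y⁆ = 0) :
    ∃ ρ : L →ₗ[k] Module.End R (Poly I R), (∀ x y, ρ ⁅x, y⁆ = ρ x * ρ y - ρ y * ρ x) ∧
      ∀ x, coord x = 0 → ρ x (Finsupp.single 0 1) = χ x • Finsupp.single 0 1 := by
  refine ⟨{ toFun := actPoly coord c χ, map_add' := actPoly_add, map_smul' := actPoly_smul }, ?_, ?_⟩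
  · intro x y
    ext M : 2
    have := defect_eq_zero (R := R) hc hχ hker _ M rfl x y
    rw [defect, sub_eq_zero] at this
    simpa using this.symm
  · intro x hx
    change actPoly coord c χ x _ = _
    rw [actPoly_single, mono_zero, lead, LinearMap.comp_apply, hx]
    simp

end InducedModule

end

/-! ### Root spaces in a solvable subalgebra and a regular element -/

noncomputable section

namespace BorelRoots

open LieAlgebra LieAlgebra.IsKilling LieModule Module

variable {K L : Type*} [Field K] [CharZero K] [LieRing L] [LieAlgebra K L]
  [FiniteDimensional K L] [IsKilling K L] {H : LieSubalgebra K L} [H.IsCartanSubalgebra]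
  [IsTriangularizable K H L] {b : LieSubalgebra K L}

/-- Root spaces are one-dimensional. -/
lemma rootSpace_le_of_mem (α : Weight K H L) (hα : α.IsNonZero) {x : L}
    (hx : x ∈ rootSpace H α) (hx0 : x ≠ 0) (hxb : x ∈ b) : ∀ y ∈ rootSpace H α, y ∈ b := by
  intro y hy
  obtain ⟨k, hk⟩ := (finrank_eq_one_iff_of_nonzero' (⟨x, hx⟩ : rootSpace H α)
    (by simpa using hx0)).mp (finrank_rootSpace_eq_one α hα) ⟨y, hy⟩
  have : k • x = y := congrArg Subtype.val hk
  exact this ▸ b.smul_mem k hxb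

/-- A solvable subalgebra does not contain the root spaces of opposite roots. -/
lemma not_neg_of_isSolvable [LieAlgebra.IsSolvable b] (α : Weight K H L) (hα : α.IsNonZero)
    (h1 : ∀ x ∈ rootSpace H α, x ∈ b) (h2 : ∀ x ∈ rootSpace H (-α), x ∈ b) : False := by
  obtain ⟨h, e, f, t, he, hf⟩ := exists_isSl2Triple_of_weight_isNonZero hα
  have heb := h1 e he
  have hfb := h2 f hf
  have hhb : h ∈ b := t.lie_e_f ▸ b.lie_mem heb hfb
  -- An sl₂-triple is recovered from its brackets [e, f] = h, [h, e] = 2e, [h, f] = -2f, so it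
  -- survives in the whole derived series.
  have key : ∀ n, (⟨e, heb⟩ : b) ∈ derivedSeries K b n ∧ (⟨f, hfb⟩ : b) ∈ derivedSeries K b n ∧
      (⟨h, hhb⟩ : b) ∈ derivedSeries K b n := by
    intro n
    induction n with
    | zero => simp
    | succ n ih =>
      obtain ⟨h1, h2, h3⟩ := ih
      rw [derivedSeries_def, derivedSeriesOfIdeal_succ]
      have h4 := LieSubmodule.lie_mem_lie h1 h2
      have h5 := LieSubmodule.lie_mem_lie h3 h1
      have h6 := LieSubmodule.lie_mem_lie h3 h2
      have e4 : ⁅(⟨e, heb⟩ : b), (⟨f, hfb⟩ : b)⁆ = ⟨h, hhb⟩ := Subtype.ext t.lie_e_f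
      have e5 : ⁅(⟨h, hhb⟩ : b), (⟨e, heb⟩ : b)⁆ = (2 : K) • ⟨e, heb⟩ :=
        Subtype.ext (t.lie_h_e_smul K)
      have e6 : ⁅(⟨h, hhb⟩ : b), (⟨f, hfb⟩ : b)⁆ = -((2 : K) • ⟨f, hfb⟩) :=
        Subtype.ext (t.lie_lie_smul_f K)
      rw [e4] at h4
      rw [e5] at h5
      rw [e6] at h6
      refine ⟨?_, ?_, h4⟩
      · have := SMulMemClass.smul_mem (2⁻¹ : K) h5
        rwa [smul_smul, inv_mul_cancel₀ two_ne_zero, one_smul] at this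
      · have := SMulMemClass.smul_mem (-2⁻¹ : K) h6
        rwa [smul_neg, smul_smul, neg_mul, inv_mul_cancel₀ two_ne_zero, neg_smul, neg_neg,
          one_smul] at this
  obtain ⟨n, hn⟩ := (isSolvable_iff K b).mp ‹LieAlgebra.IsSolvable b›
  have := (key n).1
  rw [hn] at this
  exact t.e_ne_zero (congrArg Subtype.val ((LieSubmodule.mem_bot _).mp this))

/-- If the root spaces of `α` and `β` lie in `b` and `β` is negative on the coroot of `α`, then the
root space of the reflection of `β` along `α` lies in `b`. -/
lemma reflectRoot_le (α β : Weight K H L) (hα : α.IsNonZero) (hβ : β.IsNonZero)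
    (h1 : ∀ x ∈ rootSpace H α, x ∈ b) (h2 : ∀ x ∈ rootSpace H β, x ∈ b) (n : ℕ)
    (hn : β (coroot α) = -(n : K)) : ∀ x ∈ rootSpace H (reflectRoot α β), x ∈ b := by
  obtain ⟨h, e, f, t, he, hf⟩ := exists_isSl2Triple_of_weight_isNonZero hα
  obtain rfl := t.h_eq_coroot hα he hf
  obtain ⟨y, hy, hy0⟩ := β.exists_ne_zero
  have hfpow (j : ℕ) := toEnd_pow_apply_mem (M := L) hf hy j
  -- The bottom of the α-string through β.
  obtain ⟨j, hj, hj'⟩ : ∃ j, ((toEnd K L L f) ^ j) y ≠ 0 ∧ ((toEnd K L L f) ^ (j + 1)) y = 0 := by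
    refine Nat.exists_not_and_succ_of_not_zero_of_exists (p := fun j => ((toEnd K L L f) ^ j) y = 0)
      (by simpa using hy0) ?_
    have : IsNilpotent (toEnd K L L f) := isNilpotent_toEnd_of_mem_rootSpace L H
      (χ := -α) (fun h => hα (neg_eq_zero.mp h)) hf
    obtain ⟨k, hk⟩ := this
    exact ⟨k, by simp [hk]⟩
  have prim : t.symm.HasPrimitiveVectorWith (((toEnd K L L f) ^ j) y) ((n + 2 * j : ℕ) : K) := by
    refine ⟨hj, ?_, ?_⟩
    · have := lie_eq_smul_of_mem_rootSpace (hfpow j) (coroot α)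
      rw [neg_lie, ← H.coe_bracket_of_module, this, ← neg_smul]
      congr 1
      have h2 : α (coroot α) = 2 := root_apply_coroot hα
      rw [Pi.add_apply, Pi.smul_apply, Pi.neg_apply, hn, h2, nsmul_eq_mul]
      push_cast
      ring
    · rw [pow_succ', Module.End.mul_apply] at hj'
      exact hj'
  -- By sl₂-theory the powers of `e` on a lowest vector of weight -(n + 2j) are nonzero up to
  -- exponent n + 2j. Since e^j f^j y is a multiple of `y`, this yields e^n y ≠ 0, a vector in the
  -- reflected root space and in `b`.
  have h3 := prim.pow_toEnd_f_ne_zero_of_eq_nat rfl (i := n + j) (by omega)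
  rw [pow_add, Module.End.mul_apply] at h3
  obtain ⟨k, hk⟩ : ∃ k : K, k • y = ((toEnd K L L e) ^ j) (((toEnd K L L f) ^ j) y) := by
    have hmem := toEnd_pow_apply_mem (M := L) he (hfpow j) j
    have h0 : j • (α : H → K) + (j • -(α : H → K) + β) = β := by
      rw [smul_neg]; abel
    rw [h0] at hmem
    obtain ⟨k, hk⟩ := (finrank_eq_one_iff_of_nonzero' (⟨y, hy⟩ : rootSpace H β)
      (by simpa using hy0)).mp (finrank_rootSpace_eq_one β hβ) ⟨_, hmem⟩
    exact ⟨k, congrArg Subtype.val hk⟩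
  rw [← hk, map_smul] at h3
  have h4 : ((toEnd K L L e) ^ n) y ≠ 0 := fun h => h3 (by rw [h, smul_zero])
  have h5 := toEnd_pow_apply_mem (M := L) he hy n
  have h6 : n • (α : H → K) + β = reflectRoot α β := by
    change _ = (β : H → K) - β (coroot α) • (α : H → K)
    rw [hn, neg_smul, sub_neg_eq_add, add_comm, Nat.cast_smul_eq_nsmul]
  rw [h6] at h5
  refine rootSpace_le_of_mem _ (reflectRoot_isNonZero α β hβ) h5 h4 ?_
  have h7 : ∀ m, ((toEnd K L L e) ^ m) y ∈ b := by
    intro m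
    induction m with
    | zero => simpa using h2 y hy
    | succ m ih =>
      rw [pow_succ', Module.End.mul_apply]
      exact b.lie_mem (h1 e he) ih
  exact h7 n

open Classical in
variable (H b) in
/-- The roots whose root space lies in `b`. -/
def rootsIn : Finset H.root := {α | ∀ x ∈ rootSpace H α.1, x ∈ b}

lemma mem_rootsIn {α : H.root} : α ∈ rootsIn H b ↔ ∀ x ∈ rootSpace H α.1, x ∈ b := by
  simp [rootsIn]

lemma coe_reflectionPerm (α β : H.root) :
    ((rootSystem H).reflectionPerm α β).1 = reflectRoot α.1 β.1 := by
  have h := (rootSystem H).root_reflectionPerm α β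
  rw [RootPairing.reflection_apply_root] at h
  ext x
  exact LinearMap.congr_fun h x

lemma pairingIn_cast (α β : H.root) :
    (((rootSystem H).pairingIn ℤ α β : ℤ) : K) = α.1 (coroot β.1) := by
  rw [← rootSystem_pairing_apply, ← (rootSystem H).algebraMap_pairingIn ℤ]
  simp

/-- The reflection along α changes the sign of the pairing with α. Roots whose reflection also lies
in the set cancel in pairs. The others pair nonnegatively with α, since a negative pairing would put
the reflection into the set, and α is one of them with pairing 2. -/
lemma sum_pairing_pos [LieAlgebra.IsSolvable b] (α : H.root) (hα : α ∈ rootsIn H b) :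
    0 < ∑ β ∈ rootsIn H b, (rootSystem H).pairingIn ℤ α β := by
  classical
  set s := (rootSystem H).reflectionPerm α
  have hneg : s α ∉ rootsIn H b := by
    intro h
    refine not_neg_of_isSolvable α.1 (H.isNonZero_coe_root α) (mem_rootsIn.mp hα) ?_
    rw [mem_rootsIn, coe_reflectionPerm] at h
    intro x hx
    refine h x ?_
    have : (reflectRoot α.1 α.1 : H → K) = -α.1 := by
      change (α.1 : H → K) - α.1 (coroot α.1) • (α.1 : H → K) = _
      have h2 : α.1 (coroot α.1) = 2 := root_apply_coroot (H.isNonZero_coe_root α)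
      rw [h2, two_smul]; abel
    rwa [this]
  have hclosed : ∀ β ∈ rootsIn H b, (rootSystem H).pairingIn ℤ α β < 0 → s β ∈ rootsIn H b := by
    intro β hβ h
    rw [RootPairing.pairingIn_lt_zero_iff] at h
    rw [mem_rootsIn, coe_reflectionPerm]
    obtain ⟨n, hn⟩ := Int.eq_ofNat_of_zero_le (neg_nonneg.mpr h.le)
    refine reflectRoot_le α.1 β.1 (H.isNonZero_coe_root α) (H.isNonZero_coe_root β)
      (mem_rootsIn.mp hα) (mem_rootsIn.mp hβ) n ?_
    rw [← pairingIn_cast, neg_eq_iff_eq_neg.mp hn]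
    simp
  rw [← Finset.sum_filter_add_sum_filter_not (rootsIn H b) (fun β => s β ∈ rootsIn H b)]
  have h1 : ∑ β ∈ rootsIn H b with s β ∈ rootsIn H b, (rootSystem H).pairingIn ℤ α β =
      -∑ β ∈ rootsIn H b with s β ∈ rootsIn H b, (rootSystem H).pairingIn ℤ α β := by
    rw [← Finset.sum_neg_distrib]
    refine Finset.sum_bij (fun β _ => s β) ?_ (fun _ _ _ _ h => s.injective h) ?_ ?_
    · intro β hβ
      rw [Finset.mem_filter] at hβ ⊢
      exact ⟨hβ.2, by rw [RootPairing.reflectionPerm_self]; exact hβ.1⟩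
    · intro β hβ
      rw [Finset.mem_filter] at hβ
      refine ⟨s β, ?_, by simp only [s, RootPairing.reflectionPerm_self]⟩
      rw [Finset.mem_filter]
      exact ⟨hβ.2, by rw [RootPairing.reflectionPerm_self]; exact hβ.1⟩
    · intro β _
      rw [(rootSystem H).pairingIn_reflectionPerm, (rootSystem H).pairingIn_reflectionPerm_self_left,
        neg_neg]
  have h2 : 0 < ∑ β ∈ rootsIn H b with s β ∉ rootsIn H b, (rootSystem H).pairingIn ℤ α β := by
    refine Finset.sum_pos' ?_ ⟨α, Finset.mem_filter.mpr ⟨hα, hneg⟩, by simp⟩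
    intro β hβ
    rw [Finset.mem_filter] at hβ
    by_contra h
    exact hβ.2 (hclosed β hβ.1 (not_le.mp h))
  omega

variable (H b) in
/-- There is a regular element of `H` with integral values on the roots, and positive values on
the roots of a solvable subalgebra. -/
lemma exists_regular [LieAlgebra.IsSolvable b] : ∃ (y : H) (d : H.root → ℤ),
    (∀ α : H.root, α.1 y = d α) ∧ (∀ α, d α ≠ 0) ∧ ∀ α ∈ rootsIn H b, 0 < d α := by
  classical
  let ℓ (α : H.root) : Module.Dual ℚ (H.root → ℚ) :=
    ∑ β, ((rootSystem H).pairingIn ℤ α β : ℚ) • LinearMap.proj β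
  -- No `ℓ α` is zero, its value at the coordinate vector of α being 2, so some rational vector
  -- avoids the finitely many hyperplanes; clearing denominators then makes it integral.
  obtain ⟨v, hv⟩ := Module.Dual.exists_forall_ne_zero_of_forall_exists ℓ (fun α =>
    ⟨Pi.single α 1, by simp [ℓ, Pi.single_apply]⟩)
  obtain ⟨⟨N, hN⟩, hN'⟩ := IsLocalization.exist_integer_multiples_of_finite (nonZeroDivisors ℤ) v
  choose w hw using hN'
  have hN0 : N ≠ 0 := nonZeroDivisors.ne_zero hN
  let p (α : H.root) : ℤ := ∑ β, (rootSystem H).pairingIn ℤ α β * w β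
  have hp : ∀ α, p α ≠ 0 := by
    intro α h
    apply hv α
    have h1 : (p α : ℚ) = N * ℓ α v := by
      simp only [p, ℓ, Int.cast_sum, Int.cast_mul, LinearMap.sum_apply, LinearMap.smul_apply,
        LinearMap.proj_apply, smul_eq_mul, Finset.mul_sum]
      refine Finset.sum_congr rfl fun β _ => ?_
      have := hw β
      simp only [algebraMap_int_eq, eq_intCast, zsmul_eq_mul] at this
      rw [this]; ring
    rw [h, Int.cast_zero, eq_comm, mul_eq_zero] at h1
    exact h1.resolve_left (by exact_mod_cast hN0)
  let q (α : H.root) : ℤ := ∑ β ∈ rootsIn H b, (rootSystem H).pairingIn ℤ α β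
  -- With C larger than every |p α|, the sign of C * q α + p α is that of q α when q α ≠ 0, and
  -- otherwise that of p α ≠ 0.
  let C : ℤ := 1 + ∑ α, |p α|
  have hC : ∀ α, |p α| < C := fun α => by
    have := Finset.single_le_sum (f := fun α => |p α|) (fun _ _ => abs_nonneg _)
      (Finset.mem_univ α)
    simp only [C]; omega
  refine ⟨C • (∑ β ∈ rootsIn H b, coroot β.1) + ∑ β, w β • coroot (β : H.root).1,
    fun α => C * q α + p α, ?_, ?_, ?_⟩
  · intro α
    have hlin : ∀ z : H, α.1 z = Weight.toLinear K H L α.1 z := fun _ => rfl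
    rw [hlin, map_add, map_zsmul, map_sum, map_sum]
    simp only [map_zsmul, ← hlin, ← pairingIn_cast, p, q]
    push_cast
    simp only [zsmul_eq_mul, mul_comm]
  · intro α h
    have h1 := hC α
    have h2 : 0 < |p α| := abs_pos.mpr (hp α)
    have h3 : p α = -(C * q α) := by linarith
    rcases eq_or_ne (q α) 0 with h0 | h0
    · rw [h0] at h3; exact hp α (by simpa using h3)
    · rw [h3, abs_neg, abs_mul] at h1
      have h4 : 1 ≤ |q α| := Int.one_le_abs h0
      have h5 : C ≤ |C| := le_abs_self C
      nlinarith [abs_nonneg C]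
  · intro α hα
    have h1 := hC α
    have h2 : 0 < q α := sum_pairing_pos α hα
    have h3 := neg_abs_le (p α)
    have h4 := abs_nonneg (p α)
    nlinarith

end BorelRoots

end

/-! ### A Borel subalgebra as the nonnegative part of a grading -/

noncomputable section

namespace BorelRoots

open LieAlgebra LieAlgebra.IsKilling LieModule Module

variable {K L : Type*} [Field K] [CharZero K] [LieRing L] [LieAlgebra K L]
  [FiniteDimensional K L] [IsKilling K L] {H : LieSubalgebra K L} [H.IsCartanSubalgebra]
  [IsTriangularizable K H L] {b : LieSubalgebra K L}

/-- The sum of the weight spaces of degree at least `n`. -/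
def filt (d : Weight K H L → ℤ) (n : ℤ) : Submodule K L :=
  ⨆ χ : Weight K H L, ⨆ _ : n ≤ d χ, (genWeightSpace L χ).toSubmodule

lemma filt_induction {d : Weight K H L → ℤ} {n : ℤ} {p : L → Prop} (h0 : p 0)
    (ha : ∀ x y, p x → p y → p (x + y))
    (h1 : ∀ χ : Weight K H L, n ≤ d χ → ∀ x ∈ rootSpace H χ, p x) {x : L}
    (hx : x ∈ filt d n) : p x := by
  refine Submodule.iSup_induction _ (motive := p) hx (fun χ x hx => ?_) h0 ha
  by_cases h : n ≤ d χ
  · rw [iSup_pos h] at hx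
    exact h1 χ h x hx
  · rw [iSup_neg h] at hx
    rw [(Submodule.mem_bot K).mp hx]; exact h0

lemma mem_filt {d : Weight K H L → ℤ} {n : ℤ} (χ : Weight K H L) (h : n ≤ d χ) {x : L}
    (hx : x ∈ rootSpace H χ) : x ∈ filt d n :=
  Submodule.mem_iSup_of_mem χ (by rw [iSup_pos h]; exact hx)

lemma filt_anti {d : Weight K H L → ℤ} {m n : ℤ} (h : m ≤ n) : filt d n ≤ filt d m :=
  fun _ hx => filt_induction (Submodule.zero_mem _) (fun _ _ => Submodule.add_mem _)
    (fun χ hχ _ hx => mem_filt χ (h.trans hχ) hx) hx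

section

variable {y : H} {d : Weight K H L → ℤ} (hd : ∀ χ : Weight K H L, χ y = d χ)

include hd in
lemma lie_mem_filt {m n : ℤ} {x z : L} (hx : x ∈ filt d m) (hz : z ∈ filt d n) :
    ⁅x, z⁆ ∈ filt d (m + n) := by
  refine filt_induction (p := fun x => ⁅x, z⁆ ∈ filt d (m + n)) (by simp)
    (fun a b ha hb => by rw [add_lie]; exact Submodule.add_mem _ ha hb) (fun χ hχ x hx => ?_) hx
  refine filt_induction (p := fun z => ⁅x, z⁆ ∈ filt d (m + n)) (by simp)
    (fun a b ha hb => by rw [lie_add]; exact Submodule.add_mem _ ha hb) (fun ψ hψ z hz => ?_) hz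
  have h := lie_mem_genWeightSpace_of_mem_genWeightSpace hx hz
  by_cases h0 : genWeightSpace L (χ + ψ : H → K) = ⊥
  · rw [h0] at h
    rw [(LieSubmodule.mem_bot _).mp h]
    exact Submodule.zero_mem _
  · refine mem_filt ⟨_, h0⟩ ?_ h
    have : ((d ⟨_, h0⟩ : ℤ) : K) = ((d χ + d ψ : ℤ) : K) := by
      rw [← hd, Int.cast_add, ← hd, ← hd]; rfl
    rw [Int.cast_injective this]
    omega

variable (hd0 : ∀ χ : Weight K H L, d χ = 0 → χ.IsZero)

lemma mem_of_isZero {χ : Weight K H L} (h : χ.IsZero) {x : L} (hx : x ∈ rootSpace H χ) : x ∈ H := by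
  rw [h, rootSpace_zero_eq] at hx
  exact hx

include hd hd0 in
-- The degree zero part is contained in the Cartan subalgebra, which is abelian, and degrees add
-- otherwise.
lemma lie_mem_filt_one {x z : L} (hx : x ∈ filt d 0) (hz : z ∈ filt d 0) :
    ⁅x, z⁆ ∈ filt d 1 := by
  refine filt_induction (p := fun x => ⁅x, z⁆ ∈ filt d 1) (by simp)
    (fun a b ha hb => by rw [add_lie]; exact Submodule.add_mem _ ha hb) (fun χ hχ x hx => ?_) hx
  refine filt_induction (p := fun z => ⁅x, z⁆ ∈ filt d 1) (by simp)
    (fun a b ha hb => by rw [lie_add]; exact Submodule.add_mem _ ha hb) (fun ψ hψ z hz => ?_) hz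
  by_cases h : d χ = 0 ∧ d ψ = 0
  · have h1 : (⟨x, mem_of_isZero (hd0 χ h.1) hx⟩ : H) = ⟨x, _⟩ := rfl
    have h2 := trivial_lie_zero H H ⟨x, mem_of_isZero (hd0 χ h.1) hx⟩
      ⟨z, mem_of_isZero (hd0 ψ h.2) hz⟩
    have h3 : ⁅x, z⁆ = 0 := congrArg Subtype.val h2
    rw [h3]
    exact Submodule.zero_mem _
  · exact filt_anti (show 1 ≤ d χ + d ψ by omega)
      (lie_mem_filt hd (mem_filt χ le_rfl hx) (mem_filt ψ le_rfl hz))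

variable (d) in
lemma exists_filt_eq_bot : ∃ N : ℕ, filt d N = ⊥ := by
  classical
  obtain ⟨N, hN⟩ : ∃ N : ℕ, ∀ χ, d χ < N := by
    have := Fintype.ofFinite (Weight K H L)
    refine ⟨1 + ∑ χ, (d χ).natAbs, fun χ => ?_⟩
    have := Finset.single_le_sum (f := fun χ => (d χ).natAbs) (fun _ _ => Nat.zero_le _)
      (Finset.mem_univ χ)
    push_cast at *
    zify at this
    have h2 := le_abs_self (d χ)
    omega
  refine ⟨N, (Submodule.eq_bot_iff _).mpr fun x hx => ?_⟩
  refine filt_induction (p := fun x : L => x = (0 : L)) rfl ?_ (fun χ hχ => ?_) hx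
  · rintro _ _ rfl rfl
    exact add_zero 0
  exact absurd (hN χ) (not_lt.mpr hχ)

/-- The subalgebra of all weight spaces of nonnegative degree. -/
def filtSubalgebra (hd : ∀ χ : Weight K H L, χ y = d χ) : LieSubalgebra K L :=
  { filt d 0 with lie_mem' := fun hx hz => by simpa using lie_mem_filt hd hx hz }

include hd0 in
-- The first derived subalgebra has degrees at least one, and each further step raises the lower
-- bound, while the degrees are bounded above.
lemma isSolvable_filtSubalgebra : LieAlgebra.IsSolvable (filtSubalgebra hd) := by
  have key : ∀ n : ℕ, ∀ x ∈ derivedSeries K (filtSubalgebra hd) (n + 1),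
      (x : L) ∈ filt d (n + 1 : ℕ) := by
    intro n
    induction n with
    | zero =>
      intro x hx
      rw [derivedSeries_def, derivedSeriesOfIdeal_succ] at hx
      rw [← LieSubmodule.mem_toSubmodule, LieSubmodule.lieIdeal_oper_eq_linear_span'] at hx
      refine Submodule.span_induction (p := fun (x : filtSubalgebra hd) _ => (x : L) ∈ filt d (0 + 1 : ℕ)) ?_
        (Submodule.zero_mem _) (fun _ _ _ _ h h' => Submodule.add_mem _ h h')
        (fun a _ _ h => Submodule.smul_mem _ a h) hx
      rintro _ ⟨a, _, c, _, rfl⟩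
      exact lie_mem_filt_one hd hd0 a.2 c.2
    | succ n ih =>
      intro x hx
      rw [derivedSeries_def, derivedSeriesOfIdeal_succ] at hx
      rw [← LieSubmodule.mem_toSubmodule, LieSubmodule.lieIdeal_oper_eq_linear_span'] at hx
      refine Submodule.span_induction (p := fun (x : filtSubalgebra hd) _ => (x : L) ∈ filt d (n + 1 + 1 : ℕ)) ?_
        (Submodule.zero_mem _) (fun _ _ _ _ h h' => Submodule.add_mem _ h h')
        (fun a _ _ h => Submodule.smul_mem _ a h) hx
      rintro _ ⟨a, ha, c, hc, rfl⟩
      exact filt_anti (by push_cast; omega) (lie_mem_filt hd (ih a ha) (ih c hc))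
  obtain ⟨N, hN⟩ := exists_filt_eq_bot d
  refine (isSolvable_iff K _).mpr ⟨N + 1, ?_⟩
  rw [eq_bot_iff]
  intro x hx
  have h1 := filt_anti (show (N : ℤ) ≤ (N + 1 : ℕ) by push_cast; omega) (key N x hx)
  rw [hN] at h1
  exact (LieSubmodule.mem_bot _).mpr (Subtype.ext ((Submodule.mem_bot K).mp h1))

include hd in
-- The weights that occur in `filt d n` take values at least `n` at `y`, hence differ from χ, and
-- distinct weight spaces are independent.
lemma disjoint_filt {χ : H → K} {m n : ℤ} (hχ : χ y = m) (hmn : m < n) :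
    Disjoint (genWeightSpace L χ).toSubmodule (filt d n) := by
  have hind := iSupIndep_genWeightSpace K H L χ
  rw [Submodule.disjoint_def]
  intro x h1 hx1
  have h2 : x ∈ ⨆ φ : H → K, ⨆ _ : φ ≠ χ, genWeightSpace L φ := by
    refine filt_induction (p := fun x => x ∈ ⨆ φ : H → K, ⨆ _ : φ ≠ χ, genWeightSpace L φ)
      (zero_mem _) (fun _ _ => add_mem) (fun ψ hψ z hz => ?_) hx1
    have h0 : (ψ : H → K) ≠ χ := by
      intro h
      have h3 := hd ψ
      rw [h, hχ, Int.cast_inj] at h3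
      omega
    exact (le_iSup₂_of_le (f := fun (φ : H → K) (_ : φ ≠ χ) => genWeightSpace L φ)
      (ψ : H → K) h0 le_rfl) hz
  have h3 := (disjoint_iff_inf_le.mp hind) ⟨h1, h2⟩
  exact (LieSubmodule.mem_bot _).mp h3

include hd in
lemma disjoint_filt_one : Disjoint H.toSubmodule (filt d 1) := by
  refine (disjoint_filt hd (χ := 0) (m := 0) (by simp) zero_lt_one).mono_left fun x hx => ?_
  change x ∈ rootSpace H (0 : H → K)
  rw [rootSpace_zero_eq]; exact hx

end

/-- Being stable under `H`, the subalgebra `b` is the sum of its intersections with the weight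
spaces; a nonzero intersection with a root space is the whole root space. -/
lemma mem_filt_zero_of_mem (hHb : H ≤ b) {d : Weight K H L → ℤ}
    (h0 : ∀ χ : Weight K H L, χ.IsZero → 0 ≤ d χ)
    (h1 : ∀ χ : Weight K H L, χ.IsNonZero → (∀ x ∈ rootSpace H χ, x ∈ b) → 0 ≤ d χ) {x : L}
    (hx : x ∈ b) : x ∈ filt d 0 := by
  let N : LieSubmodule K H L :=
    { b.toSubmodule with lie_mem := fun {h x} hx => b.lie_mem (hHb h.2) hx }
  replace hx : x ∈ N := hx
  rw [eq_iSup_inf_genWeightSpace K H L N] at hx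
  refine LieSubmodule.iSup_induction (fun χ : Weight K H L => N ⊓ genWeightSpace L χ)
    (motive := fun x => x ∈ filt d 0) hx ?_ (Submodule.zero_mem _) (fun _ _ => Submodule.add_mem _)
  intro χ x hx
  obtain ⟨hxN, hxχ⟩ := hx
  rcases eq_or_ne x 0 with h | hx0
  · rw [h]; exact Submodule.zero_mem _
  refine mem_filt χ ?_ hxχ
  by_cases h : χ.IsZero
  · exact h0 χ h
  · exact h1 χ h (rootSpace_le_of_mem χ h hxχ hx0 hxN)

variable (H b) in
/-- A maximal solvable subalgebra containing the Cartan subalgebra is the sum of the weight spaces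
of nonnegative degree, for the degree given by a regular element. -/
theorem exists_grading (hb : Maximal (fun c : LieSubalgebra K L => LieAlgebra.IsSolvable c) b)
    (hHb : H ≤ b) : ∃ (y : H) (d : Weight K H L → ℤ) (pr : L →ₗ[K] H),
      (∀ χ, χ y = d χ) ∧ (∀ χ, d χ = 0 → χ.IsZero) ∧
      (∀ x, x ∈ b ↔ x ∈ filt d 0) ∧ (∀ h : H, pr h = h) ∧ ∀ x ∈ b, ∀ z ∈ b, pr ⁅x, z⁆ = 0 := by
  classical
  have := hb.prop
  obtain ⟨y, d', h1, h2, h3⟩ := exists_regular H b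
  -- The value 0 on the zero weight is its true value at `y`.
  let d (χ : Weight K H L) : ℤ := if h : χ.IsNonZero then d' ⟨χ, by simpa using h⟩ else 0
  have hd : ∀ χ : Weight K H L, χ y = d χ := by
    intro χ
    by_cases h : χ.IsNonZero
    · simp only [d, dif_pos h]
      exact h1 ⟨χ, _⟩
    · simp only [d, dif_neg h, Int.cast_zero]
      rw [Weight.IsNonZero, not_not] at h
      rw [h]; rfl
  have hd0 : ∀ χ : Weight K H L, d χ = 0 → χ.IsZero := by
    intro χ h
    by_contra hn
    simp only [d, dif_pos (show χ.IsNonZero from hn)] at h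
    exact h2 _ h
  have hle : b ≤ filtSubalgebra hd := by
    refine fun x hx => mem_filt_zero_of_mem hHb (fun χ h => ?_) (fun χ h hχ => ?_) hx
    · simp only [d]
      rw [dif_neg (not_not.mpr h)]
    · have hm : (⟨χ, by simpa using h⟩ : H.root) ∈ rootsIn H b := mem_rootsIn.mpr hχ
      simp only [d]
      rw [dif_pos h]
      exact (h3 _ hm).le
  have hsol := isSolvable_filtSubalgebra hd hd0
  -- Maximality among solvable subalgebras turns the inclusion into an equality.
  have heq : ∀ x, x ∈ b ↔ x ∈ filt d 0 := fun x =>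
    ⟨fun h => hle h, fun h => hb.le_of_ge hsol hle h⟩
  have hdisj := disjoint_filt_one hd
  -- The projection is taken along a complement of `H` that contains all positive degrees; hence it
  -- kills the brackets of elements of `b`.
  obtain ⟨C, hC1, hC2⟩ := hdisj.symm.exists_isCompl
  have hC := hC2.symm
  refine ⟨y, d, H.toSubmodule.projectionOnto C hC, hd, hd0, heq, fun h => ?_, ?_⟩
  · exact Submodule.projectionOnto_apply_left hC h
  · intro x hx z hz
    rw [Submodule.projectionOnto_apply_eq_zero_iff]
    exact hC1 (lie_mem_filt_one hd hd0 ((heq x).mp hx) ((heq z).mp hz))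

end BorelRoots

end

/-! ### The integral grading of the affine Kac-Moody algebra -/

noncomputable section

namespace AffineO

open LieAlgebra LieModule Module

variable {𝔤 : Type u} [LieRing 𝔤] [LieAlgebra ℂ 𝔤]

/-- A homogeneous spanning family of the affine Kac-Moody algebra, for the integral grading given
by an element of the affine Cartan subalgebra, adapted to the affine Borel subalgebra. -/
structure Grading (𝔥 𝔟 : LieSubalgebra ℂ 𝔤) [LieRing.IsNilpotent 𝔥] where
  /-- the index type -/
  ι : Type u
  /-- the vectors of the family -/
  vec : ι → Affine 𝔤
  /-- their weights -/
  wt : ι → Wt 𝔥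
  /-- their degrees -/
  deg : ι → ℤ
  /-- the element defining the grading -/
  elt : CartanHat 𝔥
  span_eq_top : Submodule.span ℂ (Set.range vec) = ⊤
  lie_vec : ∀ H i, ⁅cartanIncl 𝔥 H, vec i⁆ = wt i H • vec i
  wt_elt : ∀ i, wt i elt = deg i
  of_deg_zero : ∀ i, deg i = 0 → vec i ∈ LinearMap.range (cartanIncl 𝔥)
  mem_borel : ∀ i, 0 ≤ deg i → vec i ∈ borelHat 𝔟
  wt_pos : ∀ i, 0 < deg i → wt i ∈ posAffineRoots 𝔥 𝔟
  wt_neg : ∀ i, deg i < 0 → -wt i ∈ posAffineRoots 𝔥 𝔟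
  borel_le : ∀ x ∈ borelHat 𝔟, x ∈ Submodule.span ℂ (vec '' {i | 0 ≤ deg i})
  finite_deg : ∀ n, {i | deg i = n}.Finite
  height_pos : ∀ γ ∈ posAffineRoots 𝔥 𝔟, ∃ n : ℕ, 0 < n ∧ γ elt = n
  finite_height : ∀ n : ℕ, {γ ∈ posAffineRoots 𝔥 𝔟 | γ elt = n}.Finite
  le : 𝔥 ≤ 𝔟
  /-- the projection to the Cartan subalgebra -/
  proj : 𝔤 →ₗ[ℂ] 𝔥
  proj_coe : ∀ h : 𝔥, proj h = h
  proj_lie : ∀ x ∈ 𝔟, ∀ y ∈ 𝔟, proj ⁅x, y⁆ = 0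

variable [FiniteDimensional ℂ 𝔤] [LieAlgebra.IsSimple ℂ 𝔤] (𝔥 𝔟 : LieSubalgebra ℂ 𝔤)
  [𝔥.IsCartanSubalgebra]

open BorelRoots in
-- The grading element is y + N D, with y the regular element for 𝔟 and N so large that the power of
-- t decides the sign of the degree unless it is zero. Degree zero is then the affine Cartan
-- subalgebra, and nonnegative degrees span 𝔟̂.
theorem nonempty_grading (h𝔟 : IsBorel 𝔟) (h𝔥𝔟 : 𝔥 ≤ 𝔟) : Nonempty (Grading 𝔥 𝔟) := by
  classical
  obtain ⟨y, d, pr, hd, hd0, hb, hpr, hpr'⟩ := exists_grading 𝔥 𝔟 h𝔟 h𝔥𝔟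
  have := Fintype.ofFinite (Weight ℂ 𝔥 𝔤)
  obtain ⟨N, hN1, hN⟩ : ∃ N : ℕ, 0 < N ∧ ∀ χ, |d χ| < N := by
    refine ⟨1 + ∑ χ, (d χ).natAbs, by omega, fun χ => ?_⟩
    have := Finset.single_le_sum (f := fun χ => (d χ).natAbs) (fun _ _ => Nat.zero_le _)
      (Finset.mem_univ χ)
    rw [Int.abs_eq_natAbs]
    omega
  let κ : Type u := Σ χ : Weight ℂ 𝔥 𝔤, Fin (finrank ℂ (rootSpace 𝔥 χ))
  have hκ : Finite κ := inferInstance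
  let bas (k : κ) : 𝔤 := (finBasis ℂ (rootSpace 𝔥 k.1) k.2 : rootSpace 𝔥 k.1)
  have hbas (k : κ) : bas k ∈ rootSpace 𝔥 k.1 := (finBasis ℂ (rootSpace 𝔥 k.1) k.2).2
  have hspan (χ : Weight ℂ 𝔥 𝔤) (x : 𝔤) (hx : x ∈ rootSpace 𝔥 χ) :
      x ∈ Submodule.span ℂ (bas '' {k | k.1 = χ}) := by
    have h1 := (finBasis ℂ (rootSpace 𝔥 χ)).mem_span ⟨x, hx⟩
    have h2 := Submodule.mem_map_of_mem (f := (rootSpace 𝔥 χ).toSubmodule.subtype) h1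
    rw [Submodule.map_span] at h2
    refine Submodule.span_mono ?_ h2
    rintro _ ⟨_, ⟨i, rfl⟩, rfl⟩
    exact ⟨⟨χ, i⟩, rfl, rfl⟩
  have htop (x : 𝔤) : x ∈ Submodule.span ℂ (Set.range bas) := by
    have h1 : x ∈ ⨆ χ : Weight ℂ 𝔥 𝔤, genWeightSpace 𝔤 χ := by
      rw [iSup_genWeightSpace_eq_top']; trivial
    refine LieSubmodule.iSup_induction _ (motive := fun x => x ∈ Submodule.span ℂ (Set.range bas))
      h1 (fun χ x hx => ?_) (Submodule.zero_mem _) (fun _ _ => Submodule.add_mem _)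
    exact Submodule.span_mono (Set.image_subset_range _ _) (hspan χ x hx)
  let sing (n : ℤ) : 𝔤 →ₗ[ℂ] Affine 𝔤 :=
    { toFun x := ⟨Finsupp.single n x, 0, 0⟩
      map_add' x y := by ext1 <;> simp
      map_smul' a x := by ext1 <;> simp }
  let ι : Type u := (κ × ℤ) ⊕ ULift.{u} Bool
  let vec : ι → Affine 𝔤 := Sum.elim (fun p => sing p.2 (bas p.1))
    -- The two extra basis vectors are K and D, of weight and degree zero.
    (fun c => if c.down then ⟨0, 1, 0⟩ else ⟨0, 0, 1⟩)
  let wt : ι → Wt 𝔥 := Sum.elim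
    (fun p => wtIncl (Weight.toLinear ℂ 𝔥 𝔤 p.1.1) + p.2 • delta 𝔥) (fun _ => 0)
  let deg : ι → ℤ := Sum.elim (fun p => d p.1.1 + p.2 * N) (fun _ => 0)
  let elt : CartanHat 𝔥 := (y, 0, N)
  have elt_wtIncl : ∀ α : Dual ℂ 𝔥, wtIncl α elt = α y := fun _ => rfl
  have elt_delta : delta 𝔥 elt = N := rfl
  have root_of (χ : Weight ℂ 𝔥 𝔤) (h : d χ ≠ 0) : Weight.toLinear ℂ 𝔥 𝔤 χ ∈ roots 𝔥 := by
    refine ⟨fun h0 => h ?_, χ.genWeightSpace_ne_bot⟩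
    have h1 : χ y = 0 := LinearMap.congr_fun h0 y
    rw [hd] at h1
    exact_mod_cast h1
  have pos_of (χ : Weight ℂ 𝔥 𝔤) (h : 0 < d χ) :
      Weight.toLinear ℂ 𝔥 𝔤 χ ∈ posRoots 𝔥 𝔟 :=
    ⟨root_of χ h.ne', fun x hx => (hb x).mpr (mem_filt χ h.le hx)⟩
  have zero_of (χ : Weight ℂ 𝔥 𝔤) (h : d χ = 0) : Weight.toLinear ℂ 𝔥 𝔤 χ = 0 := by
    have h1 : (χ : 𝔥 → ℂ) = 0 := hd0 χ h
    ext x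
    exact congrFun h1 x
  -- every weight with positive degree is a positive affine root
  have pos_aff (χ : Weight ℂ 𝔥 𝔤) (n : ℤ) (h : 0 < d χ + n * N) :
      wtIncl (Weight.toLinear ℂ 𝔥 𝔤 χ) + n • delta 𝔥 ∈ posAffineRoots 𝔥 𝔟 := by
    have h1 := abs_lt.mp (hN χ)
    have hn : 0 ≤ n := by
      by_contra hn
      have : n * N ≤ (-1) * N := mul_le_mul_of_nonneg_right (by omega) (by positivity)
      linarith
    lift n to ℕ using hn
    rw [natCast_zsmul]
    rcases Nat.eq_zero_or_pos n with rfl | hn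
    · left
      exact ⟨_, pos_of χ (by simpa using h), by simp⟩
    · right
      by_cases h0 : d χ = 0
      · right
        exact ⟨n, hn, by rw [zero_of χ h0]; simp [wtIncl]⟩
      · left
        exact ⟨_, root_of χ h0, n, hn, rfl⟩
  -- the weight of a root
  have weight_of (α : Dual ℂ 𝔥) (hα : α ∈ roots 𝔥) :
      ∃ χ : Weight ℂ 𝔥 𝔤, Weight.toLinear ℂ 𝔥 𝔤 χ = α ∧ d χ ≠ 0 := by
    refine ⟨⟨α, hα.2⟩, by ext; rfl, fun h => hα.1 ?_⟩
    rw [← zero_of _ h]; ext; rfl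
  let S : Set (Dual ℂ 𝔥) := insert 0 (Set.range (Weight.toLinear ℂ 𝔥 𝔤))
  have hS : S.Finite := (Set.finite_range _).insert _
  have aff_pos (γ : Wt 𝔥) (hγ : γ ∈ posAffineRoots 𝔥 𝔟) : ∃ α ∈ S, ∃ (n : ℕ) (e : ℤ),
      γ = wtIncl α + n • delta 𝔥 ∧ α y = e ∧ 0 < e + n * N ∧ |e| < N := by
    have hz : ∀ n : ℕ, 0 < n → ∀ e : ℤ, |e| < N → 0 < e + n * N := by
      intro n hn e he
      have h1 := abs_lt.mp he
      have : 1 * (N : ℤ) ≤ n * N := mul_le_mul_of_nonneg_right (by omega) (by positivity)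
      linarith
    rcases hγ with ⟨α, hα, rfl⟩ | ⟨α, hα, n, hn, rfl⟩ | ⟨n, hn, rfl⟩
    · obtain ⟨χ, rfl, h0⟩ := weight_of α hα.1
      refine ⟨_, Or.inr ⟨χ, rfl⟩, 0, d χ, by simp, hd χ, ?_, hN χ⟩
      simp only [Nat.cast_zero, zero_mul, add_zero]
      rcases lt_or_gt_of_ne h0 with h | h
      · exfalso
        -- A root of 𝔟 cannot have negative degree: its root space would meet the nonnegative part.
        obtain ⟨x, hx, hx0⟩ := χ.exists_ne_zero
        have h1 := (hb x).mp (hα.2 x hx)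
        exact hx0 ((Submodule.disjoint_def.mp (disjoint_filt hd (hd χ) h)) x hx h1)
      · exact h
    · obtain ⟨χ, rfl, h0⟩ := weight_of α hα
      exact ⟨_, Or.inr ⟨χ, rfl⟩, n, d χ, rfl, hd χ, hz n hn _ (hN χ), hN χ⟩
    · exact ⟨0, Or.inl rfl, n, 0, by simp [wtIncl], by simp, hz n hn 0 (by simpa using hN1),
        by simpa using hN1⟩
  have elt_aff : ∀ (α : Dual ℂ 𝔥) (n : ℕ) (e : ℤ), α y = e →
      (wtIncl α + n • delta 𝔥 : Wt 𝔥) elt = ((e + n * N : ℤ) : ℂ) := by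
    intro α n e h
    rw [LinearMap.add_apply, LinearMap.smul_apply, elt_wtIncl, elt_delta, h]
    push_cast
    simp
  -- spanning
  have span_of (T : Set ι) (x : Affine 𝔤)
      (h1 : ∀ n, x.loop n ≠ 0 → sing n (x.loop n) ∈ Submodule.span ℂ (vec '' T))
      (h2 : ∀ c, Sum.inr c ∈ T) : x ∈ Submodule.span ℂ (vec '' T) := by
    have h3 : x = ∑ n ∈ x.loop.support, sing n (x.loop n) + x.central • vec (Sum.inr ⟨true⟩) +
        x.deriv • vec (Sum.inr ⟨false⟩) := by
      let L : Affine 𝔤 →ₗ[ℂ] (ℤ →₀ 𝔤) :=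
        { toFun x := x.loop, map_add' _ _ := rfl, map_smul' _ _ := rfl }
      let C : Affine 𝔤 →ₗ[ℂ] ℂ :=
        { toFun x := x.central, map_add' _ _ := rfl, map_smul' _ _ := rfl }
      let D : Affine 𝔤 →ₗ[ℂ] ℂ :=
        { toFun x := x.deriv, map_add' _ _ := rfl, map_smul' _ _ := rfl }
      have key (z : Affine 𝔤) (h1 : L x = L z) (h2 : C x = C z) (h3 : D x = D z) : x = z :=
        Affine.ext h1 h2 h3
      have hL (n : ℤ) (z : 𝔤) : L (sing n z) = Finsupp.single n z := rfl
      have hC (n : ℤ) (z : 𝔤) : C (sing n z) = 0 := rfl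
      have hD (n : ℤ) (z : 𝔤) : D (sing n z) = 0 := rfl
      have hL1 : L (vec (Sum.inr ⟨true⟩)) = 0 := rfl
      have hC1 : C (vec (Sum.inr ⟨true⟩)) = 1 := rfl
      have hD1 : D (vec (Sum.inr ⟨true⟩)) = 0 := rfl
      have hL0 : L (vec (Sum.inr ⟨false⟩)) = 0 := rfl
      have hC0 : C (vec (Sum.inr ⟨false⟩)) = 0 := rfl
      have hD0 : D (vec (Sum.inr ⟨false⟩)) = 1 := rfl
      apply key
      · rw [map_add, map_add, map_sum, map_smul, map_smul, hL1, hL0, smul_zero, smul_zero,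
          add_zero, add_zero]
        simp only [hL]
        exact (Finsupp.sum_single x.loop).symm
      · rw [map_add, map_add, map_sum, map_smul, map_smul, hC1, hC0]
        simp only [hC, Finset.sum_const_zero, zero_add, smul_eq_mul, mul_one, mul_zero, add_zero]
        rfl
      · rw [map_add, map_add, map_sum, map_smul, map_smul, hD1, hD0]
        simp only [hD, Finset.sum_const_zero, zero_add, smul_eq_mul, mul_one, mul_zero]
        rfl
    rw [h3]
    refine Submodule.add_mem _ (Submodule.add_mem _ (Submodule.sum_mem _ fun n hn => ?_) ?_) ?_
    · exact h1 n (Finsupp.mem_support_iff.mp hn)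
    · exact Submodule.smul_mem _ _ (Submodule.subset_span ⟨_, h2 _, rfl⟩)
    · exact Submodule.smul_mem _ _ (Submodule.subset_span ⟨_, h2 _, rfl⟩)
  have sing_mem (T : Set ι) (U : Set κ) (n : ℤ) (hU : ∀ k ∈ U, Sum.inl (k, n) ∈ T) (x : 𝔤)
      (hx : x ∈ Submodule.span ℂ (bas '' U)) : sing n x ∈ Submodule.span ℂ (vec '' T) := by
    have h1 := Submodule.mem_map_of_mem (f := sing n) hx
    rw [Submodule.map_span] at h1
    refine Submodule.span_mono ?_ h1
    rintro _ ⟨_, ⟨k, hk, rfl⟩, rfl⟩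
    exact ⟨_, hU k hk, rfl⟩
  have deg_zero (χ : Weight ℂ 𝔥 𝔤) (n : ℤ) (h : d χ + n * N = 0) : d χ = 0 ∧ n = 0 := by
    have h3 := abs_lt.mp (hN χ)
    have h4 : n = 0 := by
      by_contra hn
      rcases lt_or_gt_of_ne hn with hn | hn
      · have : n * N ≤ (-1) * N := mul_le_mul_of_nonneg_right (by omega) (by positivity)
        linarith
      · have : 1 * (N : ℤ) ≤ n * N := mul_le_mul_of_nonneg_right (by omega) (by positivity)
        linarith
    subst h4
    exact ⟨by simpa using h, rfl⟩
  have d_neg (χ : Weight ℂ 𝔥 𝔤) : d (-χ) = -d χ := by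
    have h1 := hd (-χ)
    have h2 : (-χ : Weight ℂ 𝔥 𝔤) y = -χ y := by simp
    rw [h2, hd χ] at h1
    exact_mod_cast h1.symm
  refine ⟨{
    ι := ι
    vec := vec
    wt := wt
    deg := deg
    elt := elt
    span_eq_top := ?_
    lie_vec := ?_
    wt_elt := ?_
    of_deg_zero := ?_
    mem_borel := ?_
    wt_pos := ?_
    wt_neg := ?_
    borel_le := ?_
    finite_deg := ?_
    height_pos := ?_
    finite_height := ?_
    le := h𝔥𝔟
    proj := pr
    proj_coe := hpr
    proj_lie := hpr' }⟩
  · rw [eq_top_iff, ← Set.image_univ]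
    intro x _
    refine span_of Set.univ x (fun n _ => ?_) (fun _ => trivial)
    refine sing_mem Set.univ Set.univ n (fun _ _ => trivial) _ ?_
    rw [Set.image_univ]
    exact htop _
  · rintro H (⟨k, n⟩ | ⟨_ | _⟩)
    · have h1 : ⁅(H.1 : 𝔤), bas k⁆ = k.1 H.1 • bas k :=
        LieAlgebra.IsKilling.lie_eq_smul_of_mem_rootSpace (hbas k) H.1
      have h2 : wt (Sum.inl (k, n)) H = k.1 H.1 + n * H.2.2 := by
        simp [wt, wtIncl, delta]
      rw [h2]
      ext1
      · simp only [loop_lie, cartanIncl, LinearMap.coe_mk, AddHom.coe_mk, vec, sing, Sum.elim_inl,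
          loopBracket_single, loop_smul, h1, euler_single, zero_smul, sub_zero, zero_add,
          Finsupp.smul_single, smul_smul]
        rw [← Finsupp.single_add, ← add_smul, mul_comm H.2.2]
      · simp only [central_lie, cartanIncl, LinearMap.coe_mk, AddHom.coe_mk, vec, sing,
          Sum.elim_inl, loopCocycle_single, central_smul, Int.cast_zero, zero_mul, ite_self,
          mul_zero]
      · simp [vec, sing]
    · ext1
      · simp [vec, wt, cartanIncl, euler_single]
      · simp [vec, wt]
      · simp [vec, wt]
    · ext1
      · simp [vec, wt, cartanIncl]
      · simp [vec, wt]
      · simp [vec, wt]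
  · rintro (⟨k, n⟩ | c)
    · change wtIncl (Weight.toLinear ℂ 𝔥 𝔤 k.1) elt + (n • delta 𝔥) elt = _
      rw [elt_wtIncl, LinearMap.smul_apply, elt_delta]
      simp [deg, hd]
    · simp [wt, deg]
  · rintro (⟨k, n⟩ | ⟨_ | _⟩) h
    · have h1 : d k.1 + n * N = 0 := h
      obtain ⟨h2, rfl⟩ := deg_zero k.1 n h1
      exact ⟨(⟨bas k, mem_of_isZero (hd0 _ h2) (hbas k)⟩, 0, 0), rfl⟩
    · exact ⟨(0, 0, 1), by ext1 <;> simp [cartanIncl, vec]⟩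
    · exact ⟨(0, 1, 0), by ext1 <;> simp [cartanIncl, vec]⟩
  · rintro (⟨k, n⟩ | ⟨_ | _⟩) h
    · have h1 : 0 ≤ d k.1 + n * N := h
      have h3 := abs_lt.mp (hN k.1)
      have hn : 0 ≤ n := by
        by_contra hn
        have : n * N ≤ (-1) * N := mul_le_mul_of_nonneg_right (by omega) (by positivity)
        linarith
      refine ⟨fun m hm => Finsupp.single_eq_of_ne (by omega), ?_⟩
      change Finsupp.single n (bas k) 0 ∈ 𝔟
      rcases hn.eq_or_lt with rfl | hn
      · rw [Finsupp.single_eq_same]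
        exact (hb _).mpr (mem_filt k.1 (by simpa using h1) (hbas k))
      · rw [Finsupp.single_eq_of_ne (by omega)]
        exact 𝔟.zero_mem
    · exact ⟨fun _ _ => rfl, 𝔟.zero_mem⟩
    · exact ⟨fun _ _ => rfl, 𝔟.zero_mem⟩
  · rintro (⟨k, n⟩ | c) h
    · exact pos_aff k.1 n h
    · exact absurd h (lt_irrefl _)
  · rintro (⟨k, n⟩ | c) h
    · have h1 : d k.1 + n * N < 0 := h
      have h2 := pos_aff (-k.1) (-n) (by rw [d_neg]; linarith)
      convert h2 using 1
      change -(wtIncl _ + n • delta 𝔥) = _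
      ext H <;> simp [wtIncl, delta]
    · exact absurd h (lt_irrefl _)
  · intro x hx
    refine span_of _ x (fun n hn => ?_) (fun _ => le_refl (0 : ℤ))
    have hn0 : 0 ≤ n := by
      by_contra h
      exact hn (hx.1 n (not_le.mp h))
    rcases hn0.eq_or_lt with rfl | hn0
    · refine sing_mem _ {k | 0 ≤ d k.1} 0 (fun k hk => ?_) _ ?_
      · change 0 ≤ d k.1 + 0 * N
        simpa using hk
      · refine filt_induction (p := fun x => x ∈ Submodule.span ℂ (bas '' {k | 0 ≤ d k.1}))
          (Submodule.zero_mem _) (fun _ _ => Submodule.add_mem _) ?_ ((hb _).mp hx.2)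
        intro χ hχ z hz
        refine Submodule.span_mono (Set.image_mono ?_) (hspan χ z hz)
        rintro k rfl
        exact hχ
    · refine sing_mem _ Set.univ n (fun k _ => ?_) _ (by rw [Set.image_univ]; exact htop _)
      change 0 ≤ d k.1 + n * N
      have h3 := abs_lt.mp (hN k.1)
      have : 1 * (N : ℤ) ≤ n * N := mul_le_mul_of_nonneg_right (by omega) (by positivity)
      linarith
  · intro m
    have h1 : ({i | deg i = m} : Set ι) ⊆
        Set.range (Sum.inr : ULift.{u} Bool → ι) ∪
          ((fun p : κ × ℤ => (Sum.inl p : ι)) '' {p | d p.1.1 + p.2 * N = m}) := by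
      rintro (p | c) h
      · exact Or.inr ⟨p, h, rfl⟩
      · exact Or.inl ⟨c, rfl⟩
    refine ((Set.finite_range _).union (Set.Finite.image _ ?_)).subset h1
    refine Set.Finite.of_finite_image (f := Prod.fst) (Set.toFinite _) ?_
    rintro ⟨k, n⟩ (h : _ = _) ⟨k', n'⟩ (h' : _ = _) (rfl : k = k')
    have h2 : n * (N : ℤ) = n' * N := by linarith
    rw [mul_right_cancel₀ (by exact_mod_cast hN1.ne') h2]
  · intro γ hγ
    obtain ⟨α, -, n, e, rfl, h1, h2, -⟩ := aff_pos γ hγ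
    obtain ⟨m, hm⟩ := Int.eq_ofNat_of_zero_le h2.le
    refine ⟨m, by omega, ?_⟩
    rw [elt_aff α n e h1, hm, Int.cast_natCast]
  · intro m
    -- A positive affine root α + nδ of height m satisfies n ≤ nN = m - e with |e| < N, so α and n
    -- have finitely many values.
    refine ((hS.prod (Set.finite_lt_nat (m + N + 1))).image
      (fun p => wtIncl p.1 + p.2 • delta 𝔥)).subset ?_
    rintro γ ⟨hγ, hm⟩
    obtain ⟨α, hα, n, e, rfl, h1, h2, h3⟩ := aff_pos γ hγ
    refine ⟨(α, n), ⟨hα, ?_⟩, rfl⟩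
    rw [elt_aff α n e h1] at hm
    have h4 : e + n * N = m := by exact_mod_cast hm
    have h5 := abs_lt.mp h3
    have h6 : (n : ℤ) * 1 ≤ n * N := mul_le_mul_of_nonneg_left (by omega) (by positivity)
    change n < m + N + 1
    omega

end AffineO

end

/-! ### The action of the affine algebra on modules -/

noncomputable section

namespace AffineO

section Env

variable {𝔤 : Type u} [LieRing 𝔤] [LieAlgebra ℂ 𝔤] {A : Type u} [CommRing A] [Algebra ℂ A]

lemma act_add (x y : Affine 𝔤) : act A (x + y) = act A x + act A y := by
  simp [act, TensorProduct.tmul_add]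

lemma act_smul (c : ℂ) (x : Affine 𝔤) : act A (c • x) = algebraMap ℂ A c • act A x := by
  rw [act, map_smul, TensorProduct.tmul_smul, act, TensorProduct.smul_tmul', TensorProduct.smul_tmul',
    algebraMap_smul]

lemma act_zero : act A (0 : Affine 𝔤) = 0 := by simp [act]

lemma act_lie (x y : Affine 𝔤) : act A ⁅x, y⁆ = act A x * act A y - act A y * act A x := by
  let _ : LieRing (UniversalEnvelopingAlgebra ℂ (Affine 𝔤)) := LieRing.ofAssociativeRing
  rw [act, LieHom.map_lie, LieRing.of_associative_ring_bracket, TensorProduct.tmul_sub, act, act,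
    Algebra.TensorProduct.tmul_mul_tmul, Algebra.TensorProduct.tmul_mul_tmul, one_mul]

lemma act_smul_smul {M : GMod 𝔤 A} (x : Affine 𝔤) (a : A) (m : M) :
    act A x • a • m = a • act A x • m := smul_comm _ _ _

/-- An `A`-submodule that is stable under the affine Kac-Moody algebra is a submodule. -/
lemma smul_mem_of_act {M : GMod 𝔤 A} (N : Submodule A M)
    (h : ∀ x : Affine 𝔤, ∀ v ∈ N, act A x • v ∈ N) (e : Env 𝔤 A) {v : M} (hv : v ∈ N) :
    e • v ∈ N := by
  -- The elements of the enveloping algebra that preserve `N` form a subalgebra containing 𝔤̂; the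
  -- universal property shows that it is everything.
  let S : Subalgebra ℂ (UniversalEnvelopingAlgebra ℂ (Affine 𝔤)) :=
    { carrier := {r | ∀ v ∈ N, ((1 : A) ⊗ₜ[ℂ] r : Env 𝔤 A) • v ∈ N}
      mul_mem' := fun {r s} hr hs v hv => by
        have := hr _ (hs v hv)
        rwa [smul_smul, Algebra.TensorProduct.tmul_mul_tmul, one_mul] at this
      add_mem' := fun {r s} hr hs v hv => by
        rw [TensorProduct.tmul_add, add_smul]
        exact N.add_mem (hr v hv) (hs v hv)
      algebraMap_mem' := fun c v hv => by
        rw [Algebra.algebraMap_eq_smul_one, ← TensorProduct.smul_tmul,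
          ← Algebra.algebraMap_eq_smul_one]
        exact N.smul_mem (algebraMap ℂ A c) hv }
  have hS (r : UniversalEnvelopingAlgebra ℂ (Affine 𝔤)) : r ∈ S := by
    let _ : LieRing (UniversalEnvelopingAlgebra ℂ (Affine 𝔤)) := LieRing.ofAssociativeRing
    let _ : LieRing S := LieRing.ofAssociativeRing
    let f : Affine 𝔤 →ₗ⁅ℂ⁆ S :=
      { toFun x := ⟨UniversalEnvelopingAlgebra.ι ℂ x, fun v hv => h x v hv⟩
        map_add' x y := by ext1; simp
        map_smul' c x := by ext1; simp
        map_lie' {x y} := by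
          ext1
          rw [LieRing.of_associative_ring_bracket]
          simp only [LieHom.map_lie, LieRing.of_associative_ring_bracket]
          rfl }
    have h1 : S.val.comp (UniversalEnvelopingAlgebra.lift ℂ f) = AlgHom.id ℂ _ := by
      apply UniversalEnvelopingAlgebra.hom_ext
      ext x
      simp only [LieHom.comp_apply, AlgHom.coe_toLieHom, AlgHom.comp_apply,
        UniversalEnvelopingAlgebra.lift_ι_apply]
      rfl
    have h2 := congrArg (fun g => g r) h1
    simp only [AlgHom.comp_apply, AlgHom.id_apply] at h2
    rw [← h2]
    exact (UniversalEnvelopingAlgebra.lift ℂ f r).2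
  induction e using TensorProduct.induction_on with
  | zero => rw [zero_smul]; exact N.zero_mem
  | add e e' he he' => rw [add_smul]; exact N.add_mem he he'
  | tmul a r =>
    have h1 : (a ⊗ₜ[ℂ] r : Env 𝔤 A) = a • ((1 : A) ⊗ₜ[ℂ] r) := by
      rw [TensorProduct.smul_tmul', smul_eq_mul, mul_one]
    rw [h1, smul_assoc]
    exact N.smul_mem _ (hS r v hv)

end Env

/-! ### Weight components -/

section WeightSpaces

variable {𝔤 : Type u} [LieRing 𝔤] [LieAlgebra ℂ 𝔤] {𝔥 𝔟 : LieSubalgebra ℂ 𝔤}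
  {A : Type u} [CommRing A] [Algebra ℂ A] [Algebra (SymmetricAlgebra ℂ 𝔥) A]

lemma map_mem_weightSpace {M N : GMod 𝔤 A} (f : M →ₗ[Env 𝔤 A] N) {lam : Wt 𝔥} {m : M}
    (hm : m ∈ weightSpace 𝔥 M lam) : f m ∈ weightSpace 𝔥 N lam := fun H => by
  rw [← map_smul, hm H, smul_eq, map_smul, ← smul_eq]

lemma mem_weightSpace_of_map {M N : GMod 𝔤 A} {f : M →ₗ[Env 𝔤 A] N}
    (hf : Function.Injective f) {lam : Wt 𝔥} {m : M} (hm : f m ∈ weightSpace 𝔥 N lam) :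
    m ∈ weightSpace 𝔥 M lam := fun H => by
  apply hf
  rw [map_smul, hm H, smul_eq, smul_eq, map_smul]

/-- The weight components of an element of a stable submodule lie in this submodule. -/
lemma mem_of_sum_mem {M : GMod 𝔤 A} (N : Submodule A M)
    (hN : ∀ H : CartanHat 𝔥, ∀ v ∈ N, act A (cartanIncl 𝔥 H) • v ∈ N) (s : Finset (Wt 𝔥)) :
    ∀ v : Wt 𝔥 → M, (∀ lam ∈ s, v lam ∈ weightSpace 𝔥 M lam) → ∑ lam ∈ s, v lam ∈ N →
      ∀ lam ∈ s, v lam ∈ N := by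
  classical
  induction s using Finset.induction_on with
  | empty => simp
  | insert μ s hμ ih =>
    intro v hv hsum
    have hz : ∀ lam ∈ s, v lam ∈ N := by
      intro lam hl
      obtain ⟨H, hH⟩ : ∃ H, lam H ≠ μ H := by
        by_contra! hc
        exact hμ (LinearMap.ext hc ▸ hl)
      have hu : IsUnit (algebraMap ℂ A (lam H - μ H)) :=
        (IsUnit.mk0 _ (sub_ne_zero.mpr hH)).map _
      -- Applying `H` minus its eigenvalue on weight μ removes the component of weight μ and
      -- multiplies the one of weight `lam` by the scalar lam(H) - μ(H), a nonzero complex number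
      -- for suitable `H`.
      have h1 : act A (cartanIncl 𝔥 H) • (∑ lam ∈ insert μ s, v lam) -
          (algebraMap ℂ A (μ H) + tau 𝔥 A H) • (∑ lam ∈ insert μ s, v lam) ∈ N :=
        N.sub_mem (hN H _ hsum) (N.smul_mem _ hsum)
      rw [Finset.sum_insert hμ, smul_add, smul_add, hv μ (Finset.mem_insert_self _ _) H,
        add_sub_add_left_eq_sub, Finset.smul_sum, Finset.smul_sum,
        ← Finset.sum_sub_distrib] at h1
      have h2 := ih (fun lam => algebraMap ℂ A (lam H - μ H) • v lam)
        (fun i hi => Submodule.smul_mem _ _ (hv i (Finset.mem_insert_of_mem hi))) ?_ lam hl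
      · obtain ⟨b, hb⟩ := hu.exists_left_inv
        have h3 := N.smul_mem b h2
        rwa [smul_smul, hb, one_smul] at h3
      · convert h1 using 1
        refine Finset.sum_congr rfl fun i hi => ?_
        rw [hv i (Finset.mem_insert_of_mem hi) H, ← sub_smul, map_sub]
        congr 1; ring
    intro i hi
    rcases Finset.mem_insert.mp hi with rfl | hi
    · rw [Finset.sum_insert hμ] at hsum
      exact (N.add_mem_iff_left (N.sum_mem hz)).mp hsum
    · exact hz i hi

lemma exists_sum_of_mem_iSup {M : GMod 𝔤 A} {m : M}
    (hm : m ∈ ⨆ lam : Wt 𝔥, weightSpace 𝔥 M lam) :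
    ∃ (s : Finset (Wt 𝔥)) (v : Wt 𝔥 → M), (∀ lam, v lam ∈ weightSpace 𝔥 M lam) ∧
      m = ∑ lam ∈ s, v lam := by
  classical
  obtain ⟨f, hf, h⟩ := (Submodule.mem_iSup_iff_exists_finsupp _ _).mp hm
  exact ⟨f.support, f, hf, h.symm⟩

lemma IsWeightModule.exists_sum {M : GMod 𝔤 A} (hM : IsWeightModule 𝔥 M) (m : M) :
    ∃ (s : Finset (Wt 𝔥)) (v : Wt 𝔥 → M), (∀ lam, v lam ∈ weightSpace 𝔥 M lam) ∧
      m = ∑ lam ∈ s, v lam :=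
  exists_sum_of_mem_iSup (by rw [(isWeightModule_iff 𝔥 M).mp hM]; trivial)

lemma isWeightModule_of_span {M : GMod 𝔤 A} (S : Set M)
    (hS : ∀ s ∈ S, ∃ lam, s ∈ weightSpace 𝔥 M lam) (h : Submodule.span A S = ⊤) :
    IsWeightModule 𝔥 M := by
  rw [isWeightModule_iff, eq_top_iff, ← h, Submodule.span_le]
  intro s hs
  obtain ⟨lam, hl⟩ := hS s hs
  exact Submodule.mem_iSup_of_mem lam hl

lemma mem_bot_of_weightSpace_inf {M : GMod 𝔤 A} {μ : Wt 𝔥} {m : M}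
    (h1 : m ∈ weightSpace 𝔥 M μ) (h2 : m ∈ ⨆ lam ≠ μ, weightSpace 𝔥 M lam) : m = 0 :=
  Submodule.disjoint_def.mp (weightSpace_indep 𝔥 M μ) m h1 h2

/-- In the span of weight vectors, the vectors of weight `μ` are spanned by the given vectors of
weight `μ`. -/
lemma mem_span_of_weight {M : GMod 𝔤 A} {κ : Type*} (s : κ → M) (wt : κ → Wt 𝔥)
    (hs : ∀ k, s k ∈ weightSpace 𝔥 M (wt k)) (T : Set κ) {μ : Wt 𝔥} {m : M}
    (hm : m ∈ Submodule.span A (s '' T)) (hμ : m ∈ weightSpace 𝔥 M μ) :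
    m ∈ Submodule.span A (s '' {k ∈ T | wt k = μ}) := by
  have h : Submodule.span A (s '' T) ≤
      Submodule.span A (s '' {k ∈ T | wt k = μ}) ⊔ ⨆ lam ≠ μ, weightSpace 𝔥 M lam := by
    rw [Submodule.span_le]
    rintro _ ⟨k, hk, rfl⟩
    by_cases h : wt k = μ
    · exact Submodule.mem_sup_left (Submodule.subset_span ⟨k, ⟨hk, h⟩, rfl⟩)
    · exact Submodule.mem_sup_right (Submodule.mem_iSup_of_mem _ (Submodule.mem_iSup_of_mem h (hs k)))
  obtain ⟨a, ha, b, hb, rfl⟩ := Submodule.mem_sup.mp (h hm)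
  have ha' : a ∈ weightSpace 𝔥 M μ := by
    refine Submodule.span_le.mpr ?_ ha
    rintro _ ⟨k, hk, rfl⟩
    have := hs k
    rw [hk.2] at this
    exact this
  have hb' : b = 0 :=
    mem_bot_of_weightSpace_inf ((Submodule.add_mem_iff_right _ ha').mp hμ) hb
  rwa [hb', add_zero]

/-- The component of weight `lam` of any preimage works, because weight spaces are independent. This
exactness is what makes the universal modules projective. -/
lemma exists_mem_weightSpace_of_surjective {M N : GMod 𝔤 A} (hM : IsWeightModule 𝔥 M)
    (f : M →ₗ[Env 𝔤 A] N) (hf : Function.Surjective f) {lam : Wt 𝔥} {n : N}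
    (hn : n ∈ weightSpace 𝔥 N lam) : ∃ m ∈ weightSpace 𝔥 M lam, f m = n := by
  classical
  obtain ⟨m, rfl⟩ := hf n
  obtain ⟨s, v, hv, rfl⟩ := hM.exists_sum m
  have h1 (μ : Wt 𝔥) : f (v μ) ∈ weightSpace 𝔥 N μ := map_mem_weightSpace f (hv μ)
  rw [map_sum] at hn ⊢
  refine ⟨if lam ∈ s then v lam else 0, ?_, ?_⟩
  · split_ifs
    exacts [hv lam, Submodule.zero_mem _]
  · have h2 : ∑ μ ∈ s, f (v μ) = (if lam ∈ s then f (v lam) else 0) +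
        ∑ μ ∈ s.erase lam, f (v μ) := by
      split_ifs with h
      · exact (Finset.add_sum_erase s (fun μ => f (v μ)) h).symm
      · rw [Finset.erase_eq_of_notMem h, zero_add]
    have h3 : f (if lam ∈ s then v lam else 0) = if lam ∈ s then f (v lam) else 0 := by
      split_ifs <;> simp
    have h4 : (if lam ∈ s then f (v lam) else 0) ∈ weightSpace 𝔥 N lam := by
      split_ifs
      exacts [h1 lam, Submodule.zero_mem _]
    rw [h3, h2, left_eq_add]
    refine mem_bot_of_weightSpace_inf ?_ (Submodule.sum_mem _ fun μ hμ => ?_) (μ := lam)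
    · rw [h2] at hn
      exact (Submodule.add_mem_iff_right _ h4).mp hn
    · exact Submodule.mem_iSup_of_mem μ
        (Submodule.mem_iSup_of_mem (Finset.ne_of_mem_erase hμ) (h1 μ))

end WeightSpaces

/-! ### Closure properties of the category O and its restricted part -/

section CatO

variable {𝔤 : Type u} [LieRing 𝔤] [LieAlgebra ℂ 𝔤] {𝔥 𝔟 : LieSubalgebra ℂ 𝔤}
  {A : Type u} [CommRing A] [Algebra ℂ A] [Algebra (SymmetricAlgebra ℂ 𝔥) A]

/-- Noetherianity keeps the intersection of a submodule with a finitely generated 𝔟̂-stable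
A-submodule finitely generated. -/
lemma catO_of_injective [IsNoetherianRing A] {M N : GMod 𝔤 A} (f : M →ₗ[Env 𝔤 A] N)
    (hf : Function.Injective f) (hN : catO A 𝔥 𝔟 N) : catO A 𝔥 𝔟 M := by
  refine ⟨?_, fun m => ?_⟩
  · rw [isWeightModule_iff, eq_top_iff]
    intro m _
    obtain ⟨s, v, hv, h⟩ := hN.1.exists_sum (f m)
    have h1 := mem_of_sum_mem ((LinearMap.range f).restrictScalars A)
      (fun H x hx => Submodule.smul_mem (LinearMap.range f) _ hx) s v (fun lam _ => hv lam)
      (by rw [← h]; exact ⟨m, rfl⟩)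
    choose! u hu using h1
    have h2 : m = ∑ lam ∈ s, u lam := by
      apply hf
      rw [map_sum, h]
      exact Finset.sum_congr rfl fun i hi => (hu i hi).symm
    rw [h2]
    refine Submodule.sum_mem _ fun lam hl => Submodule.mem_iSup_of_mem lam ?_
    exact mem_weightSpace_of_map hf (by rw [hu lam hl]; exact hv lam)
  · obtain ⟨B, h1, h2, h3⟩ := hN.2 (f m)
    let g : M →ₗ[A] N := f.restrictScalars A
    refine ⟨B.comap g, h1, ?_, fun x hx v hv => ?_⟩
    · have : IsNoetherian A B := isNoetherian_of_fg_of_noetherian B h2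
      refine Submodule.fg_of_fg_map_injective g hf ?_
      exact isNoetherian_submodule.mp this _ (Submodule.map_comap_le g B)
    · change f (_ • v) ∈ B
      rw [map_smul]
      exact h3 x hx _ hv

lemma catO_of_surjective {M N : GMod 𝔤 A} (f : M →ₗ[Env 𝔤 A] N)
    (hf : Function.Surjective f) (hM : catO A 𝔥 𝔟 M) : catO A 𝔥 𝔟 N := by
  refine ⟨?_, fun n => ?_⟩
  · refine isWeightModule_of_span (⋃ lam : Wt 𝔥, f '' weightSpace 𝔥 M lam) ?_ ?_
    · intro s hs
      obtain ⟨lam, v, hv, rfl⟩ := Set.mem_iUnion.mp hs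
      exact ⟨lam, map_mem_weightSpace f hv⟩
    · rw [eq_top_iff]
      intro n _
      obtain ⟨m, rfl⟩ := hf n
      obtain ⟨s, v, hv, rfl⟩ := hM.1.exists_sum m
      rw [map_sum]
      exact Submodule.sum_mem _ fun lam _ =>
        Submodule.subset_span (Set.mem_iUnion.mpr ⟨lam, _, hv lam, rfl⟩)
  · obtain ⟨m, rfl⟩ := hf n
    obtain ⟨B, h1, h2, h3⟩ := hM.2 m
    refine ⟨B.map (f.restrictScalars A), ⟨m, h1, rfl⟩, h2.map _, ?_⟩
    rintro x hx _ ⟨v, hv, rfl⟩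
    exact ⟨_, h3 x hx v hv, f.map_smul _ _⟩

variable [LieRing.IsNilpotent 𝔥]

lemma component_map {n : ℤ} (τ : 𝟭 (catO A 𝔥 𝔟).FullSubcategory ⟶ shiftO A 𝔥 𝔟 n)
    {M N : GMod 𝔤 A} (hM : catO A 𝔥 𝔟 M) (hN : catO A 𝔥 𝔟 N) (f : M →ₗ[Env 𝔤 A] N) (v : M) :
    component τ ⟨N, hN⟩ (f v) = f (component τ ⟨M, hM⟩ v) := by
  let F : (⟨M, hM⟩ : (catO A 𝔥 𝔟).FullSubcategory) ⟶ ⟨N, hN⟩ :=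
    ObjectProperty.homMk (ModuleCat.ofHom f)
  have h := congrArg (fun g => g.hom.hom v) (τ.naturality F)
  exact h

/-- Read on the elements of M, a map to the shift commutes with the loop part and with K, but not
with D. It lowers weights by nδ. -/
lemma component_act {n : ℤ} (τ : 𝟭 (catO A 𝔥 𝔟).FullSubcategory ⟶ shiftO A 𝔥 𝔟 n)
    {M : GMod 𝔤 A} (hM : catO A 𝔥 𝔟 M) (x : Affine 𝔤) (v : M) :
    component τ ⟨M, hM⟩ (act A x • v) = act A x • component τ ⟨M, hM⟩ v +
      algebraMap ℂ A (n * x.deriv) • component τ ⟨M, hM⟩ v := by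
  let f : M ⟶ (shiftMod 𝔤 A n).obj M := (τ.app ⟨M, hM⟩).hom
  have h := f.hom.map_smul (act A x) v
  have h2 := act_toShift n M x ((toShift n M).symm (f.hom v))
  rw [LinearEquiv.apply_symm_apply, ← h, ← LinearEquiv.symm_apply_eq] at h2
  exact h2

lemma component_smul_eq_zero {n : ℤ} (τ : 𝟭 (catO A 𝔥 𝔟).FullSubcategory ⟶ shiftO A 𝔥 𝔟 n)
    {M : GMod 𝔤 A} (hM : catO A 𝔥 𝔟 M) (e : Env 𝔤 A) {v : M}
    (h : component τ ⟨M, hM⟩ v = 0) : component τ ⟨M, hM⟩ (e • v) = 0 := by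
  let f : M ⟶ (shiftMod 𝔤 A n).obj M := (τ.app ⟨M, hM⟩).hom
  have h1 : f.hom v = 0 := h
  have h2 : f.hom (e • v) = 0 := by rw [map_smul, h1, smul_zero]
  exact h2

lemma resO_iff {M : GMod 𝔤 A} : resO A 𝔥 𝔟 M ↔ ∃ h : catO A 𝔥 𝔟 M, ∀ n : ℤ, n ≠ 0 →
    ∀ τ ∈ gradedCenter A 𝔥 𝔟 n, ∀ v : M, component τ ⟨M, h⟩ v = 0 := by
  refine exists_congr fun h => forall_congr' fun n => forall_congr' fun _ => forall_congr' fun τ =>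
    forall_congr' fun _ => ⟨fun h1 v => ?_, fun h1 => ?_⟩
  · rw [component, h1]
    rfl
  · apply ObjectProperty.hom_ext
    apply ModuleCat.hom_ext
    apply LinearMap.ext
    intro v
    exact h1 v

/-- A module in the category `O` is restricted if restricted modules separate its points. -/
lemma resO_of_separating {M : GMod 𝔤 A} (hM : catO A 𝔥 𝔟 M)
    (h : ∀ m : M, m ≠ 0 → ∃ (N : GMod 𝔤 A) (f : M →ₗ[Env 𝔤 A] N), resO A 𝔥 𝔟 N ∧ f m ≠ 0) :
    resO A 𝔥 𝔟 M := by
  refine resO_iff.mpr ⟨hM, fun n hn τ hτ v => ?_⟩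
  by_contra h0
  obtain ⟨N, f, hN, hf⟩ := h _ h0
  obtain ⟨hN', h1⟩ := resO_iff.mp hN
  rw [← component_map τ hM hN', h1 n hn τ hτ] at hf
  exact hf rfl

lemma resO_of_injective [IsNoetherianRing A] {M N : GMod 𝔤 A} (f : M →ₗ[Env 𝔤 A] N)
    (hf : Function.Injective f) (hN : resO A 𝔥 𝔟 N) : resO A 𝔥 𝔟 M :=
  resO_of_separating (catO_of_injective f hf hN.1) fun _ hm =>
    ⟨N, f, hN, (map_ne_zero_iff f hf).mpr hm⟩

lemma resO_of_surjective {M N : GMod 𝔤 A} (f : M →ₗ[Env 𝔤 A] N)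
    (hf : Function.Surjective f) (hM : resO A 𝔥 𝔟 M) : resO A 𝔥 𝔟 N := by
  obtain ⟨hM', h1⟩ := resO_iff.mp hM
  refine resO_iff.mpr ⟨catO_of_surjective f hf hM', fun n hn τ hτ v => ?_⟩
  obtain ⟨m, rfl⟩ := hf v
  rw [component_map τ hM', h1 n hn τ hτ, map_zero]

lemma resOTrunc_of_injective [IsNoetherianRing A] {J : Set (Wt 𝔥)} {M N : GMod 𝔤 A}
    (f : M →ₗ[Env 𝔤 A] N) (hf : Function.Injective f) (hN : resOTrunc A 𝔥 𝔟 J N) :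
    resOTrunc A 𝔥 𝔟 J M := by
  refine ⟨resO_of_injective f hf hN.1, fun lam h => hN.2 lam ?_⟩
  obtain ⟨m, hm, h0⟩ := (Submodule.ne_bot_iff _).mp h
  exact (Submodule.ne_bot_iff _).mpr
    ⟨f m, map_mem_weightSpace f hm, (map_ne_zero_iff f hf).mpr h0⟩

lemma resOTrunc_of_surjective {J : Set (Wt 𝔥)} {M N : GMod 𝔤 A}
    (f : M →ₗ[Env 𝔤 A] N) (hf : Function.Surjective f) (hM : resOTrunc A 𝔥 𝔟 J M) :
    resOTrunc A 𝔥 𝔟 J N := by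
  refine ⟨resO_of_surjective f hf hM.1, fun lam h => hM.2 lam ?_⟩
  obtain ⟨n, hn, h0⟩ := (Submodule.ne_bot_iff _).mp h
  obtain ⟨m, hm, rfl⟩ := exists_mem_weightSpace_of_surjective hM.1.1.1 f hf hn
  exact (Submodule.ne_bot_iff _).mpr ⟨m, hm, fun h => h0 (by rw [h, map_zero])⟩

end CatO

end AffineO

end

/-! ### The order on weights and finiteness of words -/

noncomputable section

namespace AffineO

section Order

variable {𝔤 : Type u} [LieRing 𝔤] [LieAlgebra ℂ 𝔤] {𝔥 𝔟 : LieSubalgebra ℂ 𝔤}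
  [LieRing.IsNilpotent 𝔥]

lemma WtLE.refl (μ : Wt 𝔥) : WtLE 𝔥 𝔟 μ μ := by
  rw [WtLE, sub_self]
  exact AddSubmonoid.zero_mem _

lemma WtLE.trans {lam μ ν : Wt 𝔥} (h : WtLE 𝔥 𝔟 lam μ) (h' : WtLE 𝔥 𝔟 μ ν) :
    WtLE 𝔥 𝔟 lam ν := by
  have := AddSubmonoid.add_mem _ h' h
  rwa [sub_add_sub_cancel] at this

namespace Grading

variable (G : Grading 𝔥 𝔟)

/-- The height of a weight: the real part of its value at the element defining the grading. -/
def ht : Wt 𝔥 →+ ℝ where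
  toFun lam := (lam G.elt).re
  map_zero' := by simp
  map_add' x y := by simp

lemma ht_wt (i : G.ι) : G.ht (G.wt i) = G.deg i := by
  change (G.wt i G.elt).re = _
  rw [G.wt_elt]
  simp

lemma exists_ht_eq {β : Wt 𝔥} (hβ : β ∈ AddSubmonoid.closure (posAffineRoots 𝔥 𝔟)) :
    ∃ n : ℕ, β G.elt = n ∧ (n = 0 → β = 0) := by
  induction hβ using AddSubmonoid.closure_induction with
  | mem x hx =>
    obtain ⟨n, h1, h2⟩ := G.height_pos x hx
    exact ⟨n, h2, fun h => absurd h h1.ne'⟩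
  | zero => exact ⟨0, by simp, fun _ => rfl⟩
  | add x y hx hy h h' =>
    obtain ⟨n, h1, h2⟩ := h
    obtain ⟨m, h3, h4⟩ := h'
    refine ⟨n + m, by rw [LinearMap.add_apply, h1, h3, Nat.cast_add], fun h0 => ?_⟩
    rw [h2 (by omega), h4 (by omega), add_zero]

lemma ht_nonneg {β : Wt 𝔥} (hβ : β ∈ AddSubmonoid.closure (posAffineRoots 𝔥 𝔟)) :
    0 ≤ G.ht β := by
  obtain ⟨n, h1, -⟩ := G.exists_ht_eq hβ
  change 0 ≤ (β G.elt).re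
  rw [h1]
  simp

lemma eq_zero_of_ht {β : Wt 𝔥} (hβ : β ∈ AddSubmonoid.closure (posAffineRoots 𝔥 𝔟))
    (h : G.ht β = 0) : β = 0 := by
  obtain ⟨n, h1, h2⟩ := G.exists_ht_eq hβ
  change (β G.elt).re = 0 at h
  rw [h1] at h
  exact h2 (by simpa using h)

include G in
lemma antisymm {lam μ : Wt 𝔥} (h : WtLE 𝔥 𝔟 lam μ) (h' : WtLE 𝔥 𝔟 μ lam) : lam = μ := by
  have h1 := G.ht_nonneg h
  have h2 := G.ht_nonneg h'
  rw [map_sub] at h1 h2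
  exact (sub_eq_zero.mp (G.eq_zero_of_ht h (by rw [map_sub]; linarith))).symm

/-- A nonzero sum of positive affine roots splits off one root, of positive height; the rest has
smaller height, and there are finitely many roots of each height. -/
lemma finite_closure (n : ℕ) :
    {β ∈ AddSubmonoid.closure (posAffineRoots 𝔥 𝔟) | β G.elt = n}.Finite := by
  have hF : ∀ k : ℕ, {γ ∈ posAffineRoots 𝔥 𝔟 | γ G.elt = k}.Finite := G.finite_height
  induction n using Nat.strong_induction_on with
  | _ n ih =>
    refine (Set.Finite.union (Set.finite_singleton (0 : Wt 𝔥))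
      (Set.Finite.biUnion (Set.finite_le_nat n) fun k _ => Set.Finite.image2 (· + ·) (hF (k + 1))
        (Set.Finite.biUnion (Set.finite_lt_nat n) fun m (hm : m < n) => ih m hm))).subset ?_
    rintro β ⟨hβ, hn⟩
    have key : β = 0 ∨ ∃ γ ∈ posAffineRoots 𝔥 𝔟,
        ∃ β' ∈ AddSubmonoid.closure (posAffineRoots 𝔥 𝔟), β = γ + β' := by
      clear hn
      induction hβ using AddSubmonoid.closure_induction_left with
      | zero => exact Or.inl rfl
      | add_left x hx y hy h => exact Or.inr ⟨x, hx, y, hy, rfl⟩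
    rcases key with rfl | ⟨γ, hγ, β', hβ', rfl⟩
    · exact Or.inl rfl
    · right
      obtain ⟨k, hk, hk'⟩ := G.height_pos γ hγ
      obtain ⟨m, hm, -⟩ := G.exists_ht_eq hβ'
      rw [LinearMap.add_apply, hk', hm] at hn
      have h1 : k + m = n := by exact_mod_cast hn
      refine Set.mem_biUnion (show k - 1 ≤ n by omega) ⟨γ, ⟨hγ, ?_⟩, β',
        Set.mem_biUnion (show m < n by omega) ⟨hβ', hm⟩, rfl⟩
      rw [hk', Nat.sub_add_cancel hk]

include G in
-- The height of γ - μ is a natural number not above the height of lam - μ.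
lemma finite_interval (lam μ : Wt 𝔥) : {γ | WtLE 𝔥 𝔟 μ γ ∧ WtLE 𝔥 𝔟 γ lam}.Finite := by
  obtain ⟨n, hn⟩ := exists_nat_gt (G.ht (lam - μ))
  refine ((Set.Finite.biUnion (Set.finite_lt_nat n) fun k _ =>
    G.finite_closure k).image (μ + ·)).subset ?_
  rintro γ ⟨h1, h2⟩
  obtain ⟨k, hk, -⟩ := G.exists_ht_eq h1
  refine ⟨γ - μ, Set.mem_biUnion (show k < n from ?_) ⟨h1, hk⟩, by simp⟩
  have h3 := G.ht_nonneg h2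
  have h4 : G.ht (γ - μ) = k := by
    change ((γ - μ) G.elt).re = k
    rw [hk]
    simp
  have h5 : G.ht (lam - μ) = G.ht (lam - γ) + G.ht (γ - μ) := by
    rw [← map_add]; congr 1; abel
  have h6 : (k : ℝ) < n := by linarith
  exact_mod_cast h6

/-- The set of all weights below a weight in a finite set is open. -/
lemma isOpenWt_below (S : Set (Wt 𝔥)) : IsOpenWt 𝔥 𝔟 {μ | ∃ lam ∈ S, WtLE 𝔥 𝔟 μ lam} :=
  fun _ ⟨lam, hl, h⟩ _ hμ => ⟨lam, hl, hμ.trans h⟩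

include G in
lemma isLocallyBoundedWt_below {S : Set (Wt 𝔥)} (hS : S.Finite) :
    IsLocallyBoundedWt 𝔥 𝔟 {μ | ∃ lam ∈ S, WtLE 𝔥 𝔟 μ lam} := fun μ =>
  (hS.biUnion fun lam _ => G.finite_interval lam μ).subset fun _ ⟨⟨_, hl, h⟩, h'⟩ =>
    Set.mem_biUnion hl ⟨h', h⟩

/-! ### Words in the homogeneous elements -/

/-- The weight of a word. -/
def wtW (w : List G.ι) : Wt 𝔥 := (w.map G.wt).sum

@[simp] lemma wtW_nil : G.wtW [] = 0 := rfl

@[simp] lemma wtW_cons (i : G.ι) (w : List G.ι) : G.wtW (i :: w) = G.wt i + G.wtW w := by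
  simp [wtW]

lemma neg_wtW_mem {w : List G.ι} (hw : ∀ i ∈ w, G.deg i < 0) :
    -G.wtW w ∈ AddSubmonoid.closure (posAffineRoots 𝔥 𝔟) := by
  induction w with
  | nil => rw [wtW_nil, neg_zero]; exact AddSubmonoid.zero_mem _
  | cons i w ih =>
    rw [wtW_cons, neg_add]
    exact AddSubmonoid.add_mem _
      (AddSubmonoid.subset_closure (G.wt_neg i (hw i List.mem_cons_self)))
      (ih fun j hj => hw j (List.mem_cons_of_mem _ hj))

lemma wtW_mem {w : List G.ι} (hw : ∀ i ∈ w, 0 < G.deg i) :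
    G.wtW w ∈ AddSubmonoid.closure (posAffineRoots 𝔥 𝔟) := by
  induction w with
  | nil => rw [wtW_nil]; exact AddSubmonoid.zero_mem _
  | cons i w ih =>
    rw [wtW_cons]
    exact AddSubmonoid.add_mem _
      (AddSubmonoid.subset_closure (G.wt_pos i (hw i List.mem_cons_self)))
      (ih fun j hj => hw j (List.mem_cons_of_mem _ hj))

lemma length_le_of_neg {w : List G.ι} (hw : ∀ i ∈ w, G.deg i < 0) :
    (w.length : ℝ) ≤ -G.ht (G.wtW w) ∧ ∀ i ∈ w, (-G.deg i : ℝ) ≤ -G.ht (G.wtW w) := by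
  induction w with
  | nil => simp
  | cons i w ih =>
    obtain ⟨h1, h2⟩ := ih fun j hj => hw j (List.mem_cons_of_mem _ hj)
    have h3 : (G.deg i : ℝ) ≤ -1 := by
      have := hw i List.mem_cons_self
      exact_mod_cast (by omega : G.deg i ≤ -1)
    have h4 : (0 : ℝ) ≤ w.length := Nat.cast_nonneg _
    rw [wtW_cons, map_add, ht_wt]
    refine ⟨by rw [List.length_cons, Nat.cast_succ]; linarith, fun j hj => ?_⟩
    rcases List.mem_cons.mp hj with rfl | hj
    · linarith
    · linarith [h2 j hj]

lemma length_le_of_pos {w : List G.ι} (hw : ∀ i ∈ w, 0 < G.deg i) :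
    (w.length : ℝ) ≤ G.ht (G.wtW w) ∧ ∀ i ∈ w, (G.deg i : ℝ) ≤ G.ht (G.wtW w) := by
  induction w with
  | nil => simp
  | cons i w ih =>
    obtain ⟨h1, h2⟩ := ih fun j hj => hw j (List.mem_cons_of_mem _ hj)
    have h3 : (1 : ℝ) ≤ G.deg i := by
      have := hw i List.mem_cons_self
      exact_mod_cast (by omega : 1 ≤ G.deg i)
    have h4 : (0 : ℝ) ≤ w.length := Nat.cast_nonneg _
    rw [wtW_cons, map_add, ht_wt]
    refine ⟨by rw [List.length_cons, Nat.cast_succ]; linarith, fun j hj => ?_⟩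
    rcases List.mem_cons.mp hj with rfl | hj
    · linarith
    · linarith [h2 j hj]

lemma _root_.List.finite_length_le_of_mem {α : Type*} {S : Set α} (hS : S.Finite) (n : ℕ) :
    {w : List α | w.length ≤ n ∧ ∀ i ∈ w, i ∈ S}.Finite := by
  induction n with
  | zero =>
    refine (Set.finite_singleton []).subset ?_
    rintro w ⟨h, -⟩
    exact List.length_eq_zero_iff.mp (Nat.le_zero.mp h)
  | succ n ih =>
    refine ((Set.finite_singleton []).union (Set.Finite.image2 List.cons hS ih)).subset ?_
    rintro (_ | ⟨i, w⟩) ⟨h, h'⟩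
    · exact Or.inl rfl
    · exact Or.inr ⟨i, h' i List.mem_cons_self, w,
        ⟨Nat.le_of_succ_le_succ h, fun j hj => h' j (List.mem_cons_of_mem _ hj)⟩, rfl⟩

lemma finite_abs_deg (n : ℕ) : {i | |G.deg i| ≤ n}.Finite := by
  refine (Set.Finite.biUnion (Set.finite_Icc (-(n : ℤ)) n) fun m _ => G.finite_deg m).subset ?_
  intro i hi
  exact Set.mem_biUnion (Set.mem_Icc.mpr (abs_le.mp hi)) rfl

/-- Each letter has degree at most -1, so the height bounds both the length of the word and the
degrees of its letters. -/
lemma finite_neg_words (c : ℝ) :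
    {w : List G.ι | (∀ i ∈ w, G.deg i < 0) ∧ c ≤ G.ht (G.wtW w)}.Finite := by
  obtain ⟨n, hn⟩ := exists_nat_gt (-c)
  refine (List.finite_length_le_of_mem (G.finite_abs_deg n) n).subset ?_
  rintro w ⟨h1, h2⟩
  obtain ⟨h3, h4⟩ := G.length_le_of_neg h1
  refine ⟨by exact_mod_cast (by linarith : (w.length : ℝ) ≤ n), fun i hi => ?_⟩
  change |G.deg i| ≤ n
  rw [abs_of_neg (h1 i hi)]
  have h5 : (-G.deg i : ℝ) ≤ n := by linarith [h4 i hi]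
  exact_mod_cast h5

lemma finite_pos_words (c : ℝ) :
    {w : List G.ι | (∀ i ∈ w, 0 < G.deg i) ∧ G.ht (G.wtW w) ≤ c}.Finite := by
  obtain ⟨n, hn⟩ := exists_nat_gt c
  refine (List.finite_length_le_of_mem (G.finite_abs_deg n) n).subset ?_
  rintro w ⟨h1, h2⟩
  obtain ⟨h3, h4⟩ := G.length_le_of_pos h1
  refine ⟨by exact_mod_cast (by linarith : (w.length : ℝ) ≤ n), fun i hi => ?_⟩
  change |G.deg i| ≤ n
  rw [abs_of_pos (h1 i hi)]
  have h5 : (G.deg i : ℝ) ≤ n := by linarith [h4 i hi]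
  exact_mod_cast h5

end Grading

end Order

/-! ### Straightening words and modules generated by 𝔟̂-stable families -/

section Words

variable {𝔤 : Type u} [LieRing 𝔤] [LieAlgebra ℂ 𝔤] {𝔥 𝔟 : LieSubalgebra ℂ 𝔤}
  [LieRing.IsNilpotent 𝔥] {A : Type u} [CommRing A] [Algebra ℂ A]
  [Algebra (SymmetricAlgebra ℂ 𝔥) A] (G : Grading 𝔥 𝔟)

namespace Grading

variable (A) in
/-- The product of the elements in a word. -/
def word (w : List G.ι) : Env 𝔤 A := (w.map fun i => act A (G.vec i)).prod

@[simp] lemma word_nil : G.word A [] = 1 := rfl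

@[simp] lemma word_cons (i : G.ι) (w : List G.ι) :
    G.word A (i :: w) = act A (G.vec i) * G.word A w := by
  simp [word]

lemma act_mem_weightSpace {M : GMod 𝔤 A} (i : G.ι) {lam : Wt 𝔥} {m : M}
    (hm : m ∈ weightSpace 𝔥 M lam) : act A (G.vec i) • m ∈ weightSpace 𝔥 M (G.wt i + lam) := by
  intro H
  have h1 := act_lie (A := A) (cartanIncl 𝔥 H) (G.vec i)
  rw [G.lie_vec, act_smul, eq_sub_iff_add_eq] at h1
  rw [smul_smul, ← h1, add_smul, mul_smul, hm H, act_smul_smul, smul_assoc, ← add_smul,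
    LinearMap.add_apply, map_add, add_assoc]

lemma word_mem_weightSpace {M : GMod 𝔤 A} (w : List G.ι) {lam : Wt 𝔥} {m : M}
    (hm : m ∈ weightSpace 𝔥 M lam) : G.word A w • m ∈ weightSpace 𝔥 M (G.wtW w + lam) := by
  induction w with
  | nil => simpa using hm
  | cons i w ih =>
    rw [word_cons, mul_smul, wtW_cons, add_assoc]
    exact G.act_mem_weightSpace i ih

/-- Stability under `𝔟̂` is stability under the elements of nonnegative degree. -/
lemma borel_smul_mem {M : GMod 𝔤 A} (N : Submodule A M) {v : M}
    (h : ∀ i, 0 ≤ G.deg i → act A (G.vec i) • v ∈ N) {x : Affine 𝔤} (hx : x ∈ borelHat 𝔟) :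
    act A x • v ∈ N := by
  have hx' := G.borel_le x hx
  clear hx
  induction hx' using Submodule.span_induction with
  | mem x hx => obtain ⟨i, hi, rfl⟩ := hx; exact h i hi
  | zero => rw [act_zero, zero_smul]; exact N.zero_mem
  | add x y _ _ hx hy => rw [act_add, add_smul]; exact N.add_mem hx hy
  | smul a x _ hx => rw [act_smul, smul_assoc]; exact N.smul_mem _ hx

lemma act_smul_mem {M : GMod 𝔤 A} (N : Submodule A M) {v : M}
    (h : ∀ i, act A (G.vec i) • v ∈ N) (x : Affine 𝔤) : act A x • v ∈ N := by
  have hx : x ∈ Submodule.span ℂ (Set.range G.vec) := by rw [G.span_eq_top]; trivial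
  induction hx using Submodule.span_induction with
  | mem x hx => obtain ⟨i, rfl⟩ := hx; exact h i
  | zero => rw [act_zero, zero_smul]; exact N.zero_mem
  | add x y _ _ hx hy => rw [act_add, add_smul]; exact N.add_mem hx hy
  | smul a x _ hx => rw [act_smul, smul_assoc]; exact N.smul_mem _ hx

lemma act_zero_smul {M : GMod 𝔤 A} {i : G.ι} (hi : G.deg i = 0) {lam : Wt 𝔥} {v : M}
    (hv : v ∈ weightSpace 𝔥 M lam) : ∃ a : A, act A (G.vec i) • v = a • v := by
  obtain ⟨H, hH⟩ := G.of_deg_zero i hi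
  rw [← hH]
  exact ⟨_, hv H⟩

/-- Words of negative degree, applied to a family of vectors. -/
def negWord {M : GMod 𝔤 A} {κ : Type*} (s : κ → M) (p : List G.ι × κ) : M := G.word A p.1 • s p.2

/-- A family whose span is stable under `𝔟̂` generates the span of its translates by words of
negative degree. -/
lemma span_le_negWord {M : GMod 𝔤 A} {κ : Type*} (s : κ → M)
    (hs : ∀ k, ∀ x ∈ borelHat 𝔟, act A x • s k ∈ Submodule.span A (Set.range s))
    {m : M} (hm : m ∈ Submodule.span (Env 𝔤 A) (Set.range s)) :
    m ∈ Submodule.span A (G.negWord s '' {p | ∀ i ∈ p.1, G.deg i < 0}) := by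
  set N := Submodule.span A (G.negWord s '' {p | ∀ i ∈ p.1, G.deg i < 0}) with hN
  have h0 : Submodule.span A (Set.range s) ≤ N := by
    rw [Submodule.span_le]
    rintro _ ⟨k, rfl⟩
    exact Submodule.subset_span ⟨([], k), by simp, by simp [negWord]⟩
  have h1 (i : G.ι) (hi : G.deg i < 0) (v : M) (hv : v ∈ N) : act A (G.vec i) • v ∈ N := by
    induction hv using Submodule.span_induction with
    | mem v hv =>
      obtain ⟨⟨w, k⟩, hw, rfl⟩ := hv
      refine Submodule.subset_span ⟨(i :: w, k), ?_, by simp [negWord, mul_smul]⟩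
      intro j hj
      rcases List.mem_cons.mp hj with rfl | hj
      exacts [hi, hw j hj]
    | zero => rw [smul_zero]; exact N.zero_mem
    | add x y _ _ hx hy => rw [smul_add]; exact N.add_mem hx hy
    | smul a x _ hx => rw [act_smul_smul]; exact N.smul_mem _ hx
  -- Straightening: `x` is moved past the first letter at the price of a bracket acting on a shorter
  -- word. The induction runs over all `x` at once because the bracket is a new element.
  have h2 (k : κ) (w : List G.ι) (hw : ∀ i ∈ w, G.deg i < 0) (x : Affine 𝔤) :
      act A x • G.word A w • s k ∈ N := by
    induction w generalizing x with
    | nil =>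
      rw [word_nil, one_smul]
      refine G.act_smul_mem N (fun i => ?_) x
      rcases lt_or_ge (G.deg i) 0 with hi | hi
      · refine Submodule.subset_span ⟨([i], k), ?_, by simp [negWord]⟩
        intro j hj
        rwa [List.mem_singleton.mp hj]
      · exact h0 (hs k _ (G.mem_borel i hi))
    | cons i w ih =>
      have hw' : ∀ j ∈ w, G.deg j < 0 := fun j hj => hw j (List.mem_cons_of_mem _ hj)
      have h3 : act A x * act A (G.vec i) = act A (G.vec i) * act A x + act A ⁅x, G.vec i⁆ := by
        rw [act_lie]; abel
      rw [word_cons, mul_smul, ← mul_smul, h3, add_smul, mul_smul]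
      exact N.add_mem (h1 i (hw i List.mem_cons_self) _ (ih hw' x)) (ih hw' _)
  have h3 (x : Affine 𝔤) (v : M) (hv : v ∈ N) : act A x • v ∈ N := by
    induction hv using Submodule.span_induction with
    | mem v hv =>
      obtain ⟨⟨w, k⟩, hw, rfl⟩ := hv
      exact h2 k w hw x
    | zero => rw [smul_zero]; exact N.zero_mem
    | add x y _ _ hx hy => rw [smul_add]; exact N.add_mem hx hy
    | smul a x _ hx => rw [act_smul_smul]; exact N.smul_mem _ hx
  induction hm using Submodule.span_induction with
  | mem v hv => exact h0 (Submodule.subset_span hv)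
  | zero => exact N.zero_mem
  | add x y _ _ hx hy => exact N.add_mem hx hy
  | smul e x _ hx => exact smul_mem_of_act N h3 e hx

section Finite

variable {M : GMod 𝔤 A} {κ : Type*} (s : κ → M) (wt : κ → Wt 𝔥)
  (hs : ∀ k, ∀ x ∈ borelHat 𝔟, act A x • s k ∈ Submodule.span A (Set.range s))
  (hwt : ∀ k, s k ∈ weightSpace 𝔥 M (wt k))

include hwt in
lemma negWord_mem_weightSpace (p : List G.ι × κ) :
    G.negWord s p ∈ weightSpace 𝔥 M (G.wtW p.1 + wt p.2) :=
  G.word_mem_weightSpace _ (hwt _)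

include hs hwt G in
lemma mem_span_negWord_of_weight {μ : Wt 𝔥} {m : M}
    (hm : m ∈ Submodule.span (Env 𝔤 A) (Set.range s)) (hμ : m ∈ weightSpace 𝔥 M μ) :
    m ∈ Submodule.span A
      (G.negWord s '' {p | (∀ i ∈ p.1, G.deg i < 0) ∧ G.wtW p.1 + wt p.2 = μ}) :=
  mem_span_of_weight (G.negWord s) (fun p => G.wtW p.1 + wt p.2)
    (G.negWord_mem_weightSpace s wt hwt) _ (G.span_le_negWord s hs hm) hμ

include hs hwt G in
/-- The weights of the submodule generated by a `𝔟̂`-stable family are below the weights of the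
family. -/
lemma exists_wtLE {μ : Wt 𝔥} {m : M} (hm : m ∈ Submodule.span (Env 𝔤 A) (Set.range s))
    (hμ : m ∈ weightSpace 𝔥 M μ) (h0 : m ≠ 0) : ∃ k, WtLE 𝔥 𝔟 μ (wt k) := by
  by_contra! h
  have h1 := G.mem_span_negWord_of_weight s wt hs hwt hm hμ
  rw [show {p : List G.ι × κ | (∀ i ∈ p.1, G.deg i < 0) ∧ G.wtW p.1 + wt p.2 = μ} = ∅ from ?_,
    Set.image_empty, Submodule.span_empty] at h1
  · exact h0 ((Submodule.mem_bot A).mp h1)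
  · rw [Set.eq_empty_iff_forall_notMem]
    rintro ⟨w, k⟩ ⟨hw, rfl⟩
    refine h k ?_
    rw [WtLE]
    convert G.neg_wtW_mem hw using 1
    abel

lemma finite_words_ht [Finite κ] (r : ℝ) : {p : List G.ι × κ | (∀ i ∈ p.1, G.deg i < 0) ∧
    r ≤ G.ht (G.wtW p.1 + wt p.2)}.Finite := by
  refine (Set.Finite.biUnion (Set.finite_univ (α := κ)) fun k _ =>
    ((G.finite_neg_words (r - G.ht (wt k))).prod (Set.finite_singleton k))).subset ?_
  rintro ⟨w, k⟩ ⟨h1, h2⟩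
  refine Set.mem_biUnion (Set.mem_univ k) ⟨⟨h1, ?_⟩, rfl⟩
  rw [map_add] at h2
  linarith

include hs hwt G in
/-- A module generated by a finite family of weight vectors whose span is stable under `𝔟̂` is in
the category `O`. -/
lemma catO_of_span_eq_top [Finite κ]
    (htop : Submodule.span (Env 𝔤 A) (Set.range s) = ⊤) : catO A 𝔥 𝔟 M := by
  have hall (m : M) : m ∈ Submodule.span A (G.negWord s '' {p | ∀ i ∈ p.1, G.deg i < 0}) :=
    G.span_le_negWord s hs (by rw [htop]; trivial)
  refine ⟨isWeightModule_of_span _ ?_ (eq_top_iff.mpr fun m _ => hall m), ?_⟩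
  · rintro _ ⟨p, -, rfl⟩
    exact ⟨_, G.negWord_mem_weightSpace s wt hwt p⟩
  -- The translates of weight height at least `r` are finite in number, and elements of nonnegative
  -- degree do not lower the height; so they span finitely generated 𝔟̂-stable submodules.
  · let T (r : ℝ) : Set (List G.ι × κ) :=
      {p | (∀ i ∈ p.1, G.deg i < 0) ∧ r ≤ G.ht (G.wtW p.1 + wt p.2)}
    have hmono {r r' : ℝ} (h : r ≤ r') :
        Submodule.span A (G.negWord s '' T r') ≤ Submodule.span A (G.negWord s '' T r) :=
      Submodule.span_mono (Set.image_mono fun p hp => ⟨hp.1, h.trans hp.2⟩)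
    have hex (m : M) : ∃ r : ℝ, m ∈ Submodule.span A (G.negWord s '' T r) := by
      induction hall m using Submodule.span_induction with
      | mem m hm =>
        obtain ⟨p, hp, rfl⟩ := hm
        exact ⟨_, Submodule.subset_span ⟨p, ⟨hp, le_refl _⟩, rfl⟩⟩
      | zero => exact ⟨0, Submodule.zero_mem _⟩
      | add x y _ _ hx hy =>
        obtain ⟨r, hr⟩ := hx
        obtain ⟨r', hr'⟩ := hy
        exact ⟨min r r', Submodule.add_mem _ (hmono (min_le_left _ _) hr)
          (hmono (min_le_right _ _) hr')⟩
      | smul a x _ hx =>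
        obtain ⟨r, hr⟩ := hx
        exact ⟨r, Submodule.smul_mem _ _ hr⟩
    intro m
    obtain ⟨r, hr⟩ := hex m
    refine ⟨_, hr, Submodule.fg_span ((G.finite_words_ht wt r).image _), ?_⟩
    intro x hx v hv
    refine G.borel_smul_mem _ (fun i hi => ?_) hx
    induction hv using Submodule.span_induction with
    | mem v hv =>
      obtain ⟨p, hp, rfl⟩ := hv
      have h1 := G.act_mem_weightSpace i (G.negWord_mem_weightSpace s wt hwt p)
      have h2 := G.mem_span_negWord_of_weight s wt hs hwt (by rw [htop]; trivial) h1
      refine Submodule.span_mono (Set.image_mono ?_) h2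
      rintro q ⟨hq, hq'⟩
      refine ⟨hq, ?_⟩
      rw [hq', map_add, ht_wt]
      have : (0 : ℝ) ≤ G.deg i := by exact_mod_cast hi
      linarith [hp.2]
    | zero => rw [smul_zero]; exact Submodule.zero_mem _
    | add x y _ _ hx hy => rw [smul_add]; exact Submodule.add_mem _ hx hy
    | smul a x _ hx => rw [act_smul_smul]; exact Submodule.smul_mem _ _ hx

include hs hwt G in
/-- The weight spaces of a module generated by a finite family of weight vectors whose span is
stable under `𝔟̂` are finitely generated. -/
lemma fg_weightSpace [Finite κ] (htop : Submodule.span (Env 𝔤 A) (Set.range s) = ⊤) (μ : Wt 𝔥) :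
    (weightSpace 𝔥 M μ).FG := by
  have h : weightSpace 𝔥 M μ = Submodule.span A
      (G.negWord s '' {p | (∀ i ∈ p.1, G.deg i < 0) ∧ G.wtW p.1 + wt p.2 = μ}) := by
    refine le_antisymm (fun m hm =>
      G.mem_span_negWord_of_weight s wt hs hwt (by rw [htop]; trivial) hm) ?_
    rw [Submodule.span_le]
    rintro _ ⟨p, ⟨-, rfl⟩, rfl⟩
    exact G.negWord_mem_weightSpace s wt hwt p
  rw [h]
  refine Submodule.fg_span (((G.finite_words_ht wt (G.ht μ)).subset ?_).image _)
  rintro p ⟨hp, rfl⟩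
  exact ⟨hp, le_refl _⟩

end Finite

end Grading

end Words

end AffineO

end

/-! ### Verma modules are nonzero -/

noncomputable section

namespace AffineO

section Verma

variable {𝔤 : Type u} [LieRing 𝔤] [LieAlgebra ℂ 𝔤] {𝔥 𝔟 : LieSubalgebra ℂ 𝔤}

/-- The cocycle pairs only opposite powers of t, and its coefficient vanishes at t^0. Hence weights
define characters of 𝔟̂ also on K. -/
lemma loopCocycle_eq_zero {x y : ℤ →₀ 𝔤} (hx : ∀ n < 0, x n = 0) (hy : ∀ n < 0, y n = 0) :
    loopCocycle 𝔤 x y = 0 := by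
  have hsum (z : ℤ →₀ 𝔤) : z = ∑ n ∈ z.support, Finsupp.single n (z n) :=
    (Finsupp.sum_single z).symm
  rw [hsum x, map_sum, LinearMap.sum_apply]
  refine Finset.sum_eq_zero fun n hn => ?_
  rw [hsum y, map_sum]
  refine Finset.sum_eq_zero fun m hm => ?_
  rw [loopCocycle_single]
  have hn0 : 0 ≤ n := by
    by_contra h
    exact Finsupp.mem_support_iff.mp hn (hx n (not_le.mp h))
  have hm0 : 0 ≤ m := by
    by_contra h
    exact Finsupp.mem_support_iff.mp hm (hy m (not_le.mp h))
  split_ifs with h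
  · rw [show n = 0 by omega, Int.cast_zero, zero_mul]
  · rfl

lemma lie_loop_zero {x y : Affine 𝔤} (hx : x ∈ borelHat 𝔟) (hy : y ∈ borelHat 𝔟) :
    ⁅x, y⁆.loop 0 = ⁅x.loop 0, y.loop 0⁆ := by
  rw [loop_lie, Finsupp.sub_apply, Finsupp.add_apply, Finsupp.smul_apply, Finsupp.smul_apply,
    euler_apply, euler_apply, Int.cast_zero, zero_smul, zero_smul, smul_zero, smul_zero,
    add_zero, sub_zero, loopBracket_apply, Finsupp.sum]
  by_cases h0 : x.loop 0 = 0
  · rw [h0, zero_lie]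
    refine Finset.sum_eq_zero fun i _ => ?_
    rcases lt_trichotomy i 0 with hi | rfl | hi
    · rw [hx.1 i hi, zero_lie]
    · rw [h0, zero_lie]
    · rw [hy.1 (0 - i) (by omega), lie_zero]
  · rw [Finset.sum_eq_single 0]
    · rw [sub_zero]
    · intro i _ hi
      rcases lt_or_gt_of_ne hi with hi | hi
      · rw [hx.1 i hi, zero_lie]
      · rw [hy.1 (0 - i) (by omega), lie_zero]
    · intro h
      rw [Finsupp.notMem_support_iff.mp h, zero_lie]

variable [LieRing.IsNilpotent 𝔥] (G : Grading 𝔥 𝔟) (R : Type u) [CommRing R] [Algebra ℂ R]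
  [Algebra (SymmetricAlgebra ℂ 𝔥) R]

/-- The projection of the affine Kac-Moody algebra to its Cartan subalgebra. -/
def Grading.projHat : Affine 𝔤 →ₗ[ℂ] CartanHat 𝔥 where
  toFun x := (G.proj (x.loop 0), x.central, x.deriv)
  map_add' x y := by simp
  map_smul' c x := by simp

include G in
lemma Grading.cartanIncl_mem (H : CartanHat 𝔥) : cartanIncl 𝔥 H ∈ borelHat 𝔟 := by
  refine ⟨fun n hn => Finsupp.single_eq_of_ne (by omega), ?_⟩
  change Finsupp.single 0 (H.1 : 𝔤) 0 ∈ 𝔟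
  rw [Finsupp.single_eq_same]
  exact G.le H.1.2

lemma Grading.projHat_cartanIncl (H : CartanHat 𝔥) : G.projHat (cartanIncl 𝔥 H) = H := by
  change (G.proj (Finsupp.single 0 (H.1 : 𝔤) 0), H.2.1, H.2.2) = H
  rw [Finsupp.single_eq_same, G.proj_coe]

lemma Grading.projHat_lie {x y : Affine 𝔤} (hx : x ∈ borelHat 𝔟) (hy : y ∈ borelHat 𝔟) :
    G.projHat ⁅x, y⁆ = 0 := by
  change (G.proj (⁅x, y⁆.loop 0), ⁅x, y⁆.central, ⁅x, y⁆.deriv) = 0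
  rw [lie_loop_zero hx hy, G.proj_lie _ hx.2 _ hy.2, central_lie,
    loopCocycle_eq_zero hx.1 hy.1, deriv_lie]
  rfl

/-- The character of the affine Cartan subalgebra defined by a weight. -/
def charHat [IsScalarTower ℂ (SymmetricAlgebra ℂ 𝔥) R] (lam : Wt 𝔥) : CartanHat 𝔥 →ₗ[ℂ] R :=
  Algebra.linearMap ℂ R ∘ₗ lam +
    (IsScalarTower.toAlgHom ℂ (SymmetricAlgebra ℂ 𝔥) R).toLinearMap ∘ₗ
      SymmetricAlgebra.ι ℂ 𝔥 ∘ₗ LinearMap.fst ℂ 𝔥 (ℂ × ℂ)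

lemma charHat_apply [IsScalarTower ℂ (SymmetricAlgebra ℂ 𝔥) R] (lam : Wt 𝔥) (H : CartanHat 𝔥) :
    charHat R lam H = algebraMap ℂ R (lam H) + tau 𝔥 R H := rfl

open InducedModule in
/-- A representation of the affine Kac-Moody algebra with a nonzero vector on which the affine
Borel subalgebra acts by the character defined by a weight. -/
lemma exists_rep_of_weight [IsScalarTower ℂ (SymmetricAlgebra ℂ 𝔥) R] (lam : Wt 𝔥) :
    ∃ (I : Type u) (ρ : Affine 𝔤 →ₗ[ℂ] Module.End R (Poly I R)),
      (∀ x y, ρ ⁅x, y⁆ = ρ x * ρ y - ρ y * ρ x) ∧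
      ∀ x ∈ borelHat 𝔟, ρ x (Finsupp.single 0 1) =
        charHat R lam (G.projHat x) • Finsupp.single 0 1 := by
  classical
  -- The variables of the polynomial space are a basis of 𝔤̂ / 𝔟̂, in an arbitrary linear order.
  let Q := Affine 𝔤 ⧸ (borelHat 𝔟).toSubmodule
  let bas := Module.Basis.ofVectorSpace ℂ Q
  let I := Module.Basis.ofVectorSpaceIndex ℂ Q
  let _ : LinearOrder I := linearOrderOfSTO WellOrderingRel
  let coord : Affine 𝔤 →ₗ[ℂ] I →₀ ℂ := bas.repr.toLinearMap ∘ₗ Submodule.mkQ _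
  have hcoord (x : Affine 𝔤) : coord x = 0 ↔ x ∈ borelHat 𝔟 := by
    change bas.repr (Submodule.mkQ _ x) = 0 ↔ _
    rw [LinearEquiv.map_eq_zero_iff, Submodule.mkQ_apply, Submodule.Quotient.mk_eq_zero]
    rfl
  choose c hc using fun i : I => Submodule.mkQ_surjective (borelHat 𝔟).toSubmodule (bas i)
  have hc' (i : I) : coord (c i) = Finsupp.single i 1 := by
    change bas.repr (Submodule.mkQ _ (c i)) = _
    rw [hc, Module.Basis.repr_self]
  let χ₀ : Affine 𝔤 →ₗ[ℂ] R := charHat R lam ∘ₗ G.projHat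
  -- The correction makes the form vanish on the chosen lifts `c i` without changing it on 𝔟̂.
  let χ : Affine 𝔤 →ₗ[ℂ] R := χ₀ - Finsupp.linearCombination ℂ (fun i => χ₀ (c i)) ∘ₗ coord
  have hχ (i : I) : χ (c i) = 0 := by
    simp [χ, hc']
  have hχ' (x : Affine 𝔤) (hx : coord x = 0) : χ x = χ₀ x := by
    simp [χ, hx]
  obtain ⟨ρ, h1, h2⟩ := exists_rep (R := R) hc' hχ (fun x y hx hy => by
    have hx' := (hcoord x).mp hx
    have hy' := (hcoord y).mp hy
    have h := (hcoord _).mpr ((borelHat 𝔟).lie_mem hx' hy')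
    refine ⟨h, ?_⟩
    rw [hχ' _ h]
    change charHat R lam (G.projHat ⁅x, y⁆) = 0
    rw [G.projHat_lie hx' hy', map_zero])
  refine ⟨I, ρ, h1, fun x hx => ?_⟩
  rw [h2 x ((hcoord x).mpr hx), hχ' x ((hcoord x).mpr hx)]
  rfl

/-- A representation of the affine Kac-Moody algebra on an `R`-module, as a homomorphism on the
algebra `R ⊗ U(𝔤̂)`. -/
lemma exists_algHom_of_rep {V : Type*} [AddCommGroup V] [Module R V] [Module ℂ V]
    [IsScalarTower ℂ R V] (ρ : Affine 𝔤 →ₗ[ℂ] Module.End R V)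
    (hρ : ∀ x y, ρ ⁅x, y⁆ = ρ x * ρ y - ρ y * ρ x) :
    ∃ Φ : Env 𝔤 R →ₐ[R] Module.End R V, ∀ x, Φ (act R x) = ρ x := by
  let _ : LieRing (Module.End R V) := LieRing.ofAssociativeRing
  let ρ' : Affine 𝔤 →ₗ⁅ℂ⁆ Module.End R V :=
    { ρ with
      map_lie' := fun {x y} => by
        rw [LieRing.of_associative_ring_bracket]
        exact hρ x y }
  have hcomm (r : R) (s : UniversalEnvelopingAlgebra ℂ (Affine 𝔤)) :
      Commute (Algebra.ofId R (Module.End R V) r) (UniversalEnvelopingAlgebra.lift ℂ ρ' s) :=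
    Algebra.commutes r _
  refine ⟨Algebra.TensorProduct.lift (Algebra.ofId R _) (UniversalEnvelopingAlgebra.lift ℂ ρ')
    hcomm, fun x => ?_⟩
  refine (Algebra.TensorProduct.lift_tmul _ _ hcomm _ _).trans ?_
  rw [UniversalEnvelopingAlgebra.lift_ι_apply, map_one, one_mul]
  rfl

include G in
/-- Verma modules are not zero. -/
theorem one_notMem_verma [Nontrivial R] [IsScalarTower ℂ (SymmetricAlgebra ℂ 𝔥) R] (lam : Wt 𝔥) :
    (1 : Env 𝔤 R) ∉ Submodule.span (Env 𝔤 R)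
    ({e | ∃ H : CartanHat 𝔥, e = act R (cartanIncl 𝔥 H) -
        algebraMap R (Env 𝔤 R) (algebraMap ℂ R (lam H) + tau 𝔥 R H)} ∪
      {e | ∃ x ∈ borelHat 𝔟, ∃ y ∈ borelHat 𝔟, e = act R ⁅x, y⁆}) := by
  obtain ⟨I, ρ, h1, h2⟩ := exists_rep_of_weight G R lam
  obtain ⟨Φ, hΦ⟩ := exists_algHom_of_rep R ρ h1
  let v : InducedModule.Poly I R := Finsupp.single 0 1
  -- The annihilator of the generating vector contains the relations of the Verma module, but not 1.
  let J : Submodule (Env 𝔤 R) (Env 𝔤 R) :=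
    { carrier := {e | Φ e v = 0}
      add_mem' := fun {a b} ha hb => by
        change Φ (a + b) v = 0
        rw [map_add, LinearMap.add_apply, show Φ a v = 0 from ha, show Φ b v = 0 from hb, add_zero]
      zero_mem' := by simp
      smul_mem' := fun c x hx => by
        change Φ (c * x) v = 0
        rw [map_mul, Module.End.mul_apply, show Φ x v = 0 from hx, map_zero] }
  intro h
  have hJ : (1 : Env 𝔤 R) ∈ J := by
    refine Submodule.span_le.mpr ?_ h
    rintro _ (⟨H, rfl⟩ | ⟨x, hx, y, hy, rfl⟩)
    · change Φ _ v = 0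
      have hH : cartanIncl 𝔥 H ∈ borelHat 𝔟 := G.cartanIncl_mem H
      rw [map_sub, LinearMap.sub_apply, hΦ, AlgHom.commutes, h2 _ hH, G.projHat_cartanIncl,
        charHat_apply, Module.algebraMap_end_apply, sub_self]
    · change Φ _ v = 0
      rw [hΦ, h2 _ ((borelHat 𝔟).lie_mem hx hy), G.projHat_lie hx hy, map_zero, zero_smul]
  have h3 : Φ 1 v = 0 := hJ
  rw [map_one, Module.End.one_apply] at h3
  exact one_ne_zero (Finsupp.single_eq_zero.mp h3)

end Verma

end AffineO

end

/-! ### Singular vectors -/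

noncomputable section

namespace AffineO

section Singular

variable {𝔤 : Type u} [LieRing 𝔤] [LieAlgebra ℂ 𝔤] {𝔥 𝔟 : LieSubalgebra ℂ 𝔤}
  [LieRing.IsNilpotent 𝔥] {A : Type u} [CommRing A] [Algebra ℂ A]
  [Algebra (SymmetricAlgebra ℂ 𝔥) A] (G : Grading 𝔥 𝔟)

/-- A singular vector: a weight vector killed by the elements of positive degree. -/
structure Grading.IsSing {M : GMod 𝔤 A} (γ : Wt 𝔥) (v : M) : Prop where
  mem : v ∈ weightSpace 𝔥 M γ
  kill : ∀ i, 0 < G.deg i → act A (G.vec i) • v = 0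

variable {G}

namespace Grading.IsSing

lemma map {M N : GMod 𝔤 A} {γ : Wt 𝔥} {v : M} (hv : G.IsSing γ v) (f : M →ₗ[Env 𝔤 A] N) :
    G.IsSing γ (f v) :=
  ⟨map_mem_weightSpace f hv.mem, fun i hi => by rw [← map_smul, hv.kill i hi, map_zero]⟩

variable {M : GMod 𝔤 A} {γ : Wt 𝔥} {v : M} (hv : G.IsSing γ v)

include hv

lemma borel_mem (k : Unit) : ∀ x ∈ borelHat 𝔟,
    act A x • (fun _ : Unit => v) k ∈ Submodule.span A (Set.range fun _ : Unit => v) := by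
  intro x hx
  refine G.borel_smul_mem _ (fun i hi => ?_) hx
  rcases hi.eq_or_lt with hi | hi
  · obtain ⟨a, ha⟩ := G.act_zero_smul hi.symm hv.mem
    change act A (G.vec i) • v ∈ _
    rw [ha]
    exact Submodule.smul_mem _ _ (Submodule.subset_span ⟨(), rfl⟩)
  · change act A (G.vec i) • v ∈ _
    rw [hv.kill i hi]
    exact Submodule.zero_mem _

lemma catO (h : Submodule.span (Env 𝔤 A) {v} = ⊤) : catO A 𝔥 𝔟 M :=
  G.catO_of_span_eq_top (fun _ : Unit => v) (fun _ => γ) hv.borel_mem (fun _ => hv.mem)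
    (by rw [Set.range_const]; exact h)

lemma wtLE {μ : Wt 𝔥} {m : M} (hm : m ∈ Submodule.span (Env 𝔤 A) {v})
    (hμ : m ∈ weightSpace 𝔥 M μ) (h0 : m ≠ 0) : WtLE 𝔥 𝔟 μ γ := by
  obtain ⟨-, h⟩ := G.exists_wtLE (fun _ : Unit => v) (fun _ => γ) hv.borel_mem (fun _ => hv.mem)
    (by rw [Set.range_const]; exact hm) hμ h0
  exact h

/-- The highest weight space is spanned by the singular vector. -/
lemma exists_smul {m : M} (hm : m ∈ Submodule.span (Env 𝔤 A) {v})
    (hμ : m ∈ weightSpace 𝔥 M γ) : ∃ a : A, a • v = m := by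
  have h := G.mem_span_negWord_of_weight (fun _ : Unit => v) (fun _ => γ) hv.borel_mem
    (fun _ => hv.mem) (by rw [Set.range_const]; exact hm) hμ
  refine Submodule.mem_span_singleton.mp (Submodule.span_mono ?_ h)
  rintro _ ⟨⟨w, k⟩, ⟨hw, hγ⟩, rfl⟩
  -- A word in letters of negative degree that has weight zero is empty.
  have h1 : G.wtW w = 0 := by simpa using hγ
  have h2 := (G.length_le_of_neg hw).1
  rw [h1, map_zero, neg_zero] at h2
  have h3 : w.length = 0 := by exact_mod_cast le_antisymm h2 (Nat.cast_nonneg _)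
  rw [List.length_eq_zero_iff.mp h3]
  simp [Grading.negWord]

end Grading.IsSing

variable [IsLocalRing A]

lemma isUnit_of_smul_ne {M : GMod 𝔤 A} {a : A} {m : M} (h : a • m = m) (h0 : m ≠ 0) :
    IsUnit a := by
  rcases IsLocalRing.isUnit_or_isUnit_one_sub_self a with ha | ha
  · exact ha
  · refine absurd ?_ h0
    rw [← ha.smul_eq_zero, sub_smul, one_smul, h, sub_self]

/-- The annihilator of a nonzero singular vector is contained in the annihilator of a singular
vector of the same weight in a simple module. -/
lemma smul_eq_zero_of_isSing {M L : GMod 𝔤 A} [IsSimpleModule (Env 𝔤 A) L] {γ : Wt 𝔥} {v : M}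
    {l : L} (hv : G.IsSing γ v) (hl : G.IsSing γ l) (hv0 : v ≠ 0) (hl0 : l ≠ 0) (e : Env 𝔤 A)
    (he : e • v = 0) : e • l = 0 := by
  by_contra h0
  obtain ⟨e', he'⟩ := IsSimpleModule.toSpanSingleton_surjective (Env 𝔤 A) h0 l
  rw [LinearMap.toSpanSingleton_apply, smul_smul] at he'
  -- The pair (v, l) is singular of weight γ. If e kills v but not l, the submodule it generates
  -- contains (0, l), and by one-dimensionality over A this equals a (v, l). Then a fixes l, so it
  -- is a unit, and a v = 0 contradicts v ≠ 0.
  let P : GMod 𝔤 A := ModuleCat.of (Env 𝔤 A) (M × L)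
  let z : P := (v, l)
  let p1 : P →ₗ[Env 𝔤 A] M := LinearMap.fst (Env 𝔤 A) M L
  let p2 : P →ₗ[Env 𝔤 A] L := LinearMap.snd (Env 𝔤 A) M L
  have hP {x y : P} (h1 : p1 x = p1 y) (h2 : p2 x = p2 y) : x = y := Prod.ext h1 h2
  have hz : G.IsSing γ z := by
    refine ⟨fun H => hP ?_ ?_, fun i hi => hP ?_ ?_⟩
    · rw [map_smul, smul_eq, map_smul]; exact hv.mem H
    · rw [map_smul, smul_eq, map_smul]; exact hl.mem H
    · rw [map_smul, map_zero]; exact hv.kill i hi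
    · rw [map_smul, map_zero]; exact hl.kill i hi
  have h1 : p1 ((e' * e) • z) = 0 := by
    rw [map_smul, mul_smul]
    change e' • e • v = 0
    rw [he, smul_zero]
  have h2 : p2 ((e' * e) • z) = l := by
    rw [map_smul]
    exact he'
  have h3 : (e' * e) • z ∈ weightSpace 𝔥 P γ := by
    intro H
    refine hP ?_ ?_
    · rw [map_smul, h1, smul_zero, smul_eq, map_smul, h1, smul_zero]
    · rw [map_smul, h2, smul_eq, map_smul, h2]
      exact hl.mem H
  obtain ⟨a, ha⟩ := hz.exists_smul (Submodule.smul_mem _ _ (Submodule.mem_span_singleton_self z)) h3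
  have h4 : a • v = 0 := by
    rw [← h1, ← ha, smul_eq, smul_eq, map_smul]
    rfl
  have h5 : a • l = l := by
    have h6 := congrArg p2 ha
    rw [h2, smul_eq, map_smul] at h6
    exact h6
  exact hv0 ((isUnit_of_smul_ne h5 hl0).smul_eq_zero.mp h4)

end Singular

/-! ### The simple modules L(λ) -/

section Simple

variable {𝔤 : Type u} [LieRing 𝔤] [LieAlgebra ℂ 𝔤] {𝔥 𝔟 : LieSubalgebra ℂ 𝔤}
  [LieRing.IsNilpotent 𝔥] (G : Grading 𝔥 𝔟)

namespace Grading

/-- Up to a nonzero scalar, a vector of nonzero degree is its own bracket with the grading element.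
In positive degree it therefore lies in [𝔟̂, 𝔟̂] and kills the generator of a Verma module. -/
lemma act_eq_smul_lie {R : Type u} [CommRing R] [Algebra ℂ R] {i : G.ι} (hi : G.deg i ≠ 0) :
    act R (G.vec i) =
      algebraMap ℂ R ((G.deg i : ℂ)⁻¹) • act R ⁅cartanIncl 𝔥 G.elt, G.vec i⁆ := by
  rw [← act_smul, G.lie_vec, smul_smul, G.wt_elt, inv_mul_cancel₀ (by exact_mod_cast hi), one_smul]

lemma deriv_vec {i : G.ι} (hi : G.deg i ≠ 0) : (G.vec i).deriv = 0 := by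
  have h : (⁅cartanIncl 𝔥 G.elt, G.vec i⁆).deriv = 0 := rfl
  rw [G.lie_vec, deriv_smul, G.wt_elt, mul_eq_zero] at h
  exact h.resolve_left (by exact_mod_cast hi)

variable (R : Type u) [Field R] [Algebra ℂ R] [Algebra (SymmetricAlgebra ℂ 𝔥) R]

variable (𝔥 𝔟) in
/-- The generator of a Verma module. -/
def _root_.AffineO.vermaGen (lam : Wt 𝔥) : verma 𝔥 𝔟 R lam := Submodule.Quotient.mk (1 : Env 𝔤 R)

lemma isSing_verma (lam : Wt 𝔥) :
    G.IsSing lam (vermaGen 𝔥 𝔟 R lam) := by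
  constructor
  · intro H
    change Submodule.Quotient.mk (act R (cartanIncl 𝔥 H) * 1) =
      Submodule.Quotient.mk (algebraMap R (Env 𝔤 R) _ * 1)
    rw [mul_one, mul_one, Submodule.Quotient.eq]
    exact Submodule.subset_span (Or.inl ⟨H, rfl⟩)
  · intro i hi
    rw [G.act_eq_smul_lie hi.ne', smul_assoc]
    have h : act R ⁅cartanIncl 𝔥 G.elt, G.vec i⁆ •
        vermaGen 𝔥 𝔟 R lam = 0 := by
      change Submodule.Quotient.mk (act R _ * 1) = 0
      rw [mul_one, Submodule.Quotient.mk_eq_zero]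
      exact Submodule.subset_span (Or.inr ⟨_, G.cartanIncl_mem _, _, G.mem_borel i hi.le, rfl⟩)
    rw [h, smul_zero]

lemma span_verma (lam : Wt 𝔥) :
    Submodule.span (Env 𝔤 R) {vermaGen 𝔥 𝔟 R lam} = ⊤ := by
  rw [eq_top_iff]
  intro m _
  obtain ⟨e, rfl⟩ := Submodule.Quotient.mk_surjective _ m
  refine Submodule.mem_span_singleton.mpr ⟨e, ?_⟩
  change Submodule.Quotient.mk (e * 1) = _
  rw [mul_one]

/-- The sum of the proper submodules of a module over a field generated by a nonzero singular
vector is a proper submodule. -/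
lemma sSup_proper_ne_top {R : Type u} [Field R] [Algebra ℂ R] [Algebra (SymmetricAlgebra ℂ 𝔥) R]
    {M : GMod 𝔤 R} {γ : Wt 𝔥} {v : M} (hv : G.IsSing γ v)
    (h : Submodule.span (Env 𝔤 R) {v} = ⊤) (hv0 : v ≠ 0) :
    sSup {N : Submodule (Env 𝔤 R) M | N ≠ ⊤} ≠ ⊤ := by
  -- The highest weight space is a line over the field `R`, so a proper submodule has no component
  -- in it; the same then holds for sums of proper submodules.
  have key (N : Submodule (Env 𝔤 R) M) (hN : N ≠ ⊤) (m : M) (hm : m ∈ N) :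
      m ∈ ⨆ lam ≠ γ, weightSpace 𝔥 M lam := by
    obtain ⟨s, u, hu, rfl⟩ := (hv.catO h).1.exists_sum m
    have h1 := mem_of_sum_mem (N.restrictScalars R) (fun H x hx => N.smul_mem _ hx) s u
      (fun lam _ => hu lam) hm
    refine Submodule.sum_mem _ fun lam hl => ?_
    by_cases hlam : lam = γ
    · subst hlam
      obtain ⟨a, ha⟩ := hv.exists_smul (by rw [h]; trivial) (hu lam)
      have h2 : a = 0 := by
        by_contra ha0
        apply hN
        rw [eq_top_iff, ← h, Submodule.span_singleton_le_iff_mem]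
        have h3 : a⁻¹ • u lam ∈ N.restrictScalars R := Submodule.smul_mem _ _ (h1 lam hl)
        rwa [← ha, smul_smul, inv_mul_cancel₀ ha0, one_smul] at h3
      rw [← ha, h2, zero_smul]
      exact Submodule.zero_mem _
    · exact Submodule.mem_iSup_of_mem lam (Submodule.mem_iSup_of_mem hlam (hu lam))
  intro htop
  apply hv0
  refine mem_bot_of_weightSpace_inf hv.mem ?_
  have h1 : v ∈ sSup {N : Submodule (Env 𝔤 R) M | N ≠ ⊤} := by rw [htop]; trivial
  rw [sSup_eq_iSup'] at h1
  exact Submodule.iSup_induction _ (motive := fun m => m ∈ ⨆ lam ≠ γ, weightSpace 𝔥 M lam) h1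
    (fun N m hm => key N.1 N.2 m hm) (Submodule.zero_mem _) (fun _ _ => Submodule.add_mem _)

theorem exists_isSing_simpleQuotient [IsScalarTower ℂ (SymmetricAlgebra ℂ 𝔥) R] (lam : Wt 𝔥) :
    IsSimpleModule (Env 𝔤 R) (simpleQuotient 𝔥 𝔟 R lam) ∧
      ∃ v : simpleQuotient 𝔥 𝔟 R lam, G.IsSing lam v ∧ v ≠ 0 := by
  have hv0 : vermaGen 𝔥 𝔟 R lam ≠ 0 := fun h =>
    one_notMem_verma G R lam ((Submodule.Quotient.mk_eq_zero _).mp h)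
  have h1 := G.sSup_proper_ne_top (G.isSing_verma R lam) (span_verma (𝔟 := 𝔟) R lam) hv0
  refine ⟨?_, ?_⟩
  · refine isSimpleModule_iff_isCoatom.mpr ⟨h1, fun N hN => ?_⟩
    by_contra h
    exact absurd (le_sSup (a := N) h) (not_le_of_gt hN)
  · let q : verma 𝔥 𝔟 R lam →ₗ[Env 𝔤 R] simpleQuotient 𝔥 𝔟 R lam := Submodule.mkQ _
    refine ⟨q (vermaGen 𝔥 𝔟 R lam), (G.isSing_verma R lam).map q, fun h => h1 ?_⟩
    have h2 := (Submodule.Quotient.mk_eq_zero _).mp h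
    exact eq_top_iff.mpr ((span_verma (𝔟 := 𝔟) R lam).ge.trans
      ((Submodule.span_singleton_le_iff_mem _ _).mpr h2))

variable (A : Type u) [CommRing A] [IsLocalRing A] [Algebra ℂ A]
  [Algebra (SymmetricAlgebra ℂ 𝔥) A]

lemma residueHom_act (x : Affine 𝔤) :
    residueHom 𝔤 A (act A x) = act (IsLocalRing.ResidueField A) x := by
  rw [residueHom, act, Algebra.TensorProduct.map_tmul, map_one]
  rfl

lemma residueHom_algebraMap (a : A) : residueHom 𝔤 A (algebraMap A (Env 𝔤 A) a) =
    algebraMap (IsLocalRing.ResidueField A) _ (IsLocalRing.residue A a) := by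
  rw [residueHom]
  change Algebra.TensorProduct.map _ _ (a ⊗ₜ 1) = _ ⊗ₜ 1
  rw [Algebra.TensorProduct.map_tmul, map_one]
  rfl

lemma residueHom_surjective : Function.Surjective (residueHom 𝔤 A) := by
  refine TensorProduct.map_surjective IsLocalRing.residue_surjective Function.surjective_id

/-- Simplicity over the residue field passes to A because base change to the residue field is
surjective on the acting algebras. -/
theorem exists_isSing_simpleL [IsScalarTower ℂ (SymmetricAlgebra ℂ 𝔥) A] (lam : Wt 𝔥) :
    IsSimpleModule (Env 𝔤 A) (simpleL A 𝔥 𝔟 lam) ∧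
      ∃ v : simpleL A 𝔥 𝔟 lam, G.IsSing lam v ∧ v ≠ 0 := by
  obtain ⟨h1, v, hv, hv0⟩ :=
    G.exists_isSing_simpleQuotient (IsLocalRing.ResidueField A) lam
  refine ⟨?_, v, ⟨fun H => ?_, fun i hi => ?_⟩, hv0⟩
  · rw [isSimpleModule_iff_toSpanSingleton_surjective]
    refine ⟨⟨v, 0, hv0⟩, fun x hx y => ?_⟩
    obtain ⟨e, he⟩ := (isSimpleModule_iff_toSpanSingleton_surjective.mp h1).2 x hx y
    obtain ⟨e, rfl⟩ := residueHom_surjective A e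
    exact ⟨e, he⟩
  · change residueHom 𝔤 A (act A _) • (show simpleQuotient 𝔥 𝔟 _ lam from v) =
      residueHom 𝔤 A (algebraMap A (Env 𝔤 A) _) • (show simpleQuotient 𝔥 𝔟 _ lam from v)
    rw [residueHom_act, residueHom_algebraMap, map_add]
    exact hv.mem H
  · change residueHom 𝔤 A (act A _) • (show simpleQuotient 𝔥 𝔟 _ lam from v) = 0
    rw [residueHom_act]
    exact hv.kill i hi

end Grading

end Simple

end AffineO

end

/-! ### Simple factors described by annihilators -/

noncomputable section

section Factors

variable {R : Type*} [Ring R] {L M N : Type*} [AddCommGroup L] [Module R L] [AddCommGroup M]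
  [Module R M] [AddCommGroup N] [Module R N]

/-- A linear map from a cyclic module with a given value at a generator. -/
lemma LinearMap.exists_apply_eq_of_span {v : M} (hv : Submodule.span R {v} = ⊤) (n : N)
    (h : ∀ e : R, e • v = 0 → e • n = 0) : ∃ f : M →ₗ[R] N, f v = n := by
  have hs : Function.Surjective (LinearMap.toSpanSingleton R M v) := by
    rw [← LinearMap.range_eq_top, LinearMap.range_toSpanSingleton, hv]
  let E := (LinearMap.toSpanSingleton R M v).quotKerEquivOfSurjective hs
  let g := (LinearMap.ker (LinearMap.toSpanSingleton R M v)).liftQ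
    (LinearMap.toSpanSingleton R N n) fun e he => h e he
  refine ⟨g ∘ₗ E.symm.toLinearMap, ?_⟩
  have h1 : E (Submodule.Quotient.mk 1) = v := by
    change LinearMap.toSpanSingleton R M v 1 = v
    simp
  rw [LinearMap.comp_apply, LinearEquiv.coe_coe, (LinearEquiv.symm_apply_eq E).mpr h1.symm]
  change LinearMap.toSpanSingleton R N n 1 = n
  simp

lemma Submodule.span_coe_singleton_eq_top (v : M) :
    Submodule.span R {(⟨v, Submodule.mem_span_singleton_self v⟩ : Submodule.span R {v})} = ⊤ := by
  rw [eq_top_iff]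
  rintro ⟨x, hx⟩ -
  obtain ⟨e, rfl⟩ := Submodule.mem_span_singleton.mp hx
  exact Submodule.mem_span_singleton.mpr ⟨e, rfl⟩

variable (R L M) in
/-- A nonzero element of `L` is killed by the annihilator of an element of `M`. If `L` is simple,
this means that `L` is a subquotient of `M`. -/
def HasFactor : Prop := ∃ (x : M) (l : L), l ≠ 0 ∧ ∀ e : R, e • x = 0 → e • l = 0

lemma HasFactor.of_injective (h : HasFactor R L M) (f : M →ₗ[R] N) (hf : Function.Injective f) :
    HasFactor R L N := by
  obtain ⟨x, l, hl, hx⟩ := h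
  refine ⟨f x, l, hl, fun e he => hx e ?_⟩
  rw [← map_smul] at he
  exact (map_eq_zero_iff f hf).mp he

lemma HasFactor.of_surjective (h : HasFactor R L N) (f : M →ₗ[R] N) (hf : Function.Surjective f) :
    HasFactor R L M := by
  obtain ⟨x, l, hl, hx⟩ := h
  obtain ⟨y, rfl⟩ := hf x
  exact ⟨y, l, hl, fun e he => hx e (by rw [← map_smul, he, map_zero])⟩

lemma HasFactor.of_surjective_left [IsSimpleModule R L] (f : M →ₗ[R] L)
    (hf : Function.Surjective f) : HasFactor R L M := by
  have := IsSimpleModule.nontrivial R L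
  obtain ⟨l, hl⟩ := exists_ne (0 : L)
  obtain ⟨x, rfl⟩ := hf l
  exact ⟨x, f x, hl, fun e he => by rw [← map_smul, he, map_zero]⟩

/-- If the annihilator of x_i kills l, then x_i gives the factor. Otherwise some e kills x_i but not
l, and multiplying everything by e removes the summand x_i. -/
lemma HasFactor.exists_of_sum {κ : Type*} {S : κ → Submodule R M} (s : Finset κ) :
    ∀ (x : κ → M) (_ : ∀ i, x i ∈ S i) (l : L) (_ : l ≠ 0)
      (_ : ∀ e : R, e • ∑ i ∈ s, x i = 0 → e • l = 0), ∃ i, HasFactor R L (S i) := by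
  classical
  induction s using Finset.induction_on with
  | empty =>
    intro x _ l hl h
    exact absurd (by simpa using h 1 (by simp)) hl
  | insert i s hi ih =>
    intro x hx l hl h
    by_cases hc : ∀ e : R, e • x i = 0 → e • l = 0
    · exact ⟨i, ⟨x i, hx i⟩, l, hl, fun e he => hc e (congrArg Subtype.val he)⟩
    · push Not at hc
      obtain ⟨e, he, hel⟩ := hc
      refine ih (fun j => e • x j) (fun j => Submodule.smul_mem _ _ (hx j)) _ hel fun e' he' => ?_
      rw [smul_smul]
      refine h _ ?_
      rw [Finset.sum_insert hi, smul_add, mul_smul, he, smul_zero, zero_add, mul_smul,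
        Finset.smul_sum]
      exact he'

/-- The annihilator condition is exactly what defines a map from the cyclic submodule generated by x
to L with x ↦ l; its image is L by simplicity. -/
lemma hasFactor_iff [IsSimpleModule R L] : HasFactor R L M ↔
    ∃ (N : Submodule R M) (N' : Submodule R N), Nonempty ((N ⧸ N') ≃ₗ[R] L) := by
  constructor
  · rintro ⟨x, l, hl, h⟩
    obtain ⟨f, hf⟩ := LinearMap.exists_apply_eq_of_span (Submodule.span_coe_singleton_eq_top x) l
      (fun e he => h e (congrArg Subtype.val he))
    refine ⟨_, LinearMap.ker f, ⟨f.quotKerEquivOfSurjective ?_⟩⟩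
    rw [← LinearMap.range_eq_top, eq_top_iff, ← IsSimpleModule.span_singleton_eq_top R hl,
      Submodule.span_singleton_le_iff_mem]
    exact ⟨_, hf⟩
  · rintro ⟨N, N', ⟨E⟩⟩
    have h1 : HasFactor R L N := HasFactor.of_surjective_left (E.toLinearMap ∘ₗ N'.mkQ)
      (E.surjective.comp N'.mkQ_surjective)
    exact h1.of_injective N.subtype N.injective_subtype

end Factors

namespace AffineO

/-! ### The L(λ) as restricted modules and as simple quotients -/

section SimpleL

variable {𝔤 : Type u} [LieRing 𝔤] [LieAlgebra ℂ 𝔤] {𝔥 𝔟 : LieSubalgebra ℂ 𝔤}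
  [LieRing.IsNilpotent 𝔥] {A : Type u} [CommRing A] [IsLocalRing A] [Algebra ℂ A]
  [Algebra (SymmetricAlgebra ℂ 𝔥) A] [IsScalarTower ℂ (SymmetricAlgebra ℂ 𝔥) A]
  (G : Grading 𝔥 𝔟)

namespace Grading

include G in
lemma isSimpleModule_simpleL (γ : Wt 𝔥) : IsSimpleModule (Env 𝔤 A) (simpleL A 𝔥 𝔟 γ) :=
  (G.exists_isSing_simpleL A γ).1

variable (A) in
/-- A highest weight vector of a simple module. -/
def topVec (γ : Wt 𝔥) : simpleL A 𝔥 𝔟 γ := (G.exists_isSing_simpleL A γ).2.choose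

lemma isSing_topVec (γ : Wt 𝔥) : G.IsSing γ (G.topVec A γ) :=
  (G.exists_isSing_simpleL A γ).2.choose_spec.1

lemma topVec_ne_zero (γ : Wt 𝔥) : G.topVec A γ ≠ 0 :=
  (G.exists_isSing_simpleL A γ).2.choose_spec.2

lemma span_topVec (γ : Wt 𝔥) : Submodule.span (Env 𝔤 A) {G.topVec A γ} = ⊤ := by
  have := G.isSimpleModule_simpleL (A := A) γ
  exact IsSimpleModule.span_singleton_eq_top _ (G.topVec_ne_zero γ)

include G in
lemma catO_simpleL (γ : Wt 𝔥) : catO A 𝔥 𝔟 (simpleL A 𝔥 𝔟 γ) :=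
  (G.isSing_topVec γ).catO (G.span_topVec γ)

include G in
lemma wtLE_of_simpleL {γ μ : Wt 𝔥} {l : simpleL A 𝔥 𝔟 γ}
    (hl : l ∈ weightSpace 𝔥 (simpleL A 𝔥 𝔟 γ) μ) (h0 : l ≠ 0) : WtLE 𝔥 𝔟 μ γ :=
  (G.isSing_topVec γ).wtLE (by rw [G.span_topVec]; trivial) hl h0

/-- Each of the two singular vectors generates the whole simple module, so each of the two weights
is below the other. -/
lemma eq_of_isSing_simpleL {γ μ : Wt 𝔥} {l : simpleL A 𝔥 𝔟 γ} (hl : G.IsSing μ l)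
    (h0 : l ≠ 0) : μ = γ := by
  have := G.isSimpleModule_simpleL (A := A) γ
  refine G.antisymm (G.wtLE_of_simpleL hl.mem h0) (hl.wtLE ?_ (G.isSing_topVec (A := A) γ).mem
    (G.topVec_ne_zero γ))
  rw [IsSimpleModule.span_singleton_eq_top _ h0]
  trivial

include G in
lemma eq_of_hom_simpleL {γ μ : Wt 𝔥} (f : simpleL A 𝔥 𝔟 μ →ₗ[Env 𝔤 A] simpleL A 𝔥 𝔟 γ)
    (hf : f ≠ 0) : μ = γ := by
  have := G.isSimpleModule_simpleL (A := A) μ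
  have hinj : Function.Injective f := (LinearMap.injective_or_eq_zero f).resolve_right hf
  exact G.eq_of_isSing_simpleL ((G.isSing_topVec (A := A) μ).map f)
    ((map_ne_zero_iff f hinj).mpr (G.topVec_ne_zero μ))

lemma component_smul {n : ℤ} (τ : 𝟭 (catO A 𝔥 𝔟).FullSubcategory ⟶ shiftO A 𝔥 𝔟 n)
    {M : GMod 𝔤 A} (hM : catO A 𝔥 𝔟 M) (a : A) (v : M) :
    component τ ⟨M, hM⟩ (a • v) = a • component τ ⟨M, hM⟩ v := by
  let f : M ⟶ (shiftMod 𝔤 A n).obj M := (τ.app ⟨M, hM⟩).hom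
  have h := f.hom.map_smul (algebraMap A (Env 𝔤 A) a) v
  have h1 := (toShift n M).symm.map_smul a (f.hom v)
  refine Eq.trans ?_ h1
  exact congrArg (toShift n M).symm h

include G in
-- A natural transformation of degree n sends the highest weight vector to a singular vector of
-- weight γ - nδ. For n ≠ 0 it is zero, since nonzero singular vectors of L(γ) have weight γ.
lemma resO_simpleL (γ : Wt 𝔥) : resO A 𝔥 𝔟 (simpleL A 𝔥 𝔟 γ) := by
  have hO := G.catO_simpleL (A := A) γ
  refine resO_iff.mpr ⟨hO, fun n hn τ _ v => ?_⟩
  have htop := G.isSing_topVec (A := A) γ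
  set u := component τ ⟨_, hO⟩ (G.topVec A γ) with hu
  have hzero : component τ ⟨_, hO⟩ (0 : simpleL A 𝔥 𝔟 γ) = 0 := by
    have := component_smul τ hO 0 (0 : simpleL A 𝔥 𝔟 γ)
    rwa [zero_smul, zero_smul] at this
  have h1 : G.IsSing (γ - n • delta 𝔥) u := by
    refine ⟨fun H => ?_, fun i hi => ?_⟩
    · have h2 := component_act τ hO (cartanIncl 𝔥 H) (G.topVec A γ)
      rw [htop.mem H, component_smul, ← hu, ← sub_eq_iff_eq_add, ← sub_smul] at h2
      rw [← h2]
      congr 1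
      have h3 : (γ - n • delta 𝔥) H = γ H - n * (cartanIncl 𝔥 H).deriv := by
        simp [delta, cartanIncl]
      rw [h3, map_sub]
      abel
    · have h2 := component_act τ hO (G.vec i) (G.topVec A γ)
      rw [htop.kill i hi, hzero, G.deriv_vec hi.ne', mul_zero, map_zero, zero_smul, add_zero] at h2
      exact h2.symm
  have h0 : u = 0 := by
    by_contra h0
    have h2 := G.eq_of_isSing_simpleL h1 h0
    have h3 := LinearMap.congr_fun (sub_eq_self.mp h2) ((0, 0, 1) : CartanHat 𝔥)
    have h4 : (n : ℂ) = 0 := by simpa [delta] using h3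
    exact hn (by exact_mod_cast h4)
  have hv : v ∈ Submodule.span (Env 𝔤 A) {G.topVec A γ} := by rw [G.span_topVec]; trivial
  obtain ⟨e, rfl⟩ := Submodule.mem_span_singleton.mp hv
  exact component_smul_eq_zero τ hO e h0

include G in
lemma resOTrunc_simpleL {J : Set (Wt 𝔥)} (hJ : IsOpenWt 𝔥 𝔟 J) {γ : Wt 𝔥} (hγ : γ ∈ J) :
    resOTrunc A 𝔥 𝔟 J (simpleL A 𝔥 𝔟 γ) := by
  refine ⟨G.resO_simpleL γ, fun lam h => ?_⟩
  obtain ⟨l, hl, h0⟩ := (Submodule.ne_bot_iff _).mp h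
  exact hJ γ hγ lam (G.wtLE_of_simpleL hl h0)

/-- A finitely generated stable submodule is spanned by finitely many weight vectors. -/
lemma _root_.AffineO.exists_finite_weight_span {M : GMod 𝔤 A} (hM : IsWeightModule 𝔥 M)
    {B : Submodule A M} (hB : B.FG)
    (hs : ∀ H : CartanHat 𝔥, ∀ v ∈ B, act A (cartanIncl 𝔥 H) • v ∈ B) :
    ∃ T : Set (Wt 𝔥 × M), T.Finite ∧ (∀ p ∈ T, p.2 ∈ weightSpace 𝔥 M p.1 ∧ p.2 ∈ B) ∧
      Submodule.span A (Prod.snd '' T) = B := by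
  have h1 (m : M) : ∃ T : Set (Wt 𝔥 × M), T.Finite ∧ (m ∈ B →
      (∀ p ∈ T, p.2 ∈ weightSpace 𝔥 M p.1 ∧ p.2 ∈ B) ∧ m ∈ Submodule.span A (Prod.snd '' T)) := by
    obtain ⟨s, v, hv, rfl⟩ := hM.exists_sum m
    refine ⟨(fun lam => (lam, v lam)) '' s, s.finite_toSet.image _, fun hm => ⟨?_, ?_⟩⟩
    · rintro _ ⟨lam, hl, rfl⟩
      exact ⟨hv lam, mem_of_sum_mem B hs s v (fun lam _ => hv lam) hm lam hl⟩
    · exact Submodule.sum_mem _ fun lam hl =>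
        Submodule.subset_span ⟨(lam, v lam), ⟨lam, hl, rfl⟩, rfl⟩
  choose T hT hT' using h1
  obtain ⟨F, rfl⟩ := hB
  have hF (m : M) (hm : m ∈ F) := hT' m (Submodule.subset_span hm)
  refine ⟨⋃ m ∈ F, T m, F.finite_toSet.biUnion fun m _ => hT m, ?_, le_antisymm ?_ ?_⟩
  · intro p hp
    obtain ⟨m, hm, hp⟩ := Set.mem_iUnion₂.mp hp
    exact (hF m hm).1 p hp
  · rw [Submodule.span_le]
    rintro _ ⟨p, hp, rfl⟩
    obtain ⟨m, hm, hp⟩ := Set.mem_iUnion₂.mp hp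
    exact ((hF m hm).1 p hp).2
  · rw [Submodule.span_le]
    intro m hm
    exact Submodule.span_mono (Set.image_mono (Set.subset_biUnion_of_mem (u := fun m => T m) hm))
      (hF m hm).2

/-- A nonzero module in the category `O` has a nonzero singular vector. -/
lemma exists_isSing {M : GMod 𝔤 A} (hM : catO A 𝔥 𝔟 M) {m : M} (hm : m ≠ 0) :
    ∃ (γ : Wt 𝔥) (v : M), G.IsSing γ v ∧ v ≠ 0 := by
  obtain ⟨s, v, hv, rfl⟩ := hM.1.exists_sum m
  obtain ⟨lam, hl, hlam⟩ := Finset.exists_ne_zero_of_sum_ne_zero hm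
  obtain ⟨B, hvB, hB, hst⟩ := hM.2 (v lam)
  obtain ⟨T, hT, hT1, hT2⟩ := exists_finite_weight_span hM.1 hB
    fun H x hx => hst _ (G.cartanIncl_mem H) x hx
  let S : Set (Wt 𝔥) := {μ | ∃ x ∈ B, x ∈ weightSpace 𝔥 M μ ∧ x ≠ 0}
  have hS : S.Finite := by
    refine (hT.image Prod.fst).subset ?_
    rintro μ ⟨x, hx, hxμ, hx0⟩
    by_contra hc
    apply hx0
    rw [← hT2, ← Subtype.range_coe (s := T), ← Set.range_comp, ← Set.image_univ] at hx
    have h1 := mem_span_of_weight (fun p : T => p.1.2) (fun p => p.1.1)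
      (fun p => (hT1 p.1 p.2).1) Set.univ hx hxμ
    rw [show {k : T | k ∈ Set.univ ∧ k.1.1 = μ} = ∅ from ?_, Set.image_empty,
      Submodule.span_empty] at h1
    · exact (Submodule.mem_bot A).mp h1
    · rw [Set.eq_empty_iff_forall_notMem]
      rintro p ⟨-, hp⟩
      exact hc ⟨p.1, p.2, hp⟩
  -- A vector of maximal height in a finitely generated 𝔟̂-stable submodule is singular, since
  -- positive degrees would raise its height inside that submodule.
  obtain ⟨μ, ⟨x, hxB, hx, hx0⟩, hmax⟩ := Set.exists_max_image S G.ht hS ⟨lam, v lam, hvB, hv lam, hlam⟩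
  refine ⟨μ, x, ⟨hx, fun i hi => ?_⟩, hx0⟩
  by_contra h0
  have h1 := hmax _ ⟨_, hst _ (G.mem_borel i hi.le) x hxB, G.act_mem_weightSpace i hx, h0⟩
  rw [map_add, ht_wt] at h1
  have : (0 : ℝ) < G.deg i := by exact_mod_cast hi
  linarith

lemma exists_hom_of_isSing {M : GMod 𝔤 A} {γ : Wt 𝔥} {v : M} (hv : G.IsSing γ v) (hv0 : v ≠ 0)
    (h : Submodule.span (Env 𝔤 A) {v} = ⊤) :
    ∃ f : M →ₗ[Env 𝔤 A] simpleL A 𝔥 𝔟 γ, Function.Surjective f := by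
  have := G.isSimpleModule_simpleL (A := A) γ
  obtain ⟨f, hf⟩ := LinearMap.exists_apply_eq_of_span h (G.topVec A γ)
    fun e he => smul_eq_zero_of_isSing hv (G.isSing_topVec γ) hv0 (G.topVec_ne_zero γ) e he
  refine ⟨f, ?_⟩
  rw [← LinearMap.range_eq_top, eq_top_iff, ← G.span_topVec, Submodule.span_singleton_le_iff_mem]
  exact ⟨_, hf⟩

include G in
/-- A proper submodule of a finitely generated module in the category `O` is contained in the
kernel of a surjection to a simple module. -/
lemma exists_simple_quotient {M : GMod 𝔤 A} (hM : catO A 𝔥 𝔟 M) [Module.Finite (Env 𝔤 A) M]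
    {N : Submodule (Env 𝔤 A) M} (hN : N ≠ ⊤) :
    ∃ (γ : Wt 𝔥) (f : M →ₗ[Env 𝔤 A] simpleL A 𝔥 𝔟 γ), Function.Surjective f ∧
      N ≤ LinearMap.ker f := by
  -- The quotient by a maximal submodule is simple and contains a singular vector, which identifies
  -- it with some L(γ).
  obtain ⟨N', hN', hle⟩ := (eq_top_or_exists_le_coatom N).resolve_left hN
  have hs : IsSimpleModule (Env 𝔤 A) (M ⧸ N') := isSimpleModule_iff_isCoatom.mpr hN'
  let Q : GMod 𝔤 A := ModuleCat.of (Env 𝔤 A) (M ⧸ N')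
  let q : M →ₗ[Env 𝔤 A] Q := N'.mkQ
  have hq : Function.Surjective q := N'.mkQ_surjective
  have hQ : catO A 𝔥 𝔟 Q := catO_of_surjective q hq hM
  have := IsSimpleModule.nontrivial (Env 𝔤 A) (M ⧸ N')
  obtain ⟨x, hx⟩ := exists_ne (0 : M ⧸ N')
  obtain ⟨γ, v, hv, hv0⟩ := G.exists_isSing hQ (m := x) hx
  have htop : Submodule.span (Env 𝔤 A) {v} = ⊤ :=
    IsSimpleModule.span_singleton_eq_top (M := M ⧸ N') _ hv0
  obtain ⟨f, hf⟩ := G.exists_hom_of_isSing hv hv0 htop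
  refine ⟨γ, f ∘ₗ q, hf.comp hq, fun m hm => ?_⟩
  have h1 : q m = 0 := (Submodule.Quotient.mk_eq_zero _).mpr (hle hm)
  rw [LinearMap.mem_ker, LinearMap.comp_apply, h1, map_zero]

end Grading

lemma isSubquotient_iff {L M : GMod 𝔤 A} [IsSimpleModule (Env 𝔤 A) L] :
    IsSubquotient L M ↔ HasFactor (Env 𝔤 A) L M := hasFactor_iff.symm

end SimpleL

end AffineO

end

/-! ### Universal modules with a vector of given weight -/

noncomputable section

namespace AffineO

section Universal

variable {𝔤 : Type u} [LieRing 𝔤] [LieAlgebra ℂ 𝔤] {𝔥 𝔟 : LieSubalgebra ℂ 𝔤}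
  [LieRing.IsNilpotent 𝔥] {A : Type u} [CommRing A] [IsNoetherianRing A] [Algebra ℂ A]
  [Algebra (SymmetricAlgebra ℂ 𝔥) A]

variable (A 𝔟) in
/-- The left ideals annihilating a vector of weight `lam` in a truncated restricted module. -/
def restrictedIdeals (J : Set (Wt 𝔥)) (lam : Wt 𝔥) : Set (Submodule (Env 𝔤 A) (Env 𝔤 A)) :=
  {I | ∃ (N : GMod 𝔤 A) (n : N), resOTrunc A 𝔥 𝔟 J N ∧ n ∈ weightSpace 𝔥 N lam ∧
    I = LinearMap.ker (LinearMap.toSpanSingleton (Env 𝔤 A) N n)}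

variable (A 𝔟) in
/-- The module representing the functor of vectors of weight `lam` on truncated restricted
modules. -/
def univMod (J : Set (Wt 𝔥)) (lam : Wt 𝔥) : GMod 𝔤 A :=
  ModuleCat.of (Env 𝔤 A) (Env 𝔤 A ⧸ sInf (restrictedIdeals 𝔟 A J lam))

variable (A 𝔟) in
/-- The universal vector. -/
def univVec (J : Set (Wt 𝔥)) (lam : Wt 𝔥) : univMod 𝔟 A J lam :=
  Submodule.Quotient.mk (1 : Env 𝔤 A)

variable {J : Set (Wt 𝔥)} {lam : Wt 𝔥}

lemma smul_univVec (e : Env 𝔤 A) :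
    e • univVec 𝔟 A J lam = (Submodule.Quotient.mk e : Env 𝔤 A ⧸ _) := by
  change Submodule.Quotient.mk (e * 1) = _
  rw [mul_one]

lemma span_univVec : Submodule.span (Env 𝔤 A) {univVec 𝔟 A J lam} = ⊤ := by
  rw [eq_top_iff]
  intro m _
  obtain ⟨e, rfl⟩ := Submodule.Quotient.mk_surjective _ m
  exact Submodule.mem_span_singleton.mpr ⟨e, smul_univVec e⟩

/-- A vector of weight `lam` is the image of the universal vector. -/
lemma exists_hom_univMod {N : GMod 𝔤 A} (hN : resOTrunc A 𝔥 𝔟 J N) {n : N}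
    (hn : n ∈ weightSpace 𝔥 N lam) :
    ∃ f : univMod 𝔟 A J lam →ₗ[Env 𝔤 A] N, f (univVec 𝔟 A J lam) = n := by
  refine LinearMap.exists_apply_eq_of_span span_univVec n fun e he => ?_
  rw [smul_univVec] at he
  have h1 := (Submodule.Quotient.mk_eq_zero _).mp he
  have h2 := (Submodule.mem_sInf.mp h1) _ ⟨N, n, hN, hn, rfl⟩
  exact h2

/-- Truncated restricted modules separate the points of the universal module. Relations valid in all
such modules therefore hold in it, in particular those making it restricted and truncated. -/
lemma exists_ne_zero_univMod {x : univMod 𝔟 A J lam} (hx : x ≠ 0) :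
    ∃ (N : GMod 𝔤 A) (f : univMod 𝔟 A J lam →ₗ[Env 𝔤 A] N), resOTrunc A 𝔥 𝔟 J N ∧
      f (univVec 𝔟 A J lam) ∈ weightSpace 𝔥 N lam ∧ f x ≠ 0 := by
  obtain ⟨e, rfl⟩ := Submodule.Quotient.mk_surjective _ x
  have h1 : e ∉ sInf (restrictedIdeals 𝔟 A J lam) := fun h =>
    hx ((Submodule.Quotient.mk_eq_zero _).mpr h)
  rw [Submodule.mem_sInf] at h1
  push Not at h1
  obtain ⟨_, ⟨N, n, hN, hn, rfl⟩, he⟩ := h1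
  obtain ⟨f, hf⟩ := exists_hom_univMod hN hn
  refine ⟨N, f, hN, by rwa [hf], fun h => he ?_⟩
  have h2 := map_smul f e (univVec 𝔟 A J lam)
  rw [smul_univVec, hf] at h2
  exact h2.symm.trans h

lemma univVec_mem : univVec 𝔟 A J lam ∈ weightSpace 𝔥 (univMod 𝔟 A J lam) lam := by
  intro H
  rw [← sub_eq_zero]
  by_contra h
  obtain ⟨N, f, -, hf, h1⟩ := exists_ne_zero_univMod h
  apply h1
  rw [map_sub, map_smul, smul_eq, map_smul, hf H, smul_eq, sub_self]

variable (G : Grading 𝔥 𝔟)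

include G in
-- Local boundedness leaves only finitely many words of positive degree that can act nontrivially on
-- the universal vector. Their values span a 𝔟̂-stable A-submodule that generates the module.
lemma univMod_spec (hJ : IsLocallyBoundedWt 𝔥 𝔟 J) :
    resOTrunc A 𝔥 𝔟 J (univMod 𝔟 A J lam) ∧ ∀ μ, (weightSpace 𝔥 (univMod 𝔟 A J lam) μ).FG := by
  obtain ⟨c, hc⟩ := ((hJ lam).image G.ht).bddAbove
  have hc' (γ : Wt 𝔥) (h : γ ∈ J) (hγ : WtLE 𝔥 𝔟 lam γ) : G.ht γ ≤ c := hc ⟨γ, ⟨h, hγ⟩, rfl⟩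
  -- The maximum with 0 keeps the empty word in `S` even if no weight of `J` lies above `lam`.
  let S : Set (List G.ι) := {w | (∀ i ∈ w, 0 < G.deg i) ∧ G.ht (G.wtW w) ≤ max (c - G.ht lam) 0}
  have : Finite S := G.finite_pos_words _
  let q := univVec 𝔟 A J lam
  let s : S → univMod 𝔟 A J lam := fun w => G.word A w.1 • q
  let wt : S → Wt 𝔥 := fun w => G.wtW w.1 + lam
  have hwt (w : S) : s w ∈ weightSpace 𝔥 (univMod 𝔟 A J lam) (wt w) :=
    G.word_mem_weightSpace _ univVec_mem
  have hzero {w : List G.ι} (hw : G.wtW w + lam ∉ J) : G.word A w • q = 0 := by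
    by_contra h
    obtain ⟨N, f, hN, hf, h1⟩ := exists_ne_zero_univMod h
    rw [map_smul] at h1
    exact hw (hN.2 _ ((Submodule.ne_bot_iff _).mpr ⟨_, G.word_mem_weightSpace w hf, h1⟩))
  have hs (w : S) (x : Affine 𝔤) (hx : x ∈ borelHat 𝔟) :
      act A x • s w ∈ Submodule.span A (Set.range s) := by
    refine G.borel_smul_mem _ (fun i hi => ?_) hx
    rcases hi.eq_or_lt with hi | hi
    · obtain ⟨a, ha⟩ := G.act_zero_smul hi.symm (hwt w)
      rw [ha]
      exact Submodule.smul_mem _ _ (Submodule.subset_span ⟨w, rfl⟩)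
    · have h1 : act A (G.vec i) • s w = G.word A (i :: w.1) • q := by
        rw [G.word_cons, mul_smul]
      have h2 : ∀ j ∈ i :: w.1, 0 < G.deg j := by
        intro j hj
        rcases List.mem_cons.mp hj with rfl | hj
        exacts [hi, w.2.1 j hj]
      rw [h1]
      by_cases h3 : G.wtW (i :: w.1) + lam ∈ J
      · refine Submodule.subset_span ⟨⟨i :: w.1, h2, ?_⟩, rfl⟩
        have h4 := hc' _ h3 (by
          rw [WtLE, add_sub_cancel_right]
          exact G.wtW_mem h2)
        rw [map_add] at h4
        exact le_max_of_le_left (by linarith)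
      · rw [hzero h3]
        exact Submodule.zero_mem _
  have htop : Submodule.span (Env 𝔤 A) (Set.range s) = ⊤ := by
    rw [eq_top_iff, ← span_univVec, Submodule.span_singleton_le_iff_mem]
    refine Submodule.subset_span ⟨⟨[], by simp, by simp⟩, ?_⟩
    change G.word A [] • q = q
    rw [G.word_nil, one_smul]
  have hO := G.catO_of_span_eq_top s wt hs hwt htop
  refine ⟨⟨resO_of_separating hO fun m hm => ?_, fun μ hμ => ?_⟩,
    G.fg_weightSpace s wt hs hwt htop⟩
  · obtain ⟨N, f, hN, -, h1⟩ := exists_ne_zero_univMod hm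
    exact ⟨N, f, hN.1, h1⟩
  · obtain ⟨x, hx, hx0⟩ := (Submodule.ne_bot_iff _).mp hμ
    obtain ⟨N, f, hN, -, h1⟩ := exists_ne_zero_univMod hx0
    exact hN.2 _ ((Submodule.ne_bot_iff _).mpr ⟨_, map_mem_weightSpace f hx, h1⟩)

end Universal

/-! ### Projectivity and projective covers -/

section Covers

variable {𝔤 : Type u} [LieRing 𝔤] [LieAlgebra ℂ 𝔤] {𝔥 𝔟 : LieSubalgebra ℂ 𝔤}
  [LieRing.IsNilpotent 𝔥] {A : Type u} [CommRing A] [IsNoetherianRing A] [IsLocalRing A]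
  [Algebra ℂ A] [Algebra (SymmetricAlgebra ℂ 𝔥) A]

/-- Projective covers of simple modules, in terms of elements. -/
structure IsCover (𝔟 : LieSubalgebra ℂ 𝔤) (J : Set (Wt 𝔥)) (γ : Wt 𝔥) (P : GMod 𝔤 A)
    (c : P →ₗ[Env 𝔤 A] simpleL A 𝔥 𝔟 γ) : Prop where
  mem : resOTrunc A 𝔥 𝔟 J P
  surjective : Function.Surjective c
  lift : ∀ (M N : GMod 𝔤 A) (p : M →ₗ[Env 𝔤 A] N) (f : P →ₗ[Env 𝔤 A] N),
    resOTrunc A 𝔥 𝔟 J M → Function.Surjective p → ∃ g : P →ₗ[Env 𝔤 A] M, p ∘ₗ g = f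
  essential : ∀ N : Submodule (Env 𝔤 A) P, N.map c = ⊤ → N = ⊤

variable {J : Set (Wt 𝔥)}

/-- Maps from the universal module are vectors of weight `lam`, and these lift along surjections. -/
lemma exists_lift_univMod {lam : Wt 𝔥} {M N : GMod 𝔤 A} (p : M →ₗ[Env 𝔤 A] N)
    (hp : Function.Surjective p) (hM : resOTrunc A 𝔥 𝔟 J M)
    (f : univMod 𝔟 A J lam →ₗ[Env 𝔤 A] N) :
    ∃ g : univMod 𝔟 A J lam →ₗ[Env 𝔤 A] M, p ∘ₗ g = f := by
  obtain ⟨m, hm, hmn⟩ := exists_mem_weightSpace_of_surjective hM.1.1.1 p hp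
    (map_mem_weightSpace f univVec_mem)
  obtain ⟨g, hg⟩ := exists_hom_univMod hM hm
  refine ⟨g, ?_⟩
  refine LinearMap.ext_on span_univVec fun x hx => ?_
  rw [Set.mem_singleton_iff.mp hx, LinearMap.comp_apply, hg, hmn]

variable [IsScalarTower ℂ (SymmetricAlgebra ℂ 𝔥) A] (G : Grading 𝔥 𝔟)

include G in
/-- A projective cover of a simple module has no maps to other simple modules. -/
lemma IsCover.eq_zero {γ lam : Wt 𝔥} {P : GMod 𝔤 A} {c : P →ₗ[Env 𝔤 A] simpleL A 𝔥 𝔟 γ}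
    (hc : IsCover 𝔟 J γ P c) (h : lam ≠ γ) (f : P →ₗ[Env 𝔤 A] simpleL A 𝔥 𝔟 lam) : f = 0 := by
  have hγ := G.isSimpleModule_simpleL (A := A) γ
  have hlam := G.isSimpleModule_simpleL (A := A) lam
  by_contra h0
  have hf : Function.Surjective f := (LinearMap.surjective_or_eq_zero f).resolve_right h0
  -- If ker f mapped onto L(γ), it would be everything by essentiality. By simplicity it maps to
  -- zero, so c factors through f and gives a nonzero map between different simple modules.
  have h1 : (LinearMap.ker f).map c ≠ ⊤ := fun h1 =>
    h0 (LinearMap.ker_eq_top.mp (hc.essential _ h1))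
  have h2 : (LinearMap.ker f).map c = ⊥ := (eq_bot_or_eq_top _).resolve_right h1
  have h3 : LinearMap.ker f ≤ LinearMap.ker c := by
    intro x hx
    have h4 : c x ∈ (LinearMap.ker f).map c := ⟨x, hx, rfl⟩
    rwa [h2, Submodule.mem_bot] at h4
  let g := (LinearMap.ker f).liftQ c h3 ∘ₗ (f.quotKerEquivOfSurjective hf).symm.toLinearMap
  refine h (G.eq_of_hom_simpleL (A := A) g fun hg => ?_)
  obtain ⟨x, hx⟩ := hc.surjective (G.topVec A γ)
  apply G.topVec_ne_zero (A := A) γ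
  rw [← hx]
  have h4 : g (f x) = c x := by
    have h5 : (f.quotKerEquivOfSurjective hf).symm (f x) = Submodule.Quotient.mk x := by
      rw [LinearEquiv.symm_apply_eq]
      rfl
    change (LinearMap.ker f).liftQ c h3 ((f.quotKerEquivOfSurjective hf).symm (f x)) = c x
    rw [h5]
    rfl
  rw [← h4, hg]
  rfl

/-- A retract of the universal module has the lifting property. -/
lemma exists_lift_of_retract {lam : Wt 𝔥} {P : GMod 𝔤 A}
    (r : univMod 𝔟 A J lam →ₗ[Env 𝔤 A] P) (i : P →ₗ[Env 𝔤 A] univMod 𝔟 A J lam)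
    (hri : r ∘ₗ i = LinearMap.id) {M N : GMod 𝔤 A} (p : M →ₗ[Env 𝔤 A] N)
    (f : P →ₗ[Env 𝔤 A] N) (hM : resOTrunc A 𝔥 𝔟 J M) (hp : Function.Surjective p) :
    ∃ g : P →ₗ[Env 𝔤 A] M, p ∘ₗ g = f := by
  obtain ⟨g, hg⟩ := exists_lift_univMod p hp hM (f ∘ₗ r)
  refine ⟨g ∘ₗ i, ?_⟩
  rw [← LinearMap.comp_assoc, hg, LinearMap.comp_assoc, hri, LinearMap.comp_id]

end Covers

end AffineO

end

/-! ### Existence of projective covers -/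

noncomputable section

namespace AffineO

section Existence

variable {𝔤 : Type u} [LieRing 𝔤] [LieAlgebra ℂ 𝔤] {𝔥 𝔟 : LieSubalgebra ℂ 𝔤}
  [LieRing.IsNilpotent 𝔥] {A : Type u} [CommRing A] [IsNoetherianRing A] [IsLocalRing A]
  [Algebra ℂ A] [Algebra (SymmetricAlgebra ℂ 𝔥) A]

/-- Among the idempotent endomorphisms over a given map there is one whose kernel has a maximal
weight space. -/
lemma exists_maximal_idempotent {J : Set (Wt 𝔥)} {lam : Wt 𝔥} {L : GMod 𝔤 A}
    (hfg : (weightSpace 𝔥 (univMod 𝔟 A J lam) lam).FG)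
    (c : univMod 𝔟 A J lam →ₗ[Env 𝔤 A] L) :
    ∃ e : univMod 𝔟 A J lam →ₗ[Env 𝔤 A] univMod 𝔟 A J lam, (e ∘ₗ e = e ∧ c ∘ₗ e = c) ∧
      ∀ e' : univMod 𝔟 A J lam →ₗ[Env 𝔤 A] univMod 𝔟 A J lam, e' ∘ₗ e' = e' → c ∘ₗ e' = c →
        (∀ x, e x = 0 → e' x = 0) →
        ∀ x ∈ weightSpace 𝔥 (univMod 𝔟 A J lam) lam, e' x = 0 → e x = 0 := by
  let Q := univMod 𝔟 A J lam
  let W := weightSpace 𝔥 Q lam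
  have : IsNoetherian A W := isNoetherian_of_fg_of_noetherian W hfg
  -- Only the kernel on the weight space of the generator is compared: it is a submodule of a
  -- Noetherian A-module.
  let κ (e : Q →ₗ[Env 𝔤 A] Q) : Submodule A W :=
    LinearMap.ker ((e.restrictScalars A : Q →ₗ[A] Q) ∘ₗ W.subtype)
  let S : Set (Submodule A W) := κ '' {e | e ∘ₗ e = e ∧ c ∘ₗ e = c}
  obtain ⟨_, ⟨e, he, rfl⟩, hmax⟩ := set_has_maximal_iff_noetherian.mpr ‹IsNoetherian A W› S
    ⟨_, LinearMap.id, ⟨rfl, rfl⟩, rfl⟩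
  refine ⟨e, he, fun e' h1 h2 hle x hx hx' => ?_⟩
  have h3 : κ e ≤ κ e' := fun y hy => hle _ hy
  have h4 := hmax _ ⟨e', ⟨h1, h2⟩, rfl⟩
  have h5 : κ e' ≤ κ e := by
    by_contra h5
    exact h4 (lt_of_le_not_ge h3 h5)
  exact h5 (x := ⟨x, hx⟩) hx'

variable [IsScalarTower ℂ (SymmetricAlgebra ℂ 𝔥) A] (G : Grading 𝔥 𝔟)

include G in
/-- If a retract of the universal module maps onto another simple module, then a bigger part of the
universal module splits off. -/
lemma exists_idempotent_of_cover {J : Set (Wt 𝔥)} {lam γ : Wt 𝔥} (hγ : lam ≠ γ) {P P' : GMod 𝔤 A}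
    (r : univMod 𝔟 A J lam →ₗ[Env 𝔤 A] P) (i : P →ₗ[Env 𝔤 A] univMod 𝔟 A J lam)
    (hri : r ∘ₗ i = LinearMap.id) (hP : resOTrunc A 𝔥 𝔟 J P)
    (c : univMod 𝔟 A J lam →ₗ[Env 𝔤 A] simpleL A 𝔥 𝔟 lam) (hc : c ∘ₗ (i ∘ₗ r) = c)
    {c' : P' →ₗ[Env 𝔤 A] simpleL A 𝔥 𝔟 γ} (hc' : IsCover 𝔟 J γ P' c')
    (f : P →ₗ[Env 𝔤 A] simpleL A 𝔥 𝔟 γ) (hf : Function.Surjective f) :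
    ∃ e : univMod 𝔟 A J lam →ₗ[Env 𝔤 A] univMod 𝔟 A J lam, e ∘ₗ e = e ∧ c ∘ₗ e = c ∧
      (∀ x, (i ∘ₗ r) x = 0 → e x = 0) ∧
      ∃ x ∈ weightSpace 𝔥 (univMod 𝔟 A J lam) lam, e x = 0 ∧ (i ∘ₗ r) x ≠ 0 := by
  -- The map f lifts to P → P', which is surjective because c' is essential, and splits because P'
  -- is projective. Thus P' is a summand of P.
  obtain ⟨g, hg⟩ := exists_lift_of_retract r i hri c' f hc'.mem hc'.surjective
  have hg' : Function.Surjective g := by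
    rw [← LinearMap.range_eq_top]
    refine hc'.essential _ ?_
    rw [← LinearMap.range_comp, hg, LinearMap.range_eq_top]
    exact hf
  obtain ⟨s, hs⟩ := hc'.lift P P' g LinearMap.id hP hg'
  have hri' (x : P) : r (i x) = x := LinearMap.congr_fun hri x
  have hs' (x : P') : g (s x) = x := LinearMap.congr_fun hs x
  -- The cover of L(γ) has no nonzero map to L(lam), so removing it does not change `c`.
  have hc0 (x : P') : c (i (s x)) = 0 :=
    LinearMap.congr_fun (hc'.eq_zero G hγ (c ∘ₗ i ∘ₗ s)) x
  -- The new idempotent cuts the summand P' out of P. The component of the universal vector in P'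
  -- witnesses that the kernel grows: it is nonzero because f is, and the old idempotent fixes it.
  refine ⟨i ∘ₗ r - i ∘ₗ s ∘ₗ g ∘ₗ r, ?_, ?_, ?_, i (s (g (r (univVec 𝔟 A J lam)))), ?_, ?_, ?_⟩
  · ext x
    simp [hri', hs']
  · ext x
    have h1 : c (i (r x)) = c x := LinearMap.congr_fun hc x
    simp [h1, hc0]
  · intro x hx
    have h1 : r x = 0 := by
      rw [← hri' (r x)]
      exact (congrArg r hx).trans (map_zero r)
    simp [h1]
  · exact map_mem_weightSpace i (map_mem_weightSpace s (map_mem_weightSpace g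
      (map_mem_weightSpace r univVec_mem)))
  · simp [hri', hs']
  · intro h
    have h1 : g (r (univVec 𝔟 A J lam)) = 0 := by
      have h2 : i (r (i (s (g (r (univVec 𝔟 A J lam)))))) = 0 := h
      rw [hri'] at h2
      have h3 := congrArg (fun x => g (r x)) h2
      simpa [hri', hs'] using h3
    have h2 : f ∘ₗ r = 0 := by
      refine LinearMap.ext_on span_univVec fun x hx => ?_
      rw [Set.mem_singleton_iff.mp hx, LinearMap.comp_apply, ← hg, LinearMap.comp_apply, h1,
        map_zero, LinearMap.zero_apply]
    obtain ⟨y, hy⟩ := hf (G.topVec A γ)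
    refine G.topVec_ne_zero (A := A) γ ?_
    rw [← hy, ← hri' y]
    exact LinearMap.congr_fun h2 (i y)

include G in
-- The cover is the image of an idempotent of the universal module over L(lam) with maximal kernel.
-- If it were not essential, it would have a second simple quotient: L(lam) again is impossible
-- since the vectors generating it are multiples of one vector, and L(γ) with γ above lam would
-- allow a larger kernel.
theorem exists_isCover {J : Set (Wt 𝔥)} (hJ : IsOpenWt 𝔥 𝔟 J) (hJ' : IsLocallyBoundedWt 𝔥 𝔟 J)
    {lam : Wt 𝔥} (hlam : lam ∈ J) :
    ∃ (P : GMod 𝔤 A) (c : P →ₗ[Env 𝔤 A] simpleL A 𝔥 𝔟 lam), IsCover 𝔟 J lam P c := by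
  obtain ⟨n, hn⟩ : ∃ n, {ν ∈ J | WtLE 𝔥 𝔟 lam ν}.ncard = n := ⟨_, rfl⟩
  induction n using Nat.strong_induction_on generalizing lam with
  | _ n ih =>
    let Q := univMod 𝔟 A J lam
    obtain ⟨hQ, hfg⟩ := univMod_spec (A := A) (lam := lam) G hJ'
    obtain ⟨c₀, hc₀⟩ := exists_hom_univMod (G.resOTrunc_simpleL (A := A) hJ hlam)
      (G.isSing_topVec lam).mem
    obtain ⟨e, ⟨he, hce⟩, hmax⟩ := exists_maximal_idempotent (hfg lam) c₀
    let P : GMod 𝔤 A := ModuleCat.of (Env 𝔤 A) (LinearMap.range e)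
    let i : P →ₗ[Env 𝔤 A] Q := (LinearMap.range e).subtype
    let r : Q →ₗ[Env 𝔤 A] P := e.rangeRestrict
    have hi : Function.Injective i := (LinearMap.range e).injective_subtype
    have hr : Function.Surjective r := e.surjective_rangeRestrict
    have hir : i ∘ₗ r = e := rfl
    have hri : r ∘ₗ i = LinearMap.id := by
      refine LinearMap.ext fun x => hi ?_
      obtain ⟨y, rfl⟩ := hr x
      exact LinearMap.congr_fun he y
    have hP : resOTrunc A 𝔥 𝔟 J P := resOTrunc_of_injective i hi hQ
    have hfin : Module.Finite (Env 𝔤 A) P :=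
      ⟨⟨{r (univVec 𝔟 A J lam)}, by
        rw [Finset.coe_singleton, ← Set.image_singleton, ← Submodule.map_span, span_univVec,
          Submodule.map_top, LinearMap.range_eq_top]
        exact hr⟩⟩
    refine ⟨P, c₀ ∘ₗ i, hP, ?_, fun M N p f hM hp => exists_lift_of_retract r i hri p f hM hp, ?_⟩
    · rw [← LinearMap.range_eq_top, eq_top_iff, ← G.span_topVec,
        Submodule.span_singleton_le_iff_mem]
      refine ⟨r (univVec 𝔟 A J lam), ?_⟩
      exact (LinearMap.congr_fun hce (univVec 𝔟 A J lam)).trans hc₀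
    · intro N hN
      by_contra hN'
      obtain ⟨γ, f, hf, hle⟩ := G.exists_simple_quotient hP.1.1 hN'
      have hfr : f (r (univVec 𝔟 A J lam)) ∈ weightSpace 𝔥 (simpleL A 𝔥 𝔟 γ) lam :=
        map_mem_weightSpace f (map_mem_weightSpace r univVec_mem)
      have hfr0 : f (r (univVec 𝔟 A J lam)) ≠ 0 := by
        intro h0
        have h1 : f ∘ₗ r = 0 := by
          refine LinearMap.ext_on span_univVec fun x hx => ?_
          rw [Set.mem_singleton_iff.mp hx]
          exact h0
        obtain ⟨x, hx⟩ := hf (G.topVec A γ)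
        obtain ⟨y, rfl⟩ := hr x
        exact G.topVec_ne_zero (A := A) γ (hx.symm.trans (LinearMap.congr_fun h1 y))
      by_cases hγ : lam = γ
      · subst hγ
        obtain ⟨a, ha⟩ := (G.isSing_topVec (A := A) lam).exists_smul
          (by rw [G.span_topVec]; trivial) hfr
        -- Both maps send the universal vector into the highest weight space A · `topVec`, so f ∘ r
        -- is a multiple of `c₀`; but f vanishes on N, which `c₀` maps onto L(lam).
        have h1 (x : Q) : f (r x) = a • c₀ x := by
          obtain ⟨d, rfl⟩ := Submodule.mem_span_singleton.mp
            (show x ∈ Submodule.span (Env 𝔤 A) {univVec 𝔟 A J lam} by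
              rw [span_univVec]; trivial)
          rw [map_smul, map_smul, map_smul, hc₀, ← ha, smul_comm]
        obtain ⟨y, hy, hy'⟩ := (Submodule.mem_map.mp
          (show G.topVec A lam ∈ N.map (c₀ ∘ₗ i) by rw [hN]; trivial))
        have h2 := h1 (i y)
        rw [show r (i y) = y from LinearMap.congr_fun hri y, show c₀ (i y) = _ from hy',
          show f y = 0 from hle hy] at h2
        exact hfr0 (ha.symm.trans h2.symm)
      · have hlt : WtLE 𝔥 𝔟 lam γ := G.wtLE_of_simpleL hfr hfr0
        have hγJ : γ ∈ J := by
          obtain ⟨x, hx, hx'⟩ := exists_mem_weightSpace_of_surjective hP.1.1.1 f hf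
            (G.isSing_topVec (A := A) γ).mem
          refine hP.2 γ ((Submodule.ne_bot_iff _).mpr ⟨x, hx, fun h0 => ?_⟩)
          rw [h0, map_zero] at hx'
          exact G.topVec_ne_zero (A := A) γ hx'.symm
        -- Strictly fewer weights of `J` lie above γ than above `lam`: the weight `lam` itself is
        -- lost.
        obtain ⟨P', c', hc'⟩ := ih _ (by
          rw [← hn]
          refine Set.ncard_lt_ncard ⟨fun ν hν => ⟨hν.1, hlt.trans hν.2⟩, fun h => ?_⟩ (hJ' lam)
          exact hγ (G.antisymm hlt (h ⟨hlam, WtLE.refl lam⟩).2)) hγJ rfl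
        obtain ⟨e', h1, h2, h3, x, hx, hx', hx0⟩ := exists_idempotent_of_cover G hγ r i hri hP c₀
          hce hc' f hf
        exact hx0 (hmax e' h1 h2 h3 x hx hx')

end Existence

end AffineO

end

/-! ### The block decomposition -/

noncomputable section

lemma HasFactor.exists_of_coe_iSup {R L M κ : Type*} [Ring R] [AddCommGroup L] [Module R L]
    [AddCommGroup M] [Module R M] {S : κ → Submodule R M}
    (h : HasFactor R L (⨆ i, S i : Submodule R M)) : ∃ i, HasFactor R L (S i) := by
  obtain ⟨⟨x, hx⟩, l, hl, hxl⟩ := h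
  classical
  obtain ⟨f, hf, rfl⟩ := (Submodule.mem_iSup_iff_exists_finsupp _ _).mp hx
  exact HasFactor.exists_of_sum f.support f hf l hl fun e he => hxl e (Subtype.ext he)

lemma HasFactor.mono {R L M : Type*} [Ring R] [AddCommGroup L] [Module R L]
    [AddCommGroup M] [Module R M] {S T : Submodule R M} (h : HasFactor R L S) (hST : S ≤ T) :
    HasFactor R L T :=
  h.of_injective (Submodule.inclusion hST) (Submodule.inclusion_injective hST)

namespace AffineO

section Linkage

variable {𝔤 : Type u} [LieRing 𝔤] [LieAlgebra ℂ 𝔤] {𝔥 𝔟 : LieSubalgebra ℂ 𝔤}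
  [LieRing.IsNilpotent 𝔥] {A : Type u} [CommRing A] [IsNoetherianRing A] [IsLocalRing A]
  [Algebra ℂ A] [Algebra (SymmetricAlgebra ℂ 𝔥) A]

/-- The truncated restricted category is closed under quotients, so the cokernel can be tested
inside it. -/
lemma surjective_of_epi {J : Set (Wt 𝔥)} {M N : (resOTrunc A 𝔥 𝔟 J).FullSubcategory}
    (e : M ⟶ N) [Epi e] : Function.Surjective e.hom.hom := by
  let R := LinearMap.range e.hom.hom
  let C : (resOTrunc A 𝔥 𝔟 J).FullSubcategory := ⟨ModuleCat.of (Env 𝔤 A) (N.obj ⧸ R),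
    resOTrunc_of_surjective (N := ModuleCat.of (Env 𝔤 A) (N.obj ⧸ R)) R.mkQ R.mkQ_surjective
      N.property⟩
  let q : N ⟶ C := ObjectProperty.homMk (ModuleCat.ofHom R.mkQ)
  let z : N ⟶ C := ObjectProperty.homMk (ModuleCat.ofHom 0)
  have h : e ≫ q = e ≫ z := by
    apply ObjectProperty.hom_ext
    apply ModuleCat.hom_ext
    refine LinearMap.ext fun x => ?_
    exact (Submodule.Quotient.mk_eq_zero _).mpr ⟨x, rfl⟩
  have h1 : q = z := (cancel_epi e).mp h
  have h2 : R.mkQ = 0 := congrArg (fun g => g.hom.hom) h1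
  rw [← LinearMap.range_eq_top]
  have h3 := congrArg LinearMap.ker h2
  rwa [Submodule.ker_mkQ, LinearMap.ker_zero] at h3

/-- A linear map as a morphism. -/
def toHom {M N : GMod 𝔤 A} (f : M →ₗ[Env 𝔤 A] N) : M ⟶ N := ModuleCat.ofHom f

lemma IsCover.isProjectiveCover {J : Set (Wt 𝔥)} {γ : Wt 𝔥} {P : GMod 𝔤 A}
    {c : P →ₗ[Env 𝔤 A] simpleL A 𝔥 𝔟 γ} (hc : IsCover 𝔟 J γ P c)
    (hL : resOTrunc A 𝔥 𝔟 J (simpleL A 𝔥 𝔟 γ)) :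
    IsProjectiveCover (P := ⟨P, hc.mem⟩) (L := ⟨simpleL A 𝔥 𝔟 γ, hL⟩)
      (ObjectProperty.homMk (toHom (M := P) (N := simpleL A 𝔥 𝔟 γ) c)) := by
  refine ⟨⟨fun {N M} f e he => ?_⟩, hc.surjective, fun M g hg => ?_⟩
  · obtain ⟨g, hg⟩ := hc.lift N.obj M.obj e.hom.hom f.hom.hom N.property (surjective_of_epi e)
    refine ⟨ObjectProperty.homMk (ModuleCat.ofHom g), ?_⟩
    apply ObjectProperty.hom_ext
    apply ModuleCat.hom_ext
    exact hg
  · rw [← LinearMap.range_eq_top]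
    refine hc.essential _ ?_
    have h1 : (c ∘ₗ g.hom.hom).range = ⊤ := LinearMap.range_eq_top.mpr hg
    rwa [LinearMap.range_comp] at h1

variable [IsScalarTower ℂ (SymmetricAlgebra ℂ 𝔥) A] (G : Grading 𝔥 𝔟)

include G in
lemma IsCover.mk_eq {J : Set (Wt 𝔥)} (hJ : IsOpenWt 𝔥 𝔟 J) (hJ' : IsLocallyBoundedWt 𝔥 𝔟 J)
    {γ μ : Wt 𝔥} (hγ : γ ∈ J) {P : GMod 𝔤 A} {c : P →ₗ[Env 𝔤 A] simpleL A 𝔥 𝔟 γ}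
    (hc : IsCover 𝔟 J γ P c) (h : HasFactor (Env 𝔤 A) (simpleL A 𝔥 𝔟 μ) P) :
    Quotient.mk (resSetoid A 𝔥 𝔟) μ = Quotient.mk (resSetoid A 𝔥 𝔟) γ := by
  have := G.isSimpleModule_simpleL (A := A) μ
  refine (Quotient.sound (Relation.EqvGen.rel _ _ ?_)).symm
  exact ⟨J, hJ, hJ', hγ, G.resOTrunc_simpleL hJ hγ, ⟨P, hc.mem⟩, _, hc.isProjectiveCover _,
    isSubquotient_iff.mpr h⟩

/-- The submodule generated by the images of the projective covers attached to an equivalence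
class. -/
def blockPart (M : GMod 𝔤 A) (Λ : Quotient (resSetoid A 𝔥 𝔟)) : Submodule (Env 𝔤 A) M :=
  sSup {R | ∃ (J : Set (Wt 𝔥)) (γ : Wt 𝔥) (P : GMod 𝔤 A)
    (c : P →ₗ[Env 𝔤 A] simpleL A 𝔥 𝔟 γ) (f : P →ₗ[Env 𝔤 A] M), IsOpenWt 𝔥 𝔟 J ∧
    IsLocallyBoundedWt 𝔥 𝔟 J ∧ γ ∈ J ∧ IsCover 𝔟 J γ P c ∧ Quotient.mk (resSetoid A 𝔥 𝔟) γ = Λ ∧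
    R = LinearMap.range f}

variable {M : GMod 𝔤 A}

include G in
lemma mk_eq_of_hasFactor_blockPart {Λ : Quotient (resSetoid A 𝔥 𝔟)} {μ : Wt 𝔥}
    (h : HasFactor (Env 𝔤 A) (simpleL A 𝔥 𝔟 μ) (blockPart M Λ)) :
    Quotient.mk (resSetoid A 𝔥 𝔟) μ = Λ := by
  rw [blockPart, sSup_eq_iSup'] at h
  obtain ⟨⟨_, J, γ, P, c, f, hJ, hJ', hγ, hc, rfl, rfl⟩, h⟩ := h.exists_of_coe_iSup
  exact hc.mk_eq G hJ hJ' hγ (h.of_surjective f.rangeRestrict f.surjective_rangeRestrict)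

include G in
/-- A nonzero submodule of a module in the category `O` has a simple factor. -/
lemma exists_hasFactor (hM : catO A 𝔥 𝔟 M) {S : Submodule (Env 𝔤 A) M} (hS : S ≠ ⊥) :
    ∃ γ, HasFactor (Env 𝔤 A) (simpleL A 𝔥 𝔟 γ) S := by
  obtain ⟨x, hx, hx0⟩ := S.ne_bot_iff.mp hS
  have hS' : catO A 𝔥 𝔟 (ModuleCat.of (Env 𝔤 A) S) :=
    catO_of_injective (M := ModuleCat.of (Env 𝔤 A) S) S.subtype S.injective_subtype hM
  obtain ⟨γ, v, hv, hv0⟩ := G.exists_isSing hS' (m := (⟨x, hx⟩ : S))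
    (fun h => hx0 (congrArg Subtype.val h))
  have := G.isSimpleModule_simpleL (A := A) γ
  exact ⟨γ, v, G.topVec A γ, G.topVec_ne_zero γ,
    fun e he => smul_eq_zero_of_isSing hv (G.isSing_topVec γ) hv0 (G.topVec_ne_zero γ) e he⟩

include G in
-- A nonzero intersection of one part with the sum of the others would have a simple factor
-- belonging to two classes.
lemma blockPart_indep (hM : catO A 𝔥 𝔟 M) :
    iSupIndep fun Λ : Quotient (resSetoid A 𝔥 𝔟) => blockPart M Λ := by
  intro Λ
  rw [disjoint_iff]
  by_contra h
  obtain ⟨γ, hγ⟩ := exists_hasFactor G hM h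
  have h1 := mk_eq_of_hasFactor_blockPart G (hγ.mono inf_le_left)
  have h2 := hγ.mono inf_le_right
  rw [iSup_subtype'] at h2
  obtain ⟨⟨Λ', hΛ'⟩, h3⟩ := h2.exists_of_coe_iSup
  exact hΛ' ((mk_eq_of_hasFactor_blockPart G h3).symm.trans h1)

include G in
/-- A weight vector generates a module whose weights lie in an open and locally bounded set. -/
lemma exists_open_of_mem (hM : catO A 𝔥 𝔟 M) (m : M) :
    ∃ J : Set (Wt 𝔥), IsOpenWt 𝔥 𝔟 J ∧ IsLocallyBoundedWt 𝔥 𝔟 J ∧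
      ∀ μ, ∀ x ∈ Submodule.span (Env 𝔤 A) {m}, x ∈ weightSpace 𝔥 M μ → x ≠ 0 → μ ∈ J := by
  obtain ⟨B, hmB, hB, hst⟩ := hM.2 m
  obtain ⟨T, hT, hT1, hT2⟩ := exists_finite_weight_span hM.1 hB
    fun H x hx => hst _ (G.cartanIncl_mem H) x hx
  have hrange : Set.range (fun p : T => p.1.2) = Prod.snd '' T := by
    ext x
    simp
  refine ⟨{μ | ∃ lam ∈ Prod.fst '' T, WtLE 𝔥 𝔟 μ lam}, Grading.isOpenWt_below _,
    G.isLocallyBoundedWt_below (hT.image _), fun μ x hx hμ h0 => ?_⟩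
  have hx' : x ∈ Submodule.span (Env 𝔤 A) (Set.range fun p : T => p.1.2) := by
    refine (Submodule.span_singleton_le_iff_mem m _).mpr ?_ hx
    rw [← hT2] at hmB
    rw [hrange]
    exact Submodule.span_le_restrictScalars A (Env 𝔤 A) _ hmB
  obtain ⟨p, hp⟩ := G.exists_wtLE (fun p : T => p.1.2) (fun p => p.1.1)
    (fun p x hx => by
      rw [hrange, hT2]
      exact hst x hx _ (hT1 p.1 p.2).2)
    (fun p => (hT1 p.1 p.2).1) hx' hμ h0
  exact ⟨_, ⟨p.1, p.2, rfl⟩, hp⟩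

include G in
-- An element outside the sum would give the module it generates a simple quotient that kills the
-- intersection with the sum; the projective cover of that quotient maps into the intersection, yet
-- onto the quotient.
lemma iSup_blockPart (hM : resO A 𝔥 𝔟 M) :
    ⨆ Λ : Quotient (resSetoid A 𝔥 𝔟), blockPart M Λ = ⊤ := by
  rw [eq_top_iff]
  intro m _
  set M' := ⨆ Λ : Quotient (resSetoid A 𝔥 𝔟), blockPart M Λ with hM'
  obtain ⟨J, hJ, hJ', hw⟩ := exists_open_of_mem G hM.1 m
  let U : GMod 𝔤 A := ModuleCat.of (Env 𝔤 A) (Submodule.span (Env 𝔤 A) {m})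
  let i : U →ₗ[Env 𝔤 A] M := (Submodule.span (Env 𝔤 A) {m}).subtype
  have hi : Function.Injective i := Submodule.injective_subtype _
  have hwU (μ : Wt 𝔥) (x : U) (hx : x ∈ weightSpace 𝔥 U μ) (h0 : x ≠ 0) : μ ∈ J :=
    hw μ (i x) x.2 (map_mem_weightSpace i hx) ((map_ne_zero_iff i hi).mpr h0)
  have hU : resOTrunc A 𝔥 𝔟 J U := by
    refine ⟨resO_of_injective i hi hM, fun μ hμ => ?_⟩
    obtain ⟨x, hx, h0⟩ := (Submodule.ne_bot_iff _).mp hμ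
    exact hwU μ x hx h0
  have hfin : Module.Finite (Env 𝔤 A) U :=
    Module.Finite.span_singleton (Env 𝔤 A) m
  by_contra hm
  have hne : M'.comap i ≠ ⊤ := by
    intro h
    apply hm
    have h1 : (⟨m, Submodule.mem_span_singleton_self m⟩ : U) ∈ M'.comap i := by
      rw [h]
      trivial
    exact h1
  obtain ⟨γ, f, hf, hle⟩ := G.exists_simple_quotient hU.1.1 hne
  obtain ⟨x, hx, hxγ⟩ := exists_mem_weightSpace_of_surjective hU.1.1.1 f hf
    (G.isSing_topVec (A := A) γ).mem
  have hγ : γ ∈ J := hwU γ x hx fun h0 => by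
    rw [h0, map_zero] at hxγ
    exact G.topVec_ne_zero (A := A) γ hxγ.symm
  obtain ⟨P, c, hc⟩ := exists_isCover (A := A) G hJ hJ' hγ
  obtain ⟨g, hg⟩ := hc.lift U _ f c hU hf
  obtain ⟨y, hy⟩ := hc.surjective (G.topVec A γ)
  apply G.topVec_ne_zero (A := A) γ
  rw [← hy, ← hg]
  refine hle (x := g y) ?_
  have h1 : LinearMap.range (i ∘ₗ g) ≤ M' := by
    refine le_trans ?_ (le_iSup (fun Λ => blockPart M Λ) (Quotient.mk (resSetoid A 𝔥 𝔟) γ))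
    exact le_sSup ⟨J, γ, P, c, _, hJ, hJ', hγ, hc, rfl, rfl⟩
  exact h1 ⟨y, rfl⟩

include G in
lemma resBlock_blockPart (hM : resO A 𝔥 𝔟 M) (Λ : Quotient (resSetoid A 𝔥 𝔟)) :
    resBlock A 𝔥 𝔟 Λ (ModuleCat.of (Env 𝔤 A) (blockPart M Λ)) := by
  refine ⟨resO_of_injective (M := ModuleCat.of (Env 𝔤 A) (blockPart M Λ)) (blockPart M Λ).subtype
    (Submodule.injective_subtype _) hM, fun lam h => ?_⟩
  have := G.isSimpleModule_simpleL (A := A) lam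
  exact mk_eq_of_hasFactor_blockPart G (isSubquotient_iff.mp h)

include G in
/-- There are no nonzero morphisms between different blocks. -/
lemma hom_eq_zero_of_resBlock {N : GMod 𝔤 A} {Λ Λ' : Quotient (resSetoid A 𝔥 𝔟)} (hne : Λ ≠ Λ')
    (hM : resBlock A 𝔥 𝔟 Λ M) (hN : resBlock A 𝔥 𝔟 Λ' N) (f : M →ₗ[Env 𝔤 A] N) : f = 0 := by
  rw [← LinearMap.range_eq_bot]
  by_contra h
  obtain ⟨γ, hγ⟩ := exists_hasFactor G hN.1.1 h
  have := G.isSimpleModule_simpleL (A := A) γ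
  have h1 := hM.2 γ (isSubquotient_iff.mpr
    (hγ.of_surjective f.rangeRestrict f.surjective_rangeRestrict))
  have h2 := hN.2 γ (isSubquotient_iff.mpr
    (hγ.of_injective (LinearMap.range f).subtype (Submodule.injective_subtype _)))
  exact hne (h1.symm.trans h2)

include G in
theorem isEquivalence_blockSum : (blockSum 𝔥 𝔟 A).IsEquivalence := by
  classical
  have hfaithful : (blockSum 𝔥 𝔟 A).Faithful := by
    refine ⟨fun {M N} f g h => ?_⟩
    funext Λ
    apply ObjectProperty.hom_ext
    apply ModuleCat.hom_ext
    refine LinearMap.ext fun m => ?_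
    have h1 : DirectSum.lmap (fun Λ => (f Λ).hom.hom) = DirectSum.lmap fun Λ => (g Λ).hom.hom :=
      congrArg (fun k => k.hom.hom) h
    have h2 := congrArg (fun x => x Λ) (LinearMap.congr_fun h1 (DirectSum.lof (Env 𝔤 A) _ _ Λ m))
    simpa [DirectSum.lmap_apply] using h2
  have hfull : (blockSum 𝔥 𝔟 A).Full := by
    refine ⟨fun {M N} F => ?_⟩
    let F' : (⨁ Λ, (M Λ).obj) →ₗ[Env 𝔤 A] ⨁ Λ, (N Λ).obj := F.hom.hom
    refine ⟨fun Λ => ObjectProperty.homMk (ModuleCat.ofHom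
      (DirectSum.component (Env 𝔤 A) _ (fun Λ => (N Λ).obj) Λ ∘ₗ F' ∘ₗ
        DirectSum.lof (Env 𝔤 A) _ (fun Λ => (M Λ).obj) Λ)), ?_⟩
    apply ObjectProperty.hom_ext
    apply ModuleCat.hom_ext
    change DirectSum.lmap _ = F'
    refine DirectSum.linearMap_ext _ fun Λ => LinearMap.ext fun m => ?_
    refine DFinsupp.ext fun Λ' => ?_
    by_cases h : Λ = Λ'
    · subst h
      rw [LinearMap.comp_apply, DirectSum.lmap_lof]
      exact DirectSum.of_eq_same _ _
    -- Off-diagonal matrix entries of a morphism are maps between different blocks.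
    · have h1 := LinearMap.congr_fun (hom_eq_zero_of_resBlock G h (M Λ).property (N Λ').property
        (DirectSum.component (Env 𝔤 A) _ (fun Λ => (N Λ).obj) Λ' ∘ₗ F' ∘ₗ
          DirectSum.lof (Env 𝔤 A) _ (fun Λ => (M Λ).obj) Λ)) m
      refine Eq.trans ?_ h1.symm
      rw [LinearMap.comp_apply, DirectSum.lmap_lof]
      exact DirectSum.of_eq_of_ne _ _ _ (Ne.symm h)
  have hsurj : (blockSum 𝔥 𝔟 A).EssSurj := by
    refine ⟨fun M => ?_⟩
    let S : Quotient (resSetoid A 𝔥 𝔟) → Submodule (Env 𝔤 A) M.obj := blockPart M.obj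
    have h : DirectSum.IsInternal S := by
      rw [DirectSum.isInternal_submodule_iff_iSupIndep_and_iSup_eq_top]
      exact ⟨blockPart_indep G M.property.1, iSup_blockPart G M.property⟩
    let e : (⨁ Λ, S Λ) ≃ₗ[Env 𝔤 A] M.obj := LinearEquiv.ofBijective (DirectSum.coeLinearMap S) h
    exact ⟨fun Λ => ⟨ModuleCat.of (Env 𝔤 A) (S Λ), resBlock_blockPart G M.property Λ⟩,
      ⟨(resO A 𝔥 𝔟).isoMk e.toModuleIso⟩⟩
  exact { }

end Linkage

end AffineO

end

theorem mainTheorem4 {𝔤 : Type u} [LieRing 𝔤] [LieAlgebra ℂ 𝔤] [FiniteDimensional ℂ 𝔤]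
    [LieAlgebra.IsSimple ℂ 𝔤] (𝔥 𝔟 : LieSubalgebra ℂ 𝔤) [𝔥.IsCartanSubalgebra]
    (h𝔟 : AffineO.IsBorel 𝔟) (h𝔥𝔟 : 𝔥 ≤ 𝔟)
    (A : Type u) [CommRing A] [IsNoetherianRing A] [IsLocalRing A] [Algebra ℂ A]
    [Algebra (SymmetricAlgebra ℂ 𝔥) A] [IsScalarTower ℂ (SymmetricAlgebra ℂ 𝔥) A] :
    (AffineO.blockSum 𝔥 𝔟 A).IsEquivalence := by
  obtain ⟨G⟩ := AffineO.nonempty_grading 𝔥 𝔟 h𝔟 h𝔥𝔟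
  exact AffineO.isEquivalence_blockSum G
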